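/- **Notation.** For a Laurent polynomial $a(z)$ over $\mathbb C$ put $a^*(z)=\overline{a(\bar z^{-1})}$. Let $\mathcal S$ be the set of pairs $(a,b)$ of Laurent polynomials with $aa^*+bb^*=1$ and $0<a^*(0)<\infty$ (so $a^*$ is a polynomial). For $\eta\in(0,1)$ let $\mathcal S_\eta$ be the set of $(a,b)\in\mathcal S$ such that $b$ is a polynomial with $0<\sup_{|z|=1}|b(z)|\le 1-\eta$. A polynomial is outer if it has no zeros in the open unit disk. The ($\mathrm{SU}(2)$) nonlinear Fourier transform of $\boldsymbol\gamma=(\gamma_0,\dots,\gamma_{n-1})\in\mathbb C^n$ is the ordered product $$\overbrace{[\gamma_0,\dots,\gamma_{n-1}]}=\prod_{k=0}^{n-1}\frac1{\sqrt{1+|\gamma_k|^2}}\begin{pmatrix}1&\gamma_kz^k\\-\overline{\gamma_k}z^{-k}&1\end{pmatrix}.$$ $\|\cdot\|$ is the Euclidean norm on $\mathbb C^n$ and the operator norm it induces on matrices; $\log$ is the natural logarithm. **Algorithm (inverse nonlinear FFT of size $n$).** Input: the first $n$ coefficients of two polynomials $a_0^*$ and $b_0$. Output: $\gamma_0,\dots,\gamma_{n-1}$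 and the coefficients of polynomials $\xi_n,\eta_n$ of degree less than $n$. (1) If $n=1$, return $\gamma_0=b_0(0)/a_0^*(0)$, $\xi_1=\gamma_0/\sqrt{1+|\gamma_0|^2}$, $\eta_1=1/\sqrt{1+|\gamma_0|^2}$. (2) If $n\ge2$, let $m=\lceil n/2\rceil$; a recursive call of size $m$ on the first $m$ coefficients of $a_0^*,b_0$ gives $\gamma_0,\dots,\gamma_{m-1}$ and $\xi_m,\eta_m$. (3) With $p^\sharp=z^mp^*$ for $p=\xi_m,\eta_m$, compute the first $n-m$ coefficients of $a_m^*=z^{-m}(\eta_m^\sharp a_0^*+\xi_m^\sharp b_0)$ and $b_m=z^{-m}(\eta_mb_0-\xi_ma_0^*)$. (4) A recursive call of size $n-m$ on these gives $\gamma_m,\dots,\gamma_{n-1}$ and $\xi_{m\to n},\eta_{m\to n}$. (5) Return $\gamma_0,\dots,\gamma_{n-1}$, $\xi_n=\eta_m^\sharp\xi_{m\to n}+\xi_m\eta_{m\to n}$ and $\eta_n=\eta_m\eta_{m\to n}-\xi_m^\sharp\xi_{m\to n}$. All polynomial products are computed with radix-2 FFTs. **Arithmetic.** The algorithm runs in floating-point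 arithmetic with machine precision $u$ in the standard model: every real operation $\circ\in\{+,-,\times,/,\sqrt{\ }\}$ returns $(x\circ y)(1+\delta)$ with some $|\delta|\le u$ that may differ from operation to operation; stored roots of unity are correct to within $u$; complex operations are carried out through real ones. The result may be arbitrary after a division by zero or the square root of a negative number. The input coefficients are taken as exact. **Theorem.** There is a universal constant $C>0$ with the following properties. (i) *(Cost.)* For every $n\ge2$ and every input of size $n$, the algorithm performs at most $C\,n\log^2n$ floating-point operations. Let $\eta\in(0,1)$ and let $(a_0,b_0)\in\mathcal S_\eta$ with $a_0^*$ outer and $\deg b_0<n$. Then there is exactly one $\boldsymbol\gamma\in\mathbb C^n$ with $\overbrace{[\gamma_0,\dots,\gamma_{n-1}]}=\begin{pmatrix}a_0&b_0\\-b_0^*&a_0^*\end{pmatrix}$; let $\hat{\boldsymbol\gamma}$ be any sequence that the algorithm may return in floating-point arithmetic for the input $(a_0^*,b_0)$. (ii) *(Numerical stability.)* For every target precision $0<\epsilon\le\frac12$ and every $r\in\mathbb N$ with $$r\ \ge\ C\left(\log^2n+\log n\,\log\eta^{-1}+\log\epsilon^{-1}\right),$$ machine precision $u=2^{-r}$ gives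 $\|\hat{\boldsymbol\gamma}-\boldsymbol\gamma\|\le\epsilon\,\|\boldsymbol\gamma\|$. That is, $O(\log^2n+\log n\log\eta^{-1}+\log\epsilon^{-1})$ bits suffice. (iii) *(Backward error.)* Let $h(n,\eta)=C\exp\!\big(C(\log^2n+\log n\log\eta^{-1})\big)$. Let $a_{j,k},b_{j,k}$ be the coefficients of $z^j$ in the polynomials $a_k^*,b_k$ defined by exact layer stripping, $$\gamma_k=\frac{b_k(0)}{a_k^*(0)},\qquad a_{k+1}^*=\frac{a_k^*+\overline{\gamma_k}\,b_k}{\sqrt{1+|\gamma_k|^2}},\qquad b_{k+1}=\frac{b_k-\gamma_ka_k^*}{z\sqrt{1+|\gamma_k|^2}},$$ let $\mathbf b_0=(b_{0,0},\dots,b_{n-1,0})^T$, and let $L$ be the unit lower triangular $n\times n$ matrix with entries $L_{ij}=a_{i-j,\,j+1}/a_{0,\,j+1}$ for $0\le j\le i<n$. If the machine precision $u\ge0$ satisfies $C\,n^3\eta^{-3}h(n,\eta)\,u\le1$, then there are a matrix $E$ and a vector $\mathbf q$ with $$(L+E)\hat{\boldsymbol\gamma}=\frac{\mathbf b_0+\mathbf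 q}{a_{0,0}},\qquad \|E\|\le h(n,\eta)\,u\,\|L\|,\qquad \|\mathbf q\|\le h(n,\eta)\,u\,\|\mathbf b_0\|.$$ -/

import Mathlib

open scoped LaurentPolynomial ComplexConjugate Matrix Matrix.Norms.L2Operator

noncomputable section

namespace NLFT

/-! ### Laurent polynomials and the nonlinear Fourier transform -/

/-- The conjugate Laurent polynomial `a*(z) = conj (a (1 / conj z))`: the coefficient of `z ^ k`
in `a*` is the complex conjugate of the coefficient of `z ^ (-k)` in `a`. -/
def conjL (a : ℂ[T;T⁻¹]) : ℂ[T;T⁻¹] :=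
  LaurentPolynomial.invert (AddMonoidAlgebra.mapRingHom ℤ (starRingEnd ℂ) a)

/-- The value of a Laurent polynomial at `z`. (At `z = 0` it is used only for Laurent polynomials
without negative powers.) -/
def evalL (a : ℂ[T;T⁻¹]) (z : ℂ) : ℂ := a.coeff.sum fun k c => c * z ^ k

/-- `a` is a polynomial: it has no negative powers. -/
def IsPoly (a : ℂ[T;T⁻¹]) : Prop := ∀ k : ℤ, k < 0 → a.coeff k = 0

/-- The set `𝒮` of pairs of Laurent polynomials with `a a* + b b* = 1` and `0 < a*(0) < ∞`.
Finiteness of `a*(0)` says that `a*` is a polynomial, and then `a*(0)` is its constant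
coefficient. -/
def S : Set (ℂ[T;T⁻¹] × ℂ[T;T⁻¹]) :=
  {p | p.1 * conjL p.1 + p.2 * conjL p.2 = 1 ∧
    IsPoly (conjL p.1) ∧
    0 < ((conjL p.1).coeff 0).re ∧ ((conjL p.1).coeff 0).im = 0}

/-- The set `𝒮_η`: the pairs in `𝒮` for which `b` is a polynomial with
`0 < sup_{|z| = 1} |b z| ≤ 1 - η`. -/
def SEta (η : ℝ) : Set (ℂ[T;T⁻¹] × ℂ[T;T⁻¹]) :=
  {p | p ∈ S ∧ IsPoly p.2 ∧
    0 < (⨆ z : Circle, ‖evalL p.2 z‖) ∧ (⨆ z : Circle, ‖evalL p.2 z‖) ≤ 1 - η}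

/-- An outer polynomial: no zeros in the open unit disk. -/
def IsOuter (f : ℂ[T;T⁻¹]) : Prop := IsPoly f ∧ ∀ z : ℂ, ‖z‖ < 1 → evalL f z ≠ 0

/-- The matrix `[[a, b], [-b*, a*]]`. -/
def pairMatrix (a b : ℂ[T;T⁻¹]) : Matrix (Fin 2) (Fin 2) ℂ[T;T⁻¹] :=
  !![a, b; -conjL b, conjL a]

/-- The `k`-th factor `(1 + |g|²)^(-1/2) [[1, g z^k], [-conj g z^(-k), 1]]`. -/
def factor (k : ℕ) (g : ℂ) : Matrix (Fin 2) (Fin 2) ℂ[T;T⁻¹] :=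
  LaurentPolynomial.C (((Real.sqrt (1 + ‖g‖ ^ 2))⁻¹ : ℝ) : ℂ) •
    !![1, LaurentPolynomial.C g * LaurentPolynomial.T (k : ℤ);
      -(LaurentPolynomial.C (conj g) * LaurentPolynomial.T (-(k : ℤ))), 1]

/-- The `SU(2)` nonlinear Fourier transform of `[γ_0, …, γ_{n-1}]`: the ordered product of the
factors, from `k = 0` on the left to `k = n - 1` on the right. -/
def nlft {n : ℕ} (γ : Fin n → ℂ) : Matrix (Fin 2) (Fin 2) ℂ[T;T⁻¹] :=
  (List.ofFn fun k : Fin n => factor k (γ k)).prod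

/-- The coefficients of `z ^ 0, z ^ 1, …` of a polynomial. -/
def coeffs (f : ℂ[T;T⁻¹]) : ℕ → ℂ := fun j => f.coeff (j : ℤ)

/-! ### Layer stripping and the matrix `L` -/

/-- The coefficient sequences `(a_{j,k})_j` and `(b_{j,k})_j` of `a_k*` and `b_k`, obtained from
`(a_0*, b_0)` by `k` steps of exact layer stripping. -/
def strip (a b : ℕ → ℂ) : ℕ → (ℕ → ℂ) × (ℕ → ℂ)
  | 0 => (a, b)
  | k + 1 =>
    let A := (strip a b k).1
    let B := (strip a b k).2
    let g := B 0 / A 0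
    let s : ℂ := (Real.sqrt (1 + ‖g‖ ^ 2) : ℝ)
    (fun j => (A j + conj g * B j) / s, fun j => (B (j + 1) - g * A (j + 1)) / s)

/-- The unit lower triangular matrix `L` with entries `a_{i-j, j+1} / a_{0, j+1}` for `j ≤ i`. -/
def matL (n : ℕ) (a b : ℕ → ℂ) : Matrix (Fin n) (Fin n) ℂ :=
  Matrix.of fun i j =>
    if j ≤ i then (strip a b (j + 1)).1 (i - j) / (strip a b (j + 1)).1 0 else 0

/-! ### Floating-point programs

A program with result in `α` assigns to a machine precision `u` the set of all pairs
(result, number of floating-point operations) that its executions can produce, when the result of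
every single operation is subject only to the standard model `fl(x ∘ y) = (x ∘ y)(1 + δ)`,
`|δ| ≤ u`, with a new `δ` for each operation. Copying, indexing, sign changes and complex
conjugation are exact and are not counted. -/

/-- Floating-point programs with result in `α`. -/
def FP (α : Type) : Type := ℝ → Set (α × ℕ)

instance : Monad FP where
  pure x := fun _ => {(x, 0)}
  bind X f := fun u => {p | ∃ q ∈ X u, ∃ s ∈ f q.1 u, p = (s.1, q.2 + s.2)}

/-- One operation, whose possible results at machine precision `u` are the elements of `R u`. -/
def op {α : Type} (R : ℝ → Set α) : FP α := fun u => {p | p.1 ∈ R u ∧ p.2 = 1}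

/-- The possible roundings of `x`. -/
def rnd (x u : ℝ) : Set ℝ := {y | ∃ δ : ℝ, |δ| ≤ u ∧ y = x * (1 + δ)}

def fadd (x y : ℝ) : FP ℝ := op (rnd (x + y))
def fsub (x y : ℝ) : FP ℝ := op (rnd (x - y))
def fmul (x y : ℝ) : FP ℝ := op (rnd (x * y))

/-- Division; a division by zero may return any number. -/
def fdiv (x y : ℝ) : FP ℝ := op fun u => {z | y ≠ 0 → z ∈ rnd (x / y) u}

/-- Square root; the square root of a negative number may return any number. -/
def fsqrt (x : ℝ) : FP ℝ := op fun u => {z | 0 ≤ x → z ∈ rnd (Real.sqrt x) u}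

/-- A stored value of `exp (2 π i x)`, correct to within the machine precision. -/
def fcis (x : ℝ) : FP ℂ :=
  op fun u => {w | ‖w - Complex.exp (2 * Real.pi * x * Complex.I)‖ ≤ u}

/-- Run `f 0, …, f (N - 1)`, one after the other, and collect the results in an array of length
`N` (extended by zero). -/
def loop {α : Type} [Zero α] (N : ℕ) (f : ℕ → FP α) : FP (ℕ → α) := fun u =>
  {p | ∃ c : ℕ → ℕ, (∀ i < N, (p.1 i, c i) ∈ f i u) ∧ (∀ i, N ≤ i → p.1 i = 0) ∧
    p.2 = ∑ i ∈ Finset.range N, c i}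

/-! Complex arithmetic through real arithmetic. -/

def cadd (x y : ℂ) : FP ℂ := do
  let r ← fadd x.re y.re
  let i ← fadd x.im y.im
  return ⟨r, i⟩

def csub (x y : ℂ) : FP ℂ := do
  let r ← fsub x.re y.re
  let i ← fsub x.im y.im
  return ⟨r, i⟩

def cmul (x y : ℂ) : FP ℂ := do
  let p ← fmul x.re y.re
  let q ← fmul x.im y.im
  let r ← fsub p q
  let p' ← fmul x.re y.im
  let q' ← fmul x.im y.re
  let i ← fadd p' q'
  return ⟨r, i⟩

/-- The computed `|x|²`. -/
def cnormSq (x : ℂ) : FP ℝ := do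
  let p ← fmul x.re x.re
  let q ← fmul x.im x.im
  fadd p q

/-- Division of a complex number by a real number. -/
def cdivReal (x : ℂ) (y : ℝ) : FP ℂ := do
  let r ← fdiv x.re y
  let i ← fdiv x.im y
  return ⟨r, i⟩

/-- The quotient `x / y`, computed as `x * conj y / |y|²`. -/
def cdiv (x y : ℂ) : FP ℂ := do
  let p ← cmul x (conj y)
  let q ← cnormSq y
  cdivReal p q

/-! ### Fast polynomial multiplication -/

/-- The radix-2 Cooley–Tukey fast Fourier transform of length `2 ^ t`: the exact result would be
`k ↦ ∑_{j < 2^t} v_j exp(-2 π i j k / 2^t)`. -/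
def fft : (t : ℕ) → (ℕ → ℂ) → FP (ℕ → ℂ)
  | 0, v => return fun i => if i = 0 then v 0 else 0
  | t + 1, v => do
    let E ← fft t fun i => v (2 * i)
    let O ← fft t fun i => v (2 * i + 1)
    let B ← loop (2 ^ t) fun k => do
      let w ← fcis (-(k : ℝ) / 2 ^ (t + 1))
      let p ← cmul w (O k)
      let x ← cadd (E k) p
      let y ← csub (E k) p
      return (x, y)
    return fun i => if i < 2 ^ t then (B i).1 else (B (i - 2 ^ t)).2

/-- The inverse fast Fourier transform of length `2 ^ t`. -/
def ifft (t : ℕ) (v : ℕ → ℂ) : FP (ℕ → ℂ) := do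
  let w ← fft t fun i => conj (v i)
  loop (2 ^ t) fun i => cdivReal (conj (w i)) (2 ^ t)

/-- `IFFT (FFT p · FFT q ∘ FFT r · FFT s)` with transforms of length `2 ^ t`, where `∘` is an
addition or subtraction `o`. -/
def conv2 (t : ℕ) (o : ℂ → ℂ → FP ℂ) (p q r s : ℕ → ℂ) : FP (ℕ → ℂ) := do
  let P ← fft t p
  let Q ← fft t q
  let R ← fft t r
  let S ← fft t s
  let V ← loop (2 ^ t) fun i => do
    let x ← cmul (P i) (Q i)
    let y ← cmul (R i) (S i)
    o x y
  ifft t V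

/-! ### The inverse nonlinear fast Fourier transform -/

/-- The first `n` coefficients of `f`, that is, `f` modulo `z ^ n`. -/
def take (n : ℕ) (f : ℕ → ℂ) : ℕ → ℂ := fun i => if i < n then f i else 0

/-- The coefficients of `p♯(z) = z ^ m p*(z)` for a polynomial `p` of degree at most `m`. -/
def sharp (m : ℕ) (p : ℕ → ℂ) : ℕ → ℂ := fun i => if i ≤ m then conj (p (m - i)) else 0

/-- The output of the algorithm: the sequence `γ_0, …, γ_{n-1}` and the coefficients of the
polynomials `ξ_n` and `η_n`. -/
structure Output where
  γ : ℕ → ℂ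
  ξ : ℕ → ℂ
  η : ℕ → ℂ

/-- The divide-and-conquer inverse nonlinear FFT of size `n`, applied to the first `n`
coefficients of `a_0*` and `b_0`. -/
def invNLFFT (n : ℕ) (a b : ℕ → ℂ) : FP Output :=
  if _h : n ≤ 1 then do
    let g ← cdiv (b 0) (a 0)
    let q ← cnormSq g
    let d ← fadd 1 q
    let s ← fsqrt d
    let x ← cdivReal g s
    let e ← fdiv 1 s
    return ⟨Pi.single 0 g, Pi.single 0 x, Pi.single 0 (e : ℂ)⟩
  else do
    let m := (n + 1) / 2
    let up ← invNLFFT m a b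
    let t := Nat.clog 2 (n + m)
    let A ← conv2 t cadd (sharp m up.η) (take n a) (sharp m up.ξ) (take n b)
    let B ← conv2 t csub up.η (take n b) up.ξ (take n a)
    let down ← invNLFFT (n - m) (take (n - m) fun i => A (m + i)) (take (n - m) fun i => B (m + i))
    let t' := Nat.clog 2 n
    let X ← conv2 t' cadd (sharp m up.η) down.ξ up.ξ down.η
    let Y ← conv2 t' csub up.η down.η (sharp m up.ξ) down.ξ
    return ⟨fun i => if i < m then up.γ i else down.γ (i - m), take n X, take n Y⟩
termination_by n
decreasing_by all_goals omega

/-- The Euclidean norm of a vector in `ℂ^n`. -/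
def norm2 {n : ℕ} (v : Fin n → ℂ) : ℝ := ‖WithLp.toLp 2 v‖

/-- The growth function `h(n, η) = C exp (C (log² n + log n log η⁻¹))`. -/
def growth (C : ℝ) (n : ℕ) (η : ℝ) : ℝ :=
  C * Real.exp (C * (Real.log n ^ 2 + Real.log n * Real.log η⁻¹))

end NLFT

end

/-! The operation count is the usual one for divide and conquer: a bounded number of FFTs at every
node, hence `O(n log n)` per level and `O(log n)` levels.

For the rounding errors, crude bounds suffice. If each level of the recursion multiplies the error
by a fixed power of `R = 8 n η⁻¹`, then `⌈log₂ n⌉` levels multiply it by `R ^ O(log n)`, which is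
`exp (O(log² n + log n log η⁻¹))`. A bound for one fast convolution that is polynomial in its length
is therefore enough (`ens_fft`, `ens_conv2`). The real task is to show that the conditioning
survives the recursion.

Layer stripping is the action of polynomial matrices `quad γ k`, of determinant `X ^ k`, on pairs
`(f, h)` of power series, applied to `(a_0*, b_0)`. For the exact sequence both components of the
result are divisible by `X ^ k`. The matrices are built from rotations and shifts, so the action and
its adjoint contract the `ℓ²` norm of coefficients. Conditioning is expressed by a Bezout pair, `f x
+ h y ≈ 1` with `x`, `y` of norm at most `R` (`Good`). Initially `x = 1 / a_0*` and `y = 0`: since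
`a_0*` is outer and at least `η` in modulus on the circle, Cauchy's estimate bounds the coefficients
of `x` by `η⁻¹` (`exists_reciprocal`). The adjoint action carries the Bezout pair to the second half
of the recursion without enlarging it (`Good.down`). The pair also forces `ξ = O(h)` (`Good.xi_le`),
so errors in the `ξ` component stay proportional to the size of `b_0`, and the final bound is
relative.

The induction (`ens_invNLFFT`) does not compare the computed sequence with the exact one. It shows
that the returned polynomials are close to those of the computed sequence, and that every initial
segment of that sequence nearly annihilates the input (`Accurate`). Such statements compose under
the product law `quad_add`. Only at the end is the small residual turned into an error of `γ`
(`coeff_difference`, `seq_error`).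

Layer stripping also gives the triangular system `L γ = b_0 / a_{0,0}` (`matL_mulVec`). As the
entries of `a_{0,0} L` are at most 1 in modulus, `b_0` is bounded by a polynomial in `n` times `γ`,
which makes the forward error relative to `γ`. A perturbation of `L` by `L` times a rank-one matrix
then turns the forward error into a backward error with `q = 0` (`exists_backward_error`). Existence
and uniqueness of `γ` hold because layer stripping inverts the transform (`nlft_stripSeq`,
`exists_of_nlft`). -/

noncomputable section

namespace NLFT

/-! ### Reasoning about floating-point programs -/

/-- Every execution of `X` uses at most `c` operations. -/
def CostLE {α : Type} (X : FP α) (u : ℝ) (c : ℕ) : Prop := ∀ p ∈ X u, p.2 ≤ c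

/-- Every result of `X` satisfies `P`. -/
def Ensures {α : Type} (X : FP α) (u : ℝ) (P : α → Prop) : Prop := ∀ p ∈ X u, P p.1

section rules

variable {α β : Type} {u : ℝ}

theorem CostLE.pure (x : α) : CostLE (Pure.pure x : FP α) u 0 := by
  rintro p rfl
  exact le_rfl

theorem CostLE.bind {X : FP α} {f : α → FP β} {c d : ℕ} (hX : CostLE X u c)
    (hf : ∀ a, CostLE (f a) u d) : CostLE (X >>= f) u (c + d) := by
  rintro p ⟨q, hq, s, hs, rfl⟩
  exact Nat.add_le_add (hX q hq) (hf _ s hs)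

theorem CostLE.mono {X : FP α} {c d : ℕ} (hX : CostLE X u c) (h : c ≤ d) : CostLE X u d :=
  fun p hp => (hX p hp).trans h

theorem CostLE.op (R : ℝ → Set α) : CostLE (op R) u 1 := fun _ hp => hp.2.le

theorem CostLE.loop [Zero α] {N c : ℕ} {f : ℕ → FP α} (h : ∀ i, CostLE (f i) u c) :
    CostLE (loop N f) u (N * c) := by
  rintro p ⟨k, h1, -, h3⟩
  rw [h3]
  calc ∑ i ∈ Finset.range N, k i ≤ ∑ _i ∈ Finset.range N, c :=
        Finset.sum_le_sum fun i hi => h i _ (h1 i (Finset.mem_range.1 hi))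
    _ = N * c := by simp

theorem Ensures.pure {P : α → Prop} {x : α} (h : P x) : Ensures (Pure.pure x : FP α) u P := by
  rintro p rfl
  exact h

theorem Ensures.bind {X : FP α} {f : α → FP β} {P : α → Prop} {Q : β → Prop}
    (hX : Ensures X u P) (hf : ∀ a, P a → Ensures (f a) u Q) : Ensures (X >>= f) u Q := by
  rintro p ⟨q, hq, s, hs, rfl⟩
  exact hf _ (hX q hq) s hs

theorem Ensures.mono {X : FP α} {P Q : α → Prop} (hX : Ensures X u P) (h : ∀ a, P a → Q a) :
    Ensures X u Q :=
  fun p hp => h _ (hX p hp)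

theorem Ensures.loop [Zero α] {N : ℕ} {f : ℕ → FP α} {P : ℕ → α → Prop}
    (h : ∀ i < N, Ensures (f i) u (P i)) :
    Ensures (loop N f) u fun r => (∀ i < N, P i (r i)) ∧ ∀ i, N ≤ i → r i = 0 := by
  rintro p ⟨k, h1, h2, -⟩
  exact ⟨fun i hi => h i hi _ (h1 i hi), h2⟩

end rules

/-! ### The operation count -/

section cost

variable {u : ℝ}

theorem cost_cadd (x y : ℂ) : CostLE (cadd x y) u 2 :=
  (CostLE.op _).bind fun _ => (CostLE.op _).bind fun _ => CostLE.pure _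

theorem cost_csub (x y : ℂ) : CostLE (csub x y) u 2 :=
  (CostLE.op _).bind fun _ => (CostLE.op _).bind fun _ => CostLE.pure _

theorem cost_cmul (x y : ℂ) : CostLE (cmul x y) u 6 :=
  (CostLE.op _).bind fun _ => (CostLE.op _).bind fun _ => (CostLE.op _).bind fun _ =>
    (CostLE.op _).bind fun _ => (CostLE.op _).bind fun _ => (CostLE.op _).bind fun _ =>
      CostLE.pure _

theorem cost_cnormSq (x : ℂ) : CostLE (cnormSq x) u 3 :=
  (CostLE.op _).bind fun _ => (CostLE.op _).bind fun _ => CostLE.op _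

theorem cost_cdivReal (x : ℂ) (y : ℝ) : CostLE (cdivReal x y) u 2 :=
  (CostLE.op _).bind fun _ => (CostLE.op _).bind fun _ => CostLE.pure _

theorem cost_cdiv (x y : ℂ) : CostLE (cdiv x y) u 11 :=
  (cost_cmul _ _).bind fun _ => (cost_cnormSq _).bind fun _ => cost_cdivReal _ _

/-- A butterfly takes 11 operations: one stored root, six for the complex product, two each for the
sum and the difference. -/
theorem cost_fft (t : ℕ) : ∀ v, CostLE (fft t v) u (11 * t * 2 ^ t) := by
  induction t with
  | zero => exact fun v => (CostLE.pure _).mono (Nat.zero_le _)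
  | succ t ih =>
    intro v
    refine CostLE.mono ((ih _).bind (d := 11 * t * 2 ^ t + (2 ^ t * 11 + 0)) fun E =>
      (ih _).bind fun O => (CostLE.loop (c := 11) fun k => ?_).bind fun B => CostLE.pure _) ?_
    · exact (CostLE.op _).bind (d := 10) fun w => (cost_cmul _ _).bind (d := 4) fun p =>
        (cost_cadd _ _).bind (d := 2) fun x => (cost_csub _ _).bind fun y => CostLE.pure _
    · rw [pow_succ]
      nlinarith [Nat.zero_le (2 ^ t)]

theorem cost_ifft (t : ℕ) (v : ℕ → ℂ) : CostLE (ifft t v) u (11 * t * 2 ^ t + 2 ^ t * 2) :=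
  (cost_fft t _).bind fun _ => CostLE.loop fun _ => cost_cdivReal _ _

theorem cost_conv2 (t : ℕ) {o : ℂ → ℂ → FP ℂ} (ho : ∀ x y, CostLE (o x y) u 2)
    (p q r s : ℕ → ℂ) : CostLE (conv2 t o p q r s) u (71 * ((t + 1) * 2 ^ t)) := by
  refine CostLE.mono ((cost_fft t _).bind fun _ => (cost_fft t _).bind fun _ =>
    (cost_fft t _).bind fun _ => (cost_fft t _).bind fun _ =>
      (CostLE.loop (c := 14) fun i => ?_).bind fun V => cost_ifft t V) ?_
  · exact (cost_cmul _ _).bind (d := 8) fun x => (cost_cmul _ _).bind fun y => ho x y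
  · nlinarith [Nat.zero_le (2 ^ t), Nat.zero_le (t * 2 ^ t)]

theorem two_pow_clog_le {n : ℕ} (hn : 1 ≤ n) : 2 ^ Nat.clog 2 n ≤ 2 * n := by
  rcases hn.eq_or_lt with rfl | h
  · simp
  · have := Nat.pow_pred_clog_lt_self (b := 2) one_lt_two h
    have hc : Nat.clog 2 n = (Nat.clog 2 n).pred + 1 :=
      (Nat.succ_pred_eq_of_pos (Nat.clog_pos one_lt_two h)).symm
    rw [hc, pow_succ]
    omega

theorem clog_half_lt {n m : ℕ} (hn : 2 ≤ n) (hm : m ≤ (n + 1) / 2) :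
    Nat.clog 2 m + 1 ≤ Nat.clog 2 n := by
  rw [Nat.clog_of_two_le one_lt_two hn]
  gcongr
  exact hm

theorem clog_two_mul {n : ℕ} (hn : 1 ≤ n) : Nat.clog 2 (2 * n) = Nat.clog 2 n + 1 := by
  rw [Nat.clog_of_two_le one_lt_two (by omega)]
  congr 2
  omega

/-- Each node performs four convolutions of at most `284 (c + 2) n` operations, where `c` is the
rounded-up binary logarithm of `n`; this is the origin of `1136 = 4 * 284`. -/
theorem cost_invNLFFT (n : ℕ) (hn : 1 ≤ n) :
    ∀ a b, CostLE (invNLFFT n a b) u (1136 * (n * (Nat.clog 2 n + 1) ^ 2)) := by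
  induction n using Nat.strong_induction_on with
  | _ n ih =>
    intro a b
    rw [invNLFFT]
    split_ifs with h
    · refine CostLE.mono ((cost_cdiv _ _).bind (d := 8) fun g => (cost_cnormSq _).bind (d := 5)
        fun q => (CostLE.op _).bind (d := 4) fun d => (CostLE.op _).bind (d := 3) fun s =>
          (cost_cdivReal _ _).bind (d := 1) fun x => (CostLE.op _).bind fun e => CostLE.pure _) ?_
      obtain rfl : n = 1 := by omega
      simp
    · have hm : 1 ≤ (n + 1) / 2 := by omega
      have hm' : 1 ≤ n - (n + 1) / 2 := by omega
      set m := (n + 1) / 2 with hmdef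
      have hconv : ∀ {t : ℕ} {o : ℂ → ℂ → FP ℂ}, (∀ x y, CostLE (o x y) u 2) →
          t ≤ Nat.clog 2 n + 1 → ∀ p q r s : ℕ → ℂ,
            CostLE (conv2 t o p q r s) u (284 * ((Nat.clog 2 n + 2) * n)) := by
        intro t o ho ht p q r s
        refine (cost_conv2 t ho p q r s).mono ?_
        have h1 : 2 ^ t ≤ 4 * n := by
          calc 2 ^ t ≤ 2 ^ (Nat.clog 2 n + 1) := Nat.pow_le_pow_right (by norm_num) ht
            _ = 2 ^ Nat.clog 2 n * 2 := pow_succ _ _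
            _ ≤ 4 * n := by have := two_pow_clog_le (n := n) (by omega); omega
        calc 71 * ((t + 1) * 2 ^ t) ≤ 71 * ((Nat.clog 2 n + 2) * (4 * n)) :=
              Nat.mul_le_mul le_rfl (Nat.mul_le_mul (by omega) h1)
          _ = _ := by ring
      have ht : Nat.clog 2 (n + m) ≤ Nat.clog 2 n + 1 := by
        rw [← clog_two_mul (by omega)]
        exact Nat.clog_mono_right 2 (by omega)
      refine CostLE.mono ((ih m (by omega) hm _ _).bind fun up =>
        (hconv cost_cadd ht _ _ _ _).bind fun A => (hconv cost_csub ht _ _ _ _).bind fun B =>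
          (ih (n - m) (by omega) hm' _ _).bind fun down =>
            (hconv cost_cadd (Nat.le_succ _) _ _ _ _).bind fun X =>
              (hconv cost_csub (Nat.le_succ _) _ _ _ _).bind fun Y => CostLE.pure _) ?_
      -- Halving lowers the rounded-up logarithm by one, so the two calls use at most `n c ^ 2` of
      -- the budget `n (c + 1) ^ 2`. The remaining `n (2 c + 1)` pays for the convolutions because
      -- `c ≥ 1`.
      have h1 := clog_half_lt (n := n) (m := m) (by omega) le_rfl
      have h2 := clog_half_lt (n := n) (m := n - m) (by omega) (by omega)
      set c := Nat.clog 2 n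
      have h3 : m * (Nat.clog 2 m + 1) ^ 2 ≤ m * c ^ 2 := by gcongr
      have h4 : (n - m) * (Nat.clog 2 (n - m) + 1) ^ 2 ≤ (n - m) * c ^ 2 := by gcongr
      have h5 : m * c ^ 2 + (n - m) * c ^ 2 = n * c ^ 2 := by
        rw [← add_mul]; congr 1; omega
      have h6 : (c + 2) * n + n * c ^ 2 ≤ n * (c + 1) ^ 2 := by
        have : n * 1 ≤ n * c := Nat.mul_le_mul le_rfl (by omega)
        nlinarith
      omega

/-- From `2 ^ clog ≤ 2 n` one gets `clog * log 2 ≤ 2 log n`, and `2 / log 2 < 3`. -/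
theorem clog_le_three_mul_log {n : ℕ} (hn : 2 ≤ n) : (Nat.clog 2 n : ℝ) ≤ 3 * Real.log n := by
  have h1 : (2 : ℝ) ^ Nat.clog 2 n ≤ 2 * n := by
    exact_mod_cast two_pow_clog_le (n := n) (by omega)
  have h2 := Real.log_le_log (by positivity) h1
  have hn' : (2 : ℝ) ≤ n := by exact_mod_cast hn
  rw [Real.log_pow, Real.log_mul (by norm_num) (by positivity)] at h2
  have h3 : Real.log 2 ≤ Real.log n := Real.log_le_log (by norm_num) hn'
  have h4 := Real.log_two_gt_d9
  have h5 := Real.log_two_lt_d9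
  nlinarith [(Nat.cast_nonneg (Nat.clog 2 n) : (0 : ℝ) ≤ _)]

theorem cost_invNLFFT_log {n : ℕ} (hn : 2 ≤ n) (a b : ℕ → ℂ) :
    ∀ out ∈ invNLFFT n a b u, (out.2 : ℝ) ≤ 28400 * (n * Real.log n ^ 2) := by
  intro out ho
  have h1 : (out.2 : ℝ) ≤ 1136 * (n * ((Nat.clog 2 n : ℝ) + 1) ^ 2) := by
    exact_mod_cast cost_invNLFFT n (by omega) a b out ho
  have h2 := clog_le_three_mul_log hn
  have hn' : (2 : ℝ) ≤ n := by exact_mod_cast hn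
  have h3 : Real.log 2 ≤ Real.log n := Real.log_le_log (by norm_num) hn'
  have h4 := Real.log_two_gt_d9
  have h5 : ((Nat.clog 2 n : ℝ) + 1) ^ 2 ≤ (5 * Real.log n) ^ 2 := by
    gcongr
    linarith
  calc (out.2 : ℝ) ≤ 1136 * (n * (5 * Real.log n) ^ 2) := h1.trans (by gcongr)
    _ = _ := by ring

end cost

/-! ### Rounding errors of the complex operations -/

section rounding

variable {u : ℝ}

theorem abs_sub_le_of_mem_rnd {x y : ℝ} (h : y ∈ rnd x u) : |y - x| ≤ u * |x| := by
  obtain ⟨δ, hδ, rfl⟩ := h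
  rw [show x * (1 + δ) - x = δ * x by ring, abs_mul]
  gcongr

theorem norm_le_of_re_im {z w : ℂ} {c : ℝ} (hc : 0 ≤ c) (hr : |z.re| ≤ c * |w.re|)
    (hi : |z.im| ≤ c * |w.im|) : ‖z‖ ≤ c * ‖w‖ := by
  refine le_of_sq_le_sq ?_ (by positivity)
  rw [mul_pow, Complex.sq_norm, Complex.sq_norm, Complex.normSq_apply, Complex.normSq_apply]
  have h1 := pow_le_pow_left₀ (abs_nonneg _) hr 2
  have h2 := pow_le_pow_left₀ (abs_nonneg _) hi 2
  rw [mul_pow, sq_abs, sq_abs] at h1 h2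
  linarith

theorem ens_op {α : Type} {R : ℝ → Set α} {P : α → Prop} (h : ∀ x ∈ R u, P x) :
    Ensures (op R) u P := fun _ hp => h _ hp.1

theorem ens_rnd (x : ℝ) : Ensures (op (rnd x)) u fun r => |r - x| ≤ u * |x| :=
  ens_op fun _ => abs_sub_le_of_mem_rnd

theorem ens_fdiv {x y : ℝ} (hy : y ≠ 0) :
    Ensures (fdiv x y) u fun r => |r - x / y| ≤ u * |x / y| :=
  ens_op fun _ h => abs_sub_le_of_mem_rnd (h hy)

theorem ens_fsqrt (x : ℝ) :
    Ensures (fsqrt x) u fun r => 0 ≤ x → |r - Real.sqrt x| ≤ u * |Real.sqrt x| :=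
  ens_op fun _ h hx => abs_sub_le_of_mem_rnd (h hx)

theorem ens_cadd (hu : 0 ≤ u) (x y : ℂ) :
    Ensures (cadd x y) u fun r => ‖r - (x + y)‖ ≤ u * ‖x + y‖ :=
  (ens_rnd _).bind fun _ hr => (ens_rnd _).bind fun _ hi =>
    Ensures.pure (norm_le_of_re_im hu (by simpa using hr) (by simpa using hi))

theorem ens_csub (hu : 0 ≤ u) (x y : ℂ) :
    Ensures (csub x y) u fun r => ‖r - (x - y)‖ ≤ u * ‖x - y‖ :=
  (ens_rnd _).bind fun _ hr => (ens_rnd _).bind fun _ hi =>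
    Ensures.pure (norm_le_of_re_im hu (by simpa using hr) (by simpa using hi))

theorem ens_cdivReal (hu : 0 ≤ u) (x : ℂ) {y : ℝ} (hy : y ≠ 0) :
    Ensures (cdivReal x y) u fun r => ‖r - x / y‖ ≤ u * ‖x / y‖ :=
  (ens_fdiv hy).bind fun _ hr => (ens_fdiv hy).bind fun _ hi =>
    Ensures.pure (norm_le_of_re_im hu (by simpa using hr) (by simpa using hi))

theorem abs_sub_add_le_of_rounded {a b p q r : ℝ} (hu : 0 ≤ u) (hu1 : u ≤ 1)
    (hp : |p - a| ≤ u * |a|) (hq : |q - b| ≤ u * |b|) (hr : |r - (p + q)| ≤ u * |p + q|) :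
    |r - (a + b)| ≤ 3 * u * (|a| + |b|) := by
  have h1 : |p + q| ≤ 2 * (|a| + |b|) := by
    have hp' : |p| ≤ |p - a| + |a| := by simpa using abs_add_le (p - a) a
    have hq' : |q| ≤ |q - b| + |b| := by simpa using abs_add_le (q - b) b
    nlinarith [abs_add_le p q, abs_nonneg a, abs_nonneg b]
  calc |r - (a + b)| = |(r - (p + q)) + ((p - a) + (q - b))| := by congr 1; ring
    _ ≤ u * |p + q| + (u * |a| + u * |b|) :=
        (abs_add_le _ _).trans (add_le_add hr ((abs_add_le _ _).trans (add_le_add hp hq)))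
    _ ≤ u * (2 * (|a| + |b|)) + (u * |a| + u * |b|) := by gcongr
    _ = _ := by ring

theorem abs_mul_add_abs_mul_le (a b c d : ℝ) :
    |a * c| + |b * d| ≤ ‖(⟨a, b⟩ : ℂ)‖ * ‖(⟨c, d⟩ : ℂ)‖ := by
  refine le_of_sq_le_sq ?_ (by positivity)
  rw [mul_pow, Complex.sq_norm, Complex.sq_norm, Complex.normSq_mk, Complex.normSq_mk, abs_mul,
    abs_mul, ← abs_mul_abs_self a, ← abs_mul_abs_self b, ← abs_mul_abs_self c,
    ← abs_mul_abs_self d]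
  nlinarith [sq_nonneg (|a| * |d| - |b| * |c|)]

theorem norm_swap (a b : ℝ) : ‖(⟨a, b⟩ : ℂ)‖ = ‖(⟨b, a⟩ : ℂ)‖ := by
  rw [Complex.norm_def, Complex.norm_def, Complex.normSq_mk, Complex.normSq_mk, add_comm]

theorem ens_cmul (hu : 0 ≤ u) (hu1 : u ≤ 1) (x y : ℂ) :
    Ensures (cmul x y) u fun r => ‖r - x * y‖ ≤ 6 * u * (‖x‖ * ‖y‖) := by
  refine (ens_rnd _).bind fun p hp => (ens_rnd _).bind fun q hq => (ens_rnd _).bind fun r hr =>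
    (ens_rnd _).bind fun p' hp' => (ens_rnd _).bind fun q' hq' => (ens_rnd _).bind fun i hi =>
      Ensures.pure ?_
  have h1 : |r - (x.re * y.re + -(x.im * y.im))| ≤ _ :=
    abs_sub_add_le_of_rounded (q := -q) hu hu1 hp
      (by rw [abs_neg, neg_sub_neg, abs_sub_comm]; exact hq) (by rwa [← sub_eq_add_neg])
  have h2 := abs_sub_add_le_of_rounded hu hu1 hp' hq' hi
  have h3 : |x.re * y.re| + |x.im * y.im| ≤ ‖x‖ * ‖y‖ := abs_mul_add_abs_mul_le _ _ _ _
  have h4 : |x.re * y.im| + |x.im * y.re| ≤ ‖x‖ * ‖y‖ := by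
    have := abs_mul_add_abs_mul_le x.re x.im y.im y.re
    rwa [norm_swap y.im] at this
  rw [abs_neg] at h1
  refine (Complex.norm_le_abs_re_add_abs_im _).trans ?_
  have e1 : ((⟨r, i⟩ : ℂ) - x * y).re = r - (x.re * y.re + -(x.im * y.im)) := by
    simp [Complex.mul_re, sub_eq_add_neg]
  have e2 : ((⟨r, i⟩ : ℂ) - x * y).im = i - (x.re * y.im + x.im * y.re) := by
    simp [Complex.mul_im]
  rw [e1, e2]
  calc _ ≤ 3 * u * (‖x‖ * ‖y‖) + 3 * u * (‖x‖ * ‖y‖) :=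
        add_le_add (h1.trans (by gcongr)) (h2.trans (by gcongr))
    _ = _ := by ring

theorem ens_cnormSq (hu : 0 ≤ u) (hu1 : u ≤ 1) (x : ℂ) :
    Ensures (cnormSq x) u fun r => |r - ‖x‖ ^ 2| ≤ 3 * u * ‖x‖ ^ 2 := by
  refine (ens_rnd _).bind fun p hp => (ens_rnd _).bind fun q hq =>
    (ens_rnd _).mono fun r hr => ?_
  have h := abs_sub_add_le_of_rounded hu hu1 hp hq hr
  rw [abs_mul_self, abs_mul_self] at h
  rwa [Complex.sq_norm, Complex.normSq_apply]

end rounding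

/-! ### The discrete Fourier transform -/

/-- The primitive character `k ↦ exp (-2 π i k / 2 ^ t)`. -/
def root (t : ℕ) (k : ℕ) : ℂ := Complex.exp (2 * Real.pi * ((-(k : ℝ) / 2 ^ t : ℝ)) * Complex.I)

/-- The exact discrete Fourier transform of length `2 ^ t`. -/
def dft (t : ℕ) (v : ℕ → ℂ) (k : ℕ) : ℂ := ∑ j ∈ Finset.range (2 ^ t), v j * root t (j * k)

theorem norm_root (t k : ℕ) : ‖root t k‖ = 1 := by
  rw [root, show (2 * Real.pi * ((-(k : ℝ) / 2 ^ t : ℝ)) * Complex.I : ℂ) =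
    ((2 * Real.pi * (-(k : ℝ) / 2 ^ t) : ℝ) : ℂ) * Complex.I by push_cast; ring,
    Complex.norm_exp_ofReal_mul_I]

theorem root_add (t k l : ℕ) : root t (k + l) = root t k * root t l := by
  rw [root, root, root, ← Complex.exp_add]
  congr 1
  push_cast
  ring

theorem root_zero (t : ℕ) : root t 0 = 1 := by simp [root]

theorem root_mul (t k l : ℕ) : root t (k * l) = root t k ^ l := by
  induction l with
  | zero => simp [root_zero]
  | succ l ih => rw [Nat.mul_succ, root_add, ih, pow_succ]

theorem root_two_pow_mul (t k : ℕ) : root t (2 ^ t * k) = 1 := by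
  rw [root, Complex.exp_eq_one_iff]
  refine ⟨-k, ?_⟩
  push_cast
  field_simp

theorem root_succ_two_mul (t k : ℕ) : root (t + 1) (2 * k) = root t k := by
  rw [root, root]
  congr 3
  push_cast
  rw [pow_succ]
  field_simp

theorem root_succ_two_pow (t : ℕ) : root (t + 1) (2 ^ t) = -1 := by
  rw [root, show (2 * Real.pi * ((-((2 ^ t : ℕ) : ℝ) / 2 ^ (t + 1) : ℝ)) * Complex.I : ℂ) =
    -(Real.pi * Complex.I) by push_cast; rw [pow_succ]; field_simp, Complex.exp_neg,
    Complex.exp_pi_mul_I]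
  norm_num

theorem root_eq_one_iff (t k : ℕ) : root t k = 1 ↔ 2 ^ t ∣ k := by
  constructor
  · intro h
    rw [root, Complex.exp_eq_one_iff] at h
    obtain ⟨n, hn⟩ := h
    have h1 : (2 * Real.pi * Complex.I : ℂ) ≠ 0 := by simp [Real.pi_ne_zero]
    have h2 : ((-(k : ℝ) / 2 ^ t : ℝ) : ℂ) = n := by
      apply mul_right_cancel₀ h1
      rw [← hn]
      ring
    have h3 : (-(k : ℝ) / 2 ^ t : ℝ) = n := by exact_mod_cast h2
    have h4 : (k : ℝ) = ((2 ^ t * (-n) : ℤ) : ℝ) := by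
      push_cast
      field_simp at h3
      linarith
    have h5 : (k : ℤ) = 2 ^ t * (-n) := by exact_mod_cast h4
    have h6 : ((2 ^ t : ℕ) : ℤ) ∣ k := ⟨-n, by push_cast; exact h5⟩
    exact Int.natCast_dvd_natCast.1 h6
  · rintro ⟨l, rfl⟩
    exact root_two_pow_mul t l

theorem sum_range_two_mul (f : ℕ → ℂ) (N : ℕ) :
    ∑ j ∈ Finset.range (2 * N), f j =
      ∑ j ∈ Finset.range N, f (2 * j) + ∑ j ∈ Finset.range N, f (2 * j + 1) := by
  induction N with
  | zero => simp
  | succ N ih =>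
    rw [Nat.mul_succ, Finset.sum_range_succ, Finset.sum_range_succ, ih, Finset.sum_range_succ,
      Finset.sum_range_succ]
    ring

theorem dft_succ (t : ℕ) (v : ℕ → ℂ) (k : ℕ) :
    dft (t + 1) v k = dft t (fun i => v (2 * i)) k +
      root (t + 1) k * dft t (fun i => v (2 * i + 1)) k := by
  rw [dft, pow_succ', sum_range_two_mul, dft, dft, Finset.mul_sum]
  congr 1
  · refine Finset.sum_congr rfl fun j _ => ?_
    rw [mul_assoc, root_succ_two_mul]
  · refine Finset.sum_congr rfl fun j _ => ?_
    rw [add_mul, one_mul, root_add, mul_assoc, root_succ_two_mul]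
    ring

theorem dft_add_two_pow (t : ℕ) (v : ℕ → ℂ) (k : ℕ) : dft t v (k + 2 ^ t) = dft t v k := by
  refine Finset.sum_congr rfl fun j _ => ?_
  rw [mul_add, root_add, mul_comm j (2 ^ t), root_two_pow_mul, mul_one]

theorem dft_succ_add (t : ℕ) (v : ℕ → ℂ) (k : ℕ) :
    dft (t + 1) v (k + 2 ^ t) = dft t (fun i => v (2 * i)) k -
      root (t + 1) k * dft t (fun i => v (2 * i + 1)) k := by
  rw [dft_succ, dft_add_two_pow, dft_add_two_pow, root_add, root_succ_two_pow]
  ring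

/-- The `ℓ¹` norm of the first `n` entries. -/
def sum1 (n : ℕ) (v : ℕ → ℂ) : ℝ := ∑ i ∈ Finset.range n, ‖v i‖

theorem sum1_nonneg (n : ℕ) (v : ℕ → ℂ) : 0 ≤ sum1 n v :=
  Finset.sum_nonneg fun _ _ => norm_nonneg _

theorem norm_dft_le (t : ℕ) (v : ℕ → ℂ) (k : ℕ) : ‖dft t v k‖ ≤ sum1 (2 ^ t) v := by
  refine (norm_sum_le _ _).trans (le_of_eq (Finset.sum_congr rfl fun j _ => ?_))
  rw [norm_mul, norm_root, mul_one]

theorem sum1_two_pow_succ (t : ℕ) (v : ℕ → ℂ) :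
    sum1 (2 ^ (t + 1)) v =
      sum1 (2 ^ t) (fun i => v (2 * i)) + sum1 (2 ^ t) fun i => v (2 * i + 1) := by
  have h : ∀ N, ∑ j ∈ Finset.range (2 * N), ‖v j‖ =
      ∑ j ∈ Finset.range N, ‖v (2 * j)‖ + ∑ j ∈ Finset.range N, ‖v (2 * j + 1)‖ := by
    intro N
    induction N with
    | zero => simp
    | succ N ih =>
      rw [Nat.mul_succ, Finset.sum_range_succ, Finset.sum_range_succ, ih, Finset.sum_range_succ,
        Finset.sum_range_succ]
      ring
  rw [sum1, pow_succ']
  exact h _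

/-- A butterfly, with errors in all inputs. -/
theorem butterfly_error {u ε Se So : ℝ} (hu : 0 ≤ u) (hu1 : u ≤ 1) (hε : 0 ≤ ε)
    {E O w E' O' w' p x : ℂ} (hw : ‖w‖ = 1) (hE : ‖E‖ ≤ Se) (hO : ‖O‖ ≤ So)
    (hE' : ‖E' - E‖ ≤ ε * Se) (hO' : ‖O' - O‖ ≤ ε * So) (hw' : ‖w' - w‖ ≤ u)
    (hp : ‖p - w' * O'‖ ≤ 6 * u * (‖w'‖ * ‖O'‖)) {σ : ℂ} (hσ : ‖σ‖ = 1)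
    (hx : ‖x - (E' + σ * p)‖ ≤ u * ‖E' + σ * p‖) :
    ‖x - (E + σ * (w * O))‖ ≤ (ε + 27 * u * (1 + ε)) * (Se + So) := by
  have hSe : 0 ≤ Se := (norm_nonneg _).trans hE
  have hSo : 0 ≤ So := (norm_nonneg _).trans hO
  have nw' : ‖w'‖ ≤ 2 := by
    calc ‖w'‖ = ‖(w' - w) + w‖ := by ring_nf
      _ ≤ ‖w' - w‖ + ‖w‖ := norm_add_le _ _
      _ ≤ 2 := by rw [hw]; linarith
  have nO' : ‖O'‖ ≤ (1 + ε) * So := by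
    calc ‖O'‖ = ‖(O' - O) + O‖ := by ring_nf
      _ ≤ ‖O' - O‖ + ‖O‖ := norm_add_le _ _
      _ ≤ (1 + ε) * So := by linarith
  have nE' : ‖E'‖ ≤ (1 + ε) * Se := by
    calc ‖E'‖ = ‖(E' - E) + E‖ := by ring_nf
      _ ≤ ‖E' - E‖ + ‖E‖ := norm_add_le _ _
      _ ≤ (1 + ε) * Se := by linarith
  have ep : ‖p - w * O‖ ≤ 13 * u * (1 + ε) * So + ε * So := by
    calc ‖p - w * O‖ = ‖(p - w' * O') + (w' - w) * O' + w * (O' - O)‖ := by congr 1; ring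
      _ ≤ ‖p - w' * O'‖ + ‖w' - w‖ * ‖O'‖ + ‖w‖ * ‖O' - O‖ := by
          rw [← norm_mul, ← norm_mul]; exact norm_add₃_le
      _ ≤ 6 * u * (2 * ((1 + ε) * So)) + u * ((1 + ε) * So) + 1 * (ε * So) := by
          rw [hw]
          gcongr
          exact hp.trans (by gcongr)
      _ = _ := by ring
  have np : ‖p‖ ≤ 14 * (1 + ε) * So := by
    calc ‖p‖ = ‖(p - w * O) + w * O‖ := by ring_nf
      _ ≤ ‖p - w * O‖ + ‖w‖ * ‖O‖ := by rw [← norm_mul]; exact norm_add_le _ _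
      _ ≤ 13 * 1 * (1 + ε) * So + ε * So + 1 * So := by
          rw [hw]; gcongr; exact ep.trans (by gcongr)
      _ = _ := by ring
  -- The constant is `27 = 14 + 13`: the last addition rounds a term `p` of size up to `14 (1 + ε)
  -- So`, and `p` itself carries the new error `13 u (1 + ε) So`.
  calc ‖x - (E + σ * (w * O))‖
      = ‖(x - (E' + σ * p)) + (E' - E) + σ * (p - w * O)‖ := by congr 1; ring
    _ ≤ ‖x - (E' + σ * p)‖ + ‖E' - E‖ + ‖σ‖ * ‖p - w * O‖ := by
        rw [← norm_mul]; exact norm_add₃_le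
    _ ≤ u * ((1 + ε) * Se + 1 * (14 * (1 + ε) * So)) + ε * Se +
          1 * (13 * u * (1 + ε) * So + ε * So) := by
        rw [hσ]
        gcongr
        refine hx.trans ?_
        gcongr
        refine (norm_add_le _ _).trans ?_
        rw [norm_mul, hσ]
        gcongr
    _ ≤ _ := by
        have : 0 ≤ u * (1 + ε) * Se := by positivity
        nlinarith

/-- One butterfly level turns a relative error `ε` into `ε + 27 u (1 + ε) ≤ 28 ε + 27 u`, and this
recursion started at 0 gives `(28 ^ t - 1) u`. The bound is far from sharp, but it is polynomial in
the length `2 ^ t`, which is all that is used. -/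
theorem ens_fft {u : ℝ} (hu : 0 ≤ u) (hu1 : u ≤ 1) (t : ℕ) : ∀ v : ℕ → ℂ,
    Ensures (fft t v) u fun r =>
      ∀ k < 2 ^ t, ‖r k - dft t v k‖ ≤ (28 ^ t - 1) * u * sum1 (2 ^ t) v := by
  induction t with
  | zero =>
    intro v
    refine Ensures.pure ?_
    intro k hk
    obtain rfl : k = 0 := by simpa using hk
    simp [dft, root_zero]
  | succ t ih =>
    intro v
    have h28 : (1 : ℝ) ≤ 28 ^ t := one_le_pow₀ (by norm_num)
    set ε : ℝ := (28 ^ t - 1) * u with hεdef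
    have hε : 0 ≤ ε := mul_nonneg (by linarith) hu
    refine (ih _).bind fun E hE => (ih _).bind fun O hO => (Ensures.loop (P := fun k r =>
      ‖r.1 - (dft t (fun i => v (2 * i)) k +
        1 * (root (t + 1) k * dft t (fun i => v (2 * i + 1)) k))‖ ≤
          (ε + 27 * u * (1 + ε)) * sum1 (2 ^ (t + 1)) v ∧
      ‖r.2 - (dft t (fun i => v (2 * i)) k +
        -1 * (root (t + 1) k * dft t (fun i => v (2 * i + 1)) k))‖ ≤
          (ε + 27 * u * (1 + ε)) * sum1 (2 ^ (t + 1)) v) ?_).bind fun B hB => Ensures.pure ?_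
    · intro k hk
      refine (ens_op (P := fun w => ‖w - root (t + 1) k‖ ≤ u) fun w hw => hw).bind fun w hw =>
        (ens_cmul hu hu1 _ _).bind fun p hp => (ens_cadd hu _ _).bind fun x hx =>
          (ens_csub hu _ _).bind fun y hy => Ensures.pure ?_
      rw [sum1_two_pow_succ]
      constructor
      · exact butterfly_error hu hu1 hε (norm_root _ _) (norm_dft_le _ _ _) (norm_dft_le _ _ _)
          (hE k hk) (hO k hk) hw hp (by simp) (by simpa using hx)
      · exact butterfly_error hu hu1 hε (norm_root _ _) (norm_dft_le _ _ _) (norm_dft_le _ _ _)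
          (hE k hk) (hO k hk) hw hp (by simp) (by simpa [← sub_eq_add_neg] using hy)
    · have hcoef : (ε + 27 * u * (1 + ε)) * sum1 (2 ^ (t + 1)) v ≤
          (28 ^ (t + 1) - 1) * u * sum1 (2 ^ (t + 1)) v := by
        refine mul_le_mul_of_nonneg_right ?_ (sum1_nonneg _ _)
        have : u * ε ≤ ε := mul_le_of_le_one_left hε hu1
        rw [pow_succ]
        nlinarith
      intro k hk
      by_cases h : k < 2 ^ t
      · simp only [h, if_true]
        have := (hB.1 k h).1
        rw [one_mul, ← dft_succ] at this
        exact this.trans hcoef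
      · simp only [h, if_false]
        have h' : k - 2 ^ t < 2 ^ t := by rw [pow_succ] at hk; omega
        have := (hB.1 _ h').2
        rw [neg_one_mul, ← sub_eq_add_neg, ← dft_succ_add, Nat.sub_add_cancel (by omega)] at this
        exact this.trans hcoef

/-! ### The inverse transform and fast convolution -/

/-- The exact inverse discrete Fourier transform of length `2 ^ t`. -/
def idft (t : ℕ) (v : ℕ → ℂ) (i : ℕ) : ℂ := conj (dft t (fun j => conj (v j)) i) / 2 ^ t

theorem sum1_conj (n : ℕ) (v : ℕ → ℂ) : sum1 n (fun j => conj (v j)) = sum1 n v := by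
  simp [sum1]

theorem ens_ifft {u : ℝ} (hu : 0 ≤ u) (hu1 : u ≤ 1) (t : ℕ) (v : ℕ → ℂ) :
    Ensures (ifft t v) u fun r => (∀ i < 2 ^ t, ‖r i - idft t v i‖ ≤
      2 * 28 ^ t * u * (sum1 (2 ^ t) v / 2 ^ t)) ∧ ∀ i, 2 ^ t ≤ i → r i = 0 := by
  refine (ens_fft hu hu1 t _).bind fun w hw => Ensures.loop (P := fun i r => ‖r - idft t v i‖ ≤
    2 * 28 ^ t * u * (sum1 (2 ^ t) v / 2 ^ t)) fun i hi =>
    (ens_cdivReal hu _ (pow_ne_zero t two_ne_zero)).mono fun r hr => ?_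
  have h := hw i hi
  rw [sum1_conj] at h
  have h28 : (1 : ℝ) ≤ 28 ^ t := one_le_pow₀ (by norm_num)
  have hS := sum1_nonneg (2 ^ t) v
  have hd := norm_dft_le t (fun j => conj (v j)) i
  rw [sum1_conj] at hd
  have hwn : ‖w i‖ ≤ 28 ^ t * sum1 (2 ^ t) v := by
    calc ‖w i‖ = ‖(w i - dft t (fun j => conj (v j)) i) + dft t (fun j => conj (v j)) i‖ := by
          ring_nf
      _ ≤ (28 ^ t - 1) * u * sum1 (2 ^ t) v + sum1 (2 ^ t) v :=
          (norm_add_le _ _).trans (add_le_add h hd)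
      _ ≤ (28 ^ t - 1) * 1 * sum1 (2 ^ t) v + sum1 (2 ^ t) v := by
          have : (0 : ℝ) ≤ 28 ^ t - 1 := by linarith
          gcongr
      _ = _ := by ring
  have hc : ((2 ^ t : ℝ) : ℂ) = 2 ^ t := by push_cast; rfl
  have h2 : ‖(2 ^ t : ℂ)‖ = 2 ^ t := by simp
  rw [hc] at hr
  calc ‖r - idft t v i‖
      = ‖(r - conj (w i) / 2 ^ t) + conj (w i - dft t (fun j => conj (v j)) i) / 2 ^ t‖ := by
        rw [idft, map_sub]
        congr 1
        ring
    _ ≤ u * (‖w i‖ / 2 ^ t) + ‖w i - dft t (fun j => conj (v j)) i‖ / 2 ^ t := by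
        refine (norm_add_le _ _).trans (add_le_add (hr.trans_eq ?_) (le_of_eq ?_)) <;>
        rw [norm_div, h2, Complex.norm_conj]
    _ ≤ u * (28 ^ t * sum1 (2 ^ t) v / 2 ^ t) + 28 ^ t * u * sum1 (2 ^ t) v / 2 ^ t := by
        gcongr
        refine h.trans ?_
        gcongr
        linarith
    _ = _ := by ring

theorem sum_root_mul_conj (t : ℕ) {i s : ℕ} (hi : i < 2 ^ t) (hs : s < 2 ^ t) :
    ∑ k ∈ Finset.range (2 ^ t), root t (s * k) * conj (root t (k * i)) =
      if s = i then 2 ^ t else 0 := by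
  have hconj : ∀ k, root t k * conj (root t k) = 1 := fun k => by
    rw [Complex.mul_conj, Complex.normSq_eq_norm_sq, norm_root]
    simp
  have key : ∀ {i s : ℕ}, i ≤ s → s < 2 ^ t →
      ∑ k ∈ Finset.range (2 ^ t), root t (s * k) * conj (root t (k * i)) =
        if s = i then 2 ^ t else 0 := by
    intro i s his hs
    obtain ⟨d, rfl⟩ := Nat.exists_eq_add_of_le his
    have h1 : ∀ k, root t ((i + d) * k) * conj (root t (k * i)) = root t d ^ k := by
      intro k
      rw [add_mul, root_add, mul_comm k i, mul_comm (root t _), mul_assoc, hconj, mul_one,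
        root_mul]
    simp_rw [h1]
    rcases Nat.eq_zero_or_pos d with rfl | hd
    · simp [root_zero]
    · have hne : root t d ≠ 1 := by
        rw [Ne, root_eq_one_iff]
        exact Nat.not_dvd_of_pos_of_lt hd (by omega)
      rw [if_neg (by omega), geom_sum_eq hne, ← root_mul, mul_comm, root_two_pow_mul, sub_self,
        zero_div]
  rcases le_total i s with h | h
  · exact key h hs
  · have h3 := congrArg conj (key h hi)
    rw [map_sum] at h3
    have h4 : conj (if i = s then (2 ^ t : ℂ) else 0) = if s = i then 2 ^ t else 0 := by
      by_cases h' : i = s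
      · simp [h', map_pow, Complex.conj_ofNat]
      · simp [h', Ne.symm h']
    rw [← h4, ← h3]
    refine Finset.sum_congr rfl fun k _ => ?_
    rw [map_mul, Complex.conj_conj, mul_comm, mul_comm k i, mul_comm s k]

/-- By orthogonality of characters the left side is a cyclic convolution; the hypothesis on `p` and
`q` excludes wrap-around, so it agrees with the ordinary product. -/
theorem idft_mul_dft (t : ℕ) {p q : ℕ → ℂ} (h : ∀ j l, 2 ^ t ≤ j + l → p j * q l = 0) {i : ℕ}
    (hi : i < 2 ^ t) : idft t (fun k => dft t p k * dft t q k) i =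
      PowerSeries.coeff i (.mk p * .mk q) := by
  have h1 : idft t (fun k => dft t p k * dft t q k) i =
      (∑ j ∈ Finset.range (2 ^ t), ∑ l ∈ Finset.range (2 ^ t), p j * q l *
        ∑ k ∈ Finset.range (2 ^ t), root t ((j + l) * k) * conj (root t (k * i))) / 2 ^ t := by
    rw [idft, dft, map_sum]
    congr 1
    simp_rw [map_mul, Complex.conj_conj, dft, Finset.sum_mul_sum, Finset.sum_mul, Finset.mul_sum]
    rw [Finset.sum_comm]
    refine Finset.sum_congr rfl fun j _ => ?_
    rw [Finset.sum_comm]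
    refine Finset.sum_congr rfl fun l _ => Finset.sum_congr rfl fun k _ => ?_
    rw [add_mul, root_add]
    ring
  have h2 : ∀ j l, p j * q l *
      ∑ k ∈ Finset.range (2 ^ t), root t ((j + l) * k) * conj (root t (k * i)) =
        if j + l = i then p j * q l * 2 ^ t else 0 := by
    intro j l
    by_cases hjl : j + l < 2 ^ t
    · rw [sum_root_mul_conj t hi hjl, mul_ite, mul_zero]
    · rw [h j l (by omega), zero_mul, if_neg (by omega)]
  rw [h1]
  simp_rw [h2]
  rw [← Finset.sum_product', ← Finset.sum_filter, ← Finset.sum_mul,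
    mul_div_cancel_right₀ _ (pow_ne_zero t two_ne_zero), PowerSeries.coeff_mul]
  refine Finset.sum_congr ?_ fun _ _ => by simp
  ext ⟨j, l⟩
  simp only [Finset.mem_filter, Finset.mem_product, Finset.mem_range,
    Finset.HasAntidiagonal.mem_antidiagonal]
  omega

/-- A real `σ` passes through the two conjugations in `idft`. It will be `1` or `-1`, so that sums
and differences of products are treated together. -/
theorem idft_add_mul (t : ℕ) (v w : ℕ → ℂ) {σ : ℂ} (hσ : conj σ = σ) (i : ℕ) :
    idft t (fun k => v k + σ * w k) i = idft t v i + σ * idft t w i := by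
  simp only [idft, dft, map_add, map_mul, hσ, add_mul, Finset.sum_add_distrib, mul_assoc,
    ← Finset.mul_sum]
  ring

theorem norm_idft_sub_le (t : ℕ) {v w : ℕ → ℂ} {c : ℝ} (h : ∀ k < 2 ^ t, ‖v k - w k‖ ≤ c)
    (i : ℕ) : ‖idft t v i - idft t w i‖ ≤ c := by
  have h1 : idft t v i - idft t w i = idft t (fun k => v k - w k) i := by
    have := idft_add_mul t v w (σ := -1) (by simp) i
    simp only [neg_one_mul, ← sub_eq_add_neg] at this
    exact this.symm
  rw [h1, idft, norm_div, Complex.norm_conj]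
  have h2 : ‖(2 ^ t : ℂ)‖ = 2 ^ t := by simp
  rw [h2, div_le_iff₀ (by positivity)]
  refine (norm_dft_le _ _ _).trans ?_
  rw [sum1_conj]
  calc sum1 (2 ^ t) (fun k => v k - w k) ≤ ∑ _k ∈ Finset.range (2 ^ t), c :=
        Finset.sum_le_sum fun k hk => h k (Finset.mem_range.1 hk)
    _ = c * 2 ^ t := by simp [mul_comm]

/-- The rounding error of a product of two inexact numbers. -/
theorem mul_error {u F p q : ℝ} (hu : 0 ≤ u) (hu1 : u ≤ 1) (hF : 1 ≤ F) {P Q P' Q' x : ℂ}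
    (hP : ‖P‖ ≤ p) (hQ : ‖Q‖ ≤ q) (hP' : ‖P' - P‖ ≤ (F - 1) * u * p)
    (hQ' : ‖Q' - Q‖ ≤ (F - 1) * u * q) (hx : ‖x - P' * Q'‖ ≤ 6 * u * (‖P'‖ * ‖Q'‖)) :
    ‖x - P * Q‖ ≤ 8 * F ^ 2 * u * (p * q) := by
  have hp : 0 ≤ p := (norm_nonneg _).trans hP
  have hq : 0 ≤ q := (norm_nonneg _).trans hQ
  have hF1 : 0 ≤ F - 1 := by linarith
  have bound : ∀ {P P' : ℂ} {p : ℝ}, ‖P‖ ≤ p → ‖P' - P‖ ≤ (F - 1) * u * p → 0 ≤ p →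
      ‖P'‖ ≤ F * p := by
    intro P P' p hP hP' hp
    calc ‖P'‖ = ‖(P' - P) + P‖ := by ring_nf
      _ ≤ (F - 1) * 1 * p + p := (norm_add_le _ _).trans (add_le_add (hP'.trans (by gcongr)) hP)
      _ = F * p := by ring
  have nP' := bound hP hP' hp
  have nQ' := bound hQ hQ' hq
  calc ‖x - P * Q‖ = ‖(x - P' * Q') + (P' - P) * Q' + P * (Q' - Q)‖ := by congr 1; ring
    _ ≤ ‖x - P' * Q'‖ + ‖P' - P‖ * ‖Q'‖ + ‖P‖ * ‖Q' - Q‖ := by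
        rw [← norm_mul, ← norm_mul]; exact norm_add₃_le
    _ ≤ 6 * u * ((F * p) * (F * q)) + (F - 1) * u * p * (F * q) + p * ((F - 1) * u * q) := by
        gcongr
        exact hx.trans (by gcongr)
    _ = (7 * F ^ 2 - 1) * u * (p * q) := by ring
    _ ≤ _ := by
        gcongr
        nlinarith

/-- With `F = 28 ^ t`, the pointwise stage errs by `17 F ^ 2 u` relative to the `ℓ¹` sizes and
leaves values of size `18 F ^ 2`. The inverse transform adds `2 F u * 18 F ^ 2`, and `36 + 17 = 53`.
-/
theorem ens_conv2 {u : ℝ} (hu : 0 ≤ u) (hu1 : u ≤ 1) (t : ℕ) {o : ℂ → ℂ → FP ℂ} {σ : ℂ}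
    (hσ : ‖σ‖ = 1) (hσ' : conj σ = σ)
    (ho : ∀ x y, Ensures (o x y) u fun r => ‖r - (x + σ * y)‖ ≤ u * ‖x + σ * y‖)
    {p q r s : ℕ → ℂ} (hpq : ∀ j l, 2 ^ t ≤ j + l → p j * q l = 0)
    (hrs : ∀ j l, 2 ^ t ≤ j + l → r j * s l = 0) :
    Ensures (conv2 t o p q r s) u fun c =>
      (∀ i < 2 ^ t, ‖c i - (PowerSeries.coeff i (.mk p * .mk q) +
        σ * PowerSeries.coeff i (.mk r * .mk s))‖ ≤ 53 * (28 ^ t) ^ 3 * u *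
          (sum1 (2 ^ t) p * sum1 (2 ^ t) q + sum1 (2 ^ t) r * sum1 (2 ^ t) s)) ∧
      ∀ i, 2 ^ t ≤ i → c i = 0 := by
  have h28 : (1 : ℝ) ≤ 28 ^ t := one_le_pow₀ (by norm_num)
  set F : ℝ := 28 ^ t with hF
  set W1 := sum1 (2 ^ t) p * sum1 (2 ^ t) q with hW1
  set W2 := sum1 (2 ^ t) r * sum1 (2 ^ t) s with hW2
  have hW1' : 0 ≤ W1 := mul_nonneg (sum1_nonneg _ _) (sum1_nonneg _ _)
  have hW2' : 0 ≤ W2 := mul_nonneg (sum1_nonneg _ _) (sum1_nonneg _ _)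
  have hF2 : 1 ≤ F ^ 2 := one_le_pow₀ h28
  refine (ens_fft hu hu1 t p).bind fun P hP => (ens_fft hu hu1 t q).bind fun Q hQ =>
    (ens_fft hu hu1 t r).bind fun R hR => (ens_fft hu hu1 t s).bind fun S hS =>
      (Ensures.loop (P := fun k v => ‖v - (dft t p k * dft t q k + σ * (dft t r k * dft t s k))‖ ≤
        17 * F ^ 2 * u * (W1 + W2)) fun k hk => ?_).bind fun V hV =>
          (ens_ifft hu hu1 t V).mono fun c hc => ⟨fun i hi => ?_, hc.2⟩
  · refine (ens_cmul hu hu1 _ _).bind fun x hx => (ens_cmul hu hu1 _ _).bind fun y hy =>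
      (ho _ _).mono fun v hv => ?_
    have ex := mul_error hu hu1 h28 (norm_dft_le t p k) (norm_dft_le t q k) (hP k hk) (hQ k hk) hx
    have ey := mul_error hu hu1 h28 (norm_dft_le t r k) (norm_dft_le t s k) (hR k hk) (hS k hk) hy
    have bound : ∀ {z w : ℂ} {W : ℝ}, ‖z - w‖ ≤ 8 * F ^ 2 * u * W → ‖w‖ ≤ W → 0 ≤ W →
        ‖z‖ ≤ 9 * F ^ 2 * W := by
      intro z w W h1 h2 hW
      calc ‖z‖ = ‖(z - w) + w‖ := by ring_nf
        _ ≤ 8 * F ^ 2 * 1 * W + F ^ 2 * W :=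
            (norm_add_le _ _).trans (add_le_add (h1.trans (by gcongr))
              (h2.trans (le_mul_of_one_le_left hW hF2)))
        _ = _ := by ring
    have nx := bound ex (by
      rw [norm_mul]; exact mul_le_mul (norm_dft_le _ _ _) (norm_dft_le _ _ _) (norm_nonneg _)
        (sum1_nonneg _ _)) hW1'
    have ny := bound ey (by
      rw [norm_mul]; exact mul_le_mul (norm_dft_le _ _ _) (norm_dft_le _ _ _) (norm_nonneg _)
        (sum1_nonneg _ _)) hW2'
    calc ‖v - (dft t p k * dft t q k + σ * (dft t r k * dft t s k))‖
        = ‖(v - (x + σ * y)) + (x - dft t p k * dft t q k) +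
            σ * (y - dft t r k * dft t s k)‖ := by congr 1; ring
      _ ≤ ‖v - (x + σ * y)‖ + ‖x - dft t p k * dft t q k‖ +
            ‖σ‖ * ‖y - dft t r k * dft t s k‖ := by rw [← norm_mul]; exact norm_add₃_le
      _ ≤ u * (9 * F ^ 2 * W1 + 1 * (9 * F ^ 2 * W2)) + 8 * F ^ 2 * u * W1 +
            1 * (8 * F ^ 2 * u * W2) := by
          rw [hσ]
          gcongr
          refine hv.trans ?_
          gcongr
          refine (norm_add_le _ _).trans ?_
          rw [norm_mul, hσ]
          gcongr
      _ = _ := by ring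
  · have e1 := hc.1 i hi
    have hVn : sum1 (2 ^ t) V / 2 ^ t ≤ 18 * F ^ 2 * (W1 + W2) := by
      rw [div_le_iff₀ (by positivity)]
      calc sum1 (2 ^ t) V ≤ ∑ _k ∈ Finset.range (2 ^ t), 18 * F ^ 2 * (W1 + W2) := by
            refine Finset.sum_le_sum fun k hk => ?_
            have h := hV.1 k (Finset.mem_range.1 hk)
            have hw : ‖dft t p k * dft t q k + σ * (dft t r k * dft t s k)‖ ≤ W1 + W2 := by
              refine (norm_add_le _ _).trans ?_
              rw [norm_mul σ, hσ, one_mul, norm_mul, norm_mul]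
              exact add_le_add
                (mul_le_mul (norm_dft_le _ _ _) (norm_dft_le _ _ _) (norm_nonneg _)
                  (sum1_nonneg _ _))
                (mul_le_mul (norm_dft_le _ _ _) (norm_dft_le _ _ _) (norm_nonneg _)
                  (sum1_nonneg _ _))
            calc ‖V k‖ = ‖(V k - (dft t p k * dft t q k + σ * (dft t r k * dft t s k))) +
                  (dft t p k * dft t q k + σ * (dft t r k * dft t s k))‖ := by ring_nf
              _ ≤ 17 * F ^ 2 * 1 * (W1 + W2) + F ^ 2 * (W1 + W2) :=
                  (norm_add_le _ _).trans (add_le_add (h.trans (by gcongr))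
                    (hw.trans (le_mul_of_one_le_left (by positivity) hF2)))
              _ = _ := by ring
        _ = _ := by simp; ring
    have e2 := norm_idft_sub_le t hV.1 i
    rw [idft_add_mul t _ _ hσ', idft_mul_dft t hpq hi, idft_mul_dft t hrs hi] at e2
    rw [← sub_add_sub_cancel]
    refine (norm_add_le _ _).trans ((add_le_add e1 e2).trans ?_)
    calc 2 * F * u * (sum1 (2 ^ t) V / 2 ^ t) + 17 * F ^ 2 * u * (W1 + W2)
        ≤ 2 * F * u * (18 * F ^ 2 * (W1 + W2)) + 17 * (F ^ 2 * F) * u * (W1 + W2) := by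
          gcongr
          exact le_mul_of_one_le_right (by positivity) h28
      _ = _ := by ring

/-! ### Truncated norms of power series -/

section norms

open PowerSeries

/-- The `ℓ¹` norm of the first `n` coefficients. -/
def norm1 (n : ℕ) (f : ℂ⟦X⟧) : ℝ := ∑ i ∈ Finset.range n, ‖coeff i f‖

/-- The sum of the squares of the absolute values of the first `n` coefficients. -/
def normSq2 (n : ℕ) (f : ℂ⟦X⟧) : ℝ := ∑ i ∈ Finset.range n, ‖coeff i f‖ ^ 2

theorem norm1_nonneg (n : ℕ) (f : ℂ⟦X⟧) : 0 ≤ norm1 n f :=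
  Finset.sum_nonneg fun _ _ => norm_nonneg _

theorem normSq2_nonneg (n : ℕ) (f : ℂ⟦X⟧) : 0 ≤ normSq2 n f :=
  Finset.sum_nonneg fun _ _ => sq_nonneg _

theorem norm1_add_le (n : ℕ) (f g : ℂ⟦X⟧) : norm1 n (f + g) ≤ norm1 n f + norm1 n g := by
  rw [norm1, norm1, norm1, ← Finset.sum_add_distrib]
  exact Finset.sum_le_sum fun i _ => by rw [map_add]; exact norm_add_le _ _

theorem norm1_sub_le (n : ℕ) (f g : ℂ⟦X⟧) : norm1 n (f - g) ≤ norm1 n f + norm1 n g := by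
  rw [norm1, norm1, norm1, ← Finset.sum_add_distrib]
  exact Finset.sum_le_sum fun i _ => by rw [map_sub]; exact norm_sub_le _ _

theorem norm1_mono {m n : ℕ} (h : m ≤ n) (f : ℂ⟦X⟧) : norm1 m f ≤ norm1 n f :=
  Finset.sum_le_sum_of_subset_of_nonneg (Finset.range_mono h) fun _ _ _ => norm_nonneg _

theorem normSq2_mono {m n : ℕ} (h : m ≤ n) (f : ℂ⟦X⟧) : normSq2 m f ≤ normSq2 n f :=
  Finset.sum_le_sum_of_subset_of_nonneg (Finset.range_mono h) fun _ _ _ => sq_nonneg _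

theorem norm_coeff_le_norm1 {i n : ℕ} (h : i < n) (f : ℂ⟦X⟧) : ‖coeff i f‖ ≤ norm1 n f :=
  Finset.single_le_sum (f := fun i => ‖coeff i f‖) (fun _ _ => norm_nonneg _)
    (Finset.mem_range.2 h)

theorem sq_norm_coeff_le_normSq2 {i n : ℕ} (h : i < n) (f : ℂ⟦X⟧) :
    ‖coeff i f‖ ^ 2 ≤ normSq2 n f :=
  Finset.single_le_sum (f := fun i => ‖coeff i f‖ ^ 2) (fun _ _ => sq_nonneg _)
    (Finset.mem_range.2 h)

theorem norm1_le_of_coeff_le {n : ℕ} {f : ℂ⟦X⟧} {c : ℝ} (h : ∀ i < n, ‖coeff i f‖ ≤ c) :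
    norm1 n f ≤ n * c := by
  calc norm1 n f ≤ ∑ _i ∈ Finset.range n, c :=
        Finset.sum_le_sum fun i hi => h i (Finset.mem_range.1 hi)
    _ = n * c := by simp

theorem norm1_le_of_normSq2_le {n : ℕ} {f : ℂ⟦X⟧} {c : ℝ} (hc : 0 ≤ c) (h : normSq2 n f ≤ c ^ 2) :
    norm1 n f ≤ n * c :=
  norm1_le_of_coeff_le fun _ hi =>
    le_of_sq_le_sq ((sq_norm_coeff_le_normSq2 hi f).trans h) hc

theorem norm1_congr {n : ℕ} {f g : ℂ⟦X⟧} (h : ∀ i < n, coeff i f = coeff i g) :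
    norm1 n f = norm1 n g :=
  Finset.sum_congr rfl fun i hi => by rw [h i (Finset.mem_range.1 hi)]

/-- Coefficients below `n` of a product involve only coefficients below `n` of the factors, so
`norm1 n` acts as an algebra norm on power series modulo `X ^ n`. The error estimates below are made
in this norm; `normSq2` serves for the contraction properties. -/
theorem norm1_mul_le (n : ℕ) (f g : ℂ⟦X⟧) : norm1 n (f * g) ≤ norm1 n f * norm1 n g := by
  have h1 : norm1 n (f * g) ≤ ∑ i ∈ Finset.range n,
      ∑ p ∈ Finset.HasAntidiagonal.antidiagonal i, ‖coeff p.1 f‖ * ‖coeff p.2 g‖ := by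
    refine Finset.sum_le_sum fun i _ => ?_
    rw [coeff_mul]
    exact (norm_sum_le _ _).trans_eq (Finset.sum_congr rfl fun p _ => norm_mul _ _)
  have h2 := Finset.sum_fiberwise_of_maps_to
    (s := (Finset.range n ×ˢ Finset.range n).filter fun p => p.1 + p.2 < n)
    (t := Finset.range n) (g := fun p => p.1 + p.2)
    (fun p hp => Finset.mem_range.2 (Finset.mem_filter.1 hp).2)
    (fun p => ‖coeff p.1 f‖ * ‖coeff p.2 g‖)
  refine h1.trans ?_
  rw [norm1, norm1, Finset.sum_mul_sum, ← Finset.sum_product']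
  calc _ = _ := by
        refine Finset.sum_congr rfl fun i hi => Finset.sum_congr ?_ fun _ _ => rfl
        ext ⟨j, l⟩
        have := Finset.mem_range.1 hi
        simp only [Finset.mem_filter, Finset.mem_product, Finset.mem_range,
          Finset.HasAntidiagonal.mem_antidiagonal]
        omega
    _ = _ := h2
    _ ≤ _ := Finset.sum_le_sum_of_subset_of_nonneg (Finset.filter_subset _ _)
        fun _ _ _ => by positivity

theorem norm1_X_pow_mul (m n : ℕ) (f : ℂ⟦X⟧) : norm1 (m + n) (X ^ m * f) = norm1 n f := by
  rw [norm1, Finset.sum_range_add]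
  simp only [coeff_X_pow_mul']
  rw [Finset.sum_eq_zero fun i hi => by
    rw [if_neg (by simpa using Finset.mem_range.1 hi), norm_zero], zero_add]
  exact Finset.sum_congr rfl fun i _ => by rw [if_pos (by omega), Nat.add_sub_cancel_left]

theorem normSq2_X_pow_mul (m n : ℕ) (f : ℂ⟦X⟧) :
    normSq2 (m + n) (X ^ m * f) = normSq2 n f := by
  rw [normSq2, Finset.sum_range_add]
  simp only [coeff_X_pow_mul']
  rw [Finset.sum_eq_zero fun i hi => by
    rw [if_neg (by simpa using Finset.mem_range.1 hi), norm_zero, zero_pow two_ne_zero], zero_add]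
  exact Finset.sum_congr rfl fun i _ => by rw [if_pos (by omega), Nat.add_sub_cancel_left]

theorem normSq2_X_mul_le (n : ℕ) (f : ℂ⟦X⟧) : normSq2 n (X * f) ≤ normSq2 n f := by
  have := normSq2_X_pow_mul 1 n f
  rw [pow_one] at this
  rw [← this]
  exact normSq2_mono (by omega) _

theorem norm1_eq_zero {n : ℕ} {f : ℂ⟦X⟧} (h : ∀ i < n, coeff i f = 0) : norm1 n f = 0 :=
  Finset.sum_eq_zero fun i hi => by rw [h i (Finset.mem_range.1 hi), norm_zero]

/-- If `f` vanishes at `0`, one coefficient less of `g` matters in `f * g`. -/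
theorem norm1_succ_mul_le (n : ℕ) {f : ℂ⟦X⟧} (hf : coeff 0 f = 0) (g : ℂ⟦X⟧) :
    norm1 (n + 1) (f * g) ≤ norm1 (n + 1) f * norm1 n g := by
  rw [coeff_zero_eq_constantCoeff] at hf
  obtain ⟨f', rfl⟩ := X_dvd_iff.2 hf
  have h : ∀ f : ℂ⟦X⟧, norm1 (n + 1) (X * f) = norm1 n f := fun f => by
    have := norm1_X_pow_mul 1 n f
    rwa [pow_one, add_comm] at this
  rw [mul_assoc, h, h]
  exact norm1_mul_le _ _ _

end norms

/-! ### The polynomials of the nonlinear Fourier transform -/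

section quad

open PowerSeries

/-- The factor `(1 + |g|²)^(-1/2)`. -/
def sc (g : ℂ) : ℂ := (((Real.sqrt (1 + ‖g‖ ^ 2))⁻¹ : ℝ) : ℂ)

theorem sc_pos (g : ℂ) : 0 < (Real.sqrt (1 + ‖g‖ ^ 2))⁻¹ := by positivity

theorem sc_ne_zero (g : ℂ) : sc g ≠ 0 := Complex.ofReal_ne_zero.2 (sc_pos g).ne'

theorem conj_sc (g : ℂ) : conj (sc g) = sc g := Complex.conj_ofReal _

theorem norm_sc_sq (g : ℂ) : ‖sc g‖ ^ 2 * (1 + ‖g‖ ^ 2) = 1 := by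
  rw [sc, Complex.norm_real, Real.norm_of_nonneg (sc_pos g).le, inv_pow,
    Real.sq_sqrt (by positivity), inv_mul_cancel₀ (by positivity)]

theorem norm_sc_le_one (g : ℂ) : ‖sc g‖ ≤ 1 := by
  have h := norm_sc_sq g
  have : ‖sc g‖ ^ 2 ≤ 1 := by nlinarith [mul_nonneg (sq_nonneg ‖sc g‖) (sq_nonneg ‖g‖)]
  exact (sq_le_one_iff₀ (norm_nonneg _)).1 this

theorem sc_mul_sc (g : ℂ) : sc g * sc g * (1 + g * conj g) = 1 := by
  have h := norm_sc_sq g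
  rw [sc, Complex.norm_real, Real.norm_of_nonneg (sc_pos g).le] at h
  rw [Complex.mul_conj, Complex.normSq_eq_norm_sq, sc]
  rw [sq (Real.sqrt _)⁻¹] at h
  exact_mod_cast h

theorem C_sc_mul_C_sc (g : ℂ) : C (sc g) * C (sc g) * (1 + C g * C (conj g)) = (1 : ℂ⟦X⟧) := by
  rw [← map_one C, ← map_mul, ← map_mul, ← map_add, ← map_mul, sc_mul_sc]

/-- The polynomials `η`, `ξ` and their reversals `η♯`, `ξ♯`. -/
structure Quad where
  et : ℂ⟦X⟧
  xi : ℂ⟦X⟧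
  ets : ℂ⟦X⟧
  xis : ℂ⟦X⟧

/-- The polynomials `η_k`, `ξ_k`, `η_k♯`, `ξ_k♯` that belong to `γ_0, …, γ_{k-1}`. -/
def quad (γ : ℕ → ℂ) : ℕ → Quad
  | 0 => ⟨1, 0, 1, 0⟩
  | k + 1 =>
    let q := quad γ k
    ⟨C (sc (γ k)) * (q.et - C (γ k) * q.xis), C (sc (γ k)) * (q.xi + C (γ k) * q.ets),
      C (sc (γ k)) * (X * (q.ets - C (conj (γ k)) * q.xi)),
      C (sc (γ k)) * (X * (q.xis + C (conj (γ k)) * q.et))⟩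

variable (γ : ℕ → ℂ)

theorem quad_congr {γ γ' : ℕ → ℂ} {k : ℕ} (h : ∀ i < k, γ i = γ' i) : quad γ k = quad γ' k := by
  induction k with
  | zero => rfl
  | succ k ih => simp only [quad, ih fun i hi => h i (by omega), h k (by omega)]

/-- The matrix with rows `(ets, xis)` and `(-xi, et)` is a product of unitary rotations and factors
`diag (X, 1)`, each of determinant `X`. Its adjugate therefore inverts the action up to the shift `X
^ k`. -/
theorem quad_det (k : ℕ) :
    (quad γ k).et * (quad γ k).ets + (quad γ k).xi * (quad γ k).xis = X ^ k := by
  induction k with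
  | zero => simp [quad]
  | succ k ih =>
    simp only [quad]
    linear_combination (X * (C (sc (γ k)) * C (sc (γ k)) * (1 + C (γ k) * C (conj (γ k))))) * ih +
      X ^ (k + 1) * C_sc_mul_C_sc (γ k)

/-- The product law for the matrices. Its first two components are the recombination step of the
algorithm. -/
theorem quad_add (m j : ℕ) :
    (quad γ (m + j)).et = (quad γ m).et * (quad (fun i => γ (m + i)) j).et -
        (quad γ m).xis * (quad (fun i => γ (m + i)) j).xi ∧
      (quad γ (m + j)).xi = (quad γ m).ets * (quad (fun i => γ (m + i)) j).xi +
        (quad γ m).xi * (quad (fun i => γ (m + i)) j).et ∧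
      (quad γ (m + j)).ets = (quad γ m).ets * (quad (fun i => γ (m + i)) j).ets -
        (quad γ m).xi * (quad (fun i => γ (m + i)) j).xis ∧
      (quad γ (m + j)).xis = (quad γ m).xis * (quad (fun i => γ (m + i)) j).ets +
        (quad γ m).et * (quad (fun i => γ (m + i)) j).xis := by
  induction j with
  | zero => simp [quad]
  | succ j ih =>
    obtain ⟨h1, h2, h3, h4⟩ := ih
    rw [← add_assoc]
    simp only [quad, h1, h2, h3, h4]
    refine ⟨?_, ?_, ?_, ?_⟩ <;> ring

/-- The first component of the action on a pair of power series. -/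
def act1 (q : Quad) (f h : ℂ⟦X⟧) : ℂ⟦X⟧ := q.ets * f + q.xis * h

/-- The second component of the action on a pair of power series. -/
def act2 (q : Quad) (f h : ℂ⟦X⟧) : ℂ⟦X⟧ := q.et * h - q.xi * f

theorem act_add (m j : ℕ) (f h : ℂ⟦X⟧) :
    act1 (quad γ (m + j)) f h = act1 (quad (fun i => γ (m + i)) j)
        (act1 (quad γ m) f h) (act2 (quad γ m) f h) ∧
      act2 (quad γ (m + j)) f h = act2 (quad (fun i => γ (m + i)) j)
        (act1 (quad γ m) f h) (act2 (quad γ m) f h) := by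
  obtain ⟨h1, h2, h3, h4⟩ := quad_add γ m j
  simp only [act1, act2, h1, h2, h3, h4]
  constructor <;> ring

theorem act_succ (k : ℕ) (f h : ℂ⟦X⟧) :
    act1 (quad γ (k + 1)) f h = C (sc (γ k)) * (X * (act1 (quad γ k) f h +
        C (conj (γ k)) * act2 (quad γ k) f h)) ∧
      act2 (quad γ (k + 1)) f h = C (sc (γ k)) * (act2 (quad γ k) f h -
        C (γ k) * act1 (quad γ k) f h) := by
  simp only [quad, act1, act2]
  constructor <;> ring

theorem normSq2_C_mul (n : ℕ) (c : ℂ) (f : ℂ⟦X⟧) :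
    normSq2 n (C c * f) = ‖c‖ ^ 2 * normSq2 n f := by
  simp [normSq2, coeff_C_mul, Finset.mul_sum, mul_pow]

/-- In every degree the pair of coefficients undergoes a unitary rotation of `ℂ²`. -/
theorem normSq2_rotation (n : ℕ) (c : ℂ) (f h : ℂ⟦X⟧) :
    normSq2 n (C (sc c) * (f + C (conj c) * h)) + normSq2 n (C (sc c) * (h - C c * f)) =
      normSq2 n f + normSq2 n h := by
  have key : normSq2 n (f + C (conj c) * h) + normSq2 n (h - C c * f) =
      (1 + ‖c‖ ^ 2) * (normSq2 n f + normSq2 n h) := by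
    simp only [normSq2, ← Finset.sum_add_distrib, Finset.mul_sum]
    refine Finset.sum_congr rfl fun i _ => ?_
    simp only [map_add, map_sub, coeff_C_mul]
    generalize coeff i f = z
    generalize coeff i h = w
    simp only [Complex.sq_norm, Complex.normSq_apply, Complex.add_re, Complex.add_im,
      Complex.sub_re, Complex.sub_im, Complex.mul_re, Complex.mul_im, Complex.conj_re,
      Complex.conj_im]
    ring
  rw [normSq2_C_mul, normSq2_C_mul, ← mul_add, key, ← mul_assoc, norm_sc_sq, one_mul]

/-- The action is a contraction. -/
theorem normSq2_act_le (k n : ℕ) (f h : ℂ⟦X⟧) :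
    normSq2 n (act1 (quad γ k) f h) + normSq2 n (act2 (quad γ k) f h) ≤
      normSq2 n f + normSq2 n h := by
  induction k with
  | zero => simp [quad, act1, act2]
  | succ k ih =>
    rw [(act_succ γ k f h).1, (act_succ γ k f h).2, mul_left_comm]
    refine le_trans (add_le_add (normSq2_X_mul_le _ _) le_rfl) ?_
    rw [normSq2_rotation]
    exact ih

/-- The adjoint action is a contraction. -/
theorem normSq2_adj_le (k n : ℕ) (x y : ℂ⟦X⟧) :
    normSq2 n ((quad γ k).et * x + (quad γ k).xi * y) +
        normSq2 n ((quad γ k).ets * y - (quad γ k).xis * x) ≤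
      normSq2 n x + normSq2 n y := by
  induction k with
  | zero => simp [quad]
  | succ k ih =>
    set x' := (quad γ k).et * x + (quad γ k).xi * y
    set y' := (quad γ k).ets * y - (quad γ k).xis * x
    have h1 : (quad γ (k + 1)).et * x + (quad γ (k + 1)).xi * y =
        C (sc (conj (γ k))) * (x' + C (conj (conj (γ k))) * y') := by
      simp only [quad, x', y', sc, Complex.norm_conj, Complex.conj_conj]
      ring
    have h2 : (quad γ (k + 1)).ets * y - (quad γ (k + 1)).xis * x =
        X * (C (sc (conj (γ k))) * (y' - C (conj (γ k)) * x')) := by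
      simp only [quad, x', y', sc, Complex.norm_conj]
      ring
    rw [h1, h2]
    refine le_trans (add_le_add le_rfl (normSq2_X_mul_le _ _)) ?_
    rw [normSq2_rotation]
    exact ih

theorem normSq2_one_le (n : ℕ) : normSq2 n (1 : ℂ⟦X⟧) ≤ 1 := by
  rw [normSq2, show ∑ i ∈ Finset.range n, ‖coeff i (1 : ℂ⟦X⟧)‖ ^ 2 =
    ∑ i ∈ Finset.range n, if i = 0 then (1 : ℝ) else 0 from Finset.sum_congr rfl fun i _ => by
      rw [coeff_one]; split_ifs <;> simp]
  rw [Finset.sum_ite_eq']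
  split_ifs <;> norm_num

theorem normSq2_zero (n : ℕ) : normSq2 n (0 : ℂ⟦X⟧) = 0 := by simp [normSq2]

theorem normSq2_ets_add_xi_le (k n : ℕ) :
    normSq2 n (quad γ k).ets + normSq2 n (-(quad γ k).xi) ≤ 1 := by
  have := normSq2_act_le γ k n 1 0
  simp only [act1, act2, mul_one, mul_zero, add_zero, zero_sub, normSq2_zero] at this
  exact this.trans (normSq2_one_le n)

theorem normSq2_xis_add_et_le (k n : ℕ) :
    normSq2 n (quad γ k).xis + normSq2 n (quad γ k).et ≤ 1 := by
  have := normSq2_act_le γ k n 0 1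
  simp only [act1, act2, mul_one, mul_zero, zero_add, sub_zero, normSq2_zero] at this
  exact this.trans (normSq2_one_le n)

theorem norm_coeff_quad_le (k i : ℕ) :
    ‖coeff i (quad γ k).et‖ ≤ 1 ∧ ‖coeff i (quad γ k).xi‖ ≤ 1 ∧
      ‖coeff i (quad γ k).ets‖ ≤ 1 ∧ ‖coeff i (quad γ k).xis‖ ≤ 1 := by
  have key : ∀ {f g : ℂ⟦X⟧}, normSq2 (i + 1) f + normSq2 (i + 1) g ≤ 1 →
      ‖coeff i f‖ ≤ 1 ∧ ‖coeff i g‖ ≤ 1 := by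
    intro f g h
    have hf := sq_norm_coeff_le_normSq2 (Nat.lt_succ_self i) f
    have hg := sq_norm_coeff_le_normSq2 (Nat.lt_succ_self i) g
    have hf' := normSq2_nonneg (i + 1) f
    have hg' := normSq2_nonneg (i + 1) g
    exact ⟨(sq_le_one_iff₀ (norm_nonneg _)).1 (by linarith),
      (sq_le_one_iff₀ (norm_nonneg _)).1 (by linarith)⟩
  have h1 := key (normSq2_ets_add_xi_le γ k (i + 1))
  have h2 := key (normSq2_xis_add_et_le γ k (i + 1))
  rw [map_neg, norm_neg] at h1
  exact ⟨h2.2, h1.2, h1.1, h2.1⟩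

theorem norm1_quad_le (k n : ℕ) :
    norm1 n (quad γ k).et ≤ n ∧ norm1 n (quad γ k).xi ≤ n ∧
      norm1 n (quad γ k).ets ≤ n ∧ norm1 n (quad γ k).xis ≤ n := by
  have key : ∀ {f : ℂ⟦X⟧}, (∀ i, ‖coeff i f‖ ≤ 1) → norm1 n f ≤ n := fun h => by
    simpa using norm1_le_of_coeff_le (n := n) fun i _ => h i
  exact ⟨key fun i => (norm_coeff_quad_le γ k i).1, key fun i => (norm_coeff_quad_le γ k i).2.1,
    key fun i => (norm_coeff_quad_le γ k i).2.2.1, key fun i => (norm_coeff_quad_le γ k i).2.2.2⟩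

theorem coeff_quad_eq_zero (k i : ℕ) (hi : k < i) :
    coeff i (quad γ k).et = 0 ∧ coeff i (quad γ k).xi = 0 ∧
      coeff i (quad γ k).ets = 0 ∧ coeff i (quad γ k).xis = 0 := by
  induction k generalizing i with
  | zero => simp [quad, coeff_one, (Nat.pos_iff_ne_zero.1 hi)]
  | succ k ih =>
    obtain ⟨j, rfl⟩ : ∃ j, i = j + 1 := ⟨i - 1, by omega⟩
    obtain ⟨h1, h2, h3, h4⟩ := ih (j + 1) (by omega)
    obtain ⟨h1', h2', h3', h4'⟩ := ih j (by omega)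
    simp [quad, coeff_C_mul, coeff_succ_X_mul, h1, h2, h3, h4, h1', h2', h3', h4']

theorem coeff_zero_sharp (k : ℕ) :
    coeff 0 (quad γ k).xis = 0 ∧ (0 < k → coeff 0 (quad γ k).ets = 0) := by
  cases k <;> simp [quad, coeff_C_mul]

theorem coeff_sharp (k : ℕ) : ∀ i ≤ k, coeff i (quad γ k).ets = conj (coeff (k - i) (quad γ k).et) ∧
    coeff i (quad γ k).xis = conj (coeff (k - i) (quad γ k).xi) := by
  induction k with
  | zero =>
    intro i hi
    obtain rfl : i = 0 := by omega
    simp [quad]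
  | succ k ih =>
    intro i hi
    cases i with
    | zero =>
      obtain ⟨h1, h2, h3, h4⟩ := coeff_quad_eq_zero γ k (k + 1) (by omega)
      simp [quad, coeff_C_mul, h1, h2, h3, h4]
    | succ i =>
      obtain ⟨h1, h2⟩ := ih i (by omega)
      obtain ⟨h3, h4⟩ := ih (k - i) (by omega)
      have e : k - (k - i) = i := by omega
      rw [e] at h3 h4
      simp only [quad, coeff_C_mul, coeff_succ_X_mul, map_sub, map_add, Nat.add_sub_add_right,
        map_mul, conj_sc, h1, h2, h3, h4, Complex.conj_conj]
      simp

/-- The coefficient of degree `k` is the conjugate of the constant coefficient of the reversal,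
which vanishes. The case `k = 0` is an exception for `et` only, because there `et = 1`. -/
theorem coeff_quad_eq_zero_of_le (k i : ℕ) (hi : k ≤ i) :
    (0 < k → coeff i (quad γ k).et = 0) ∧ coeff i (quad γ k).xi = 0 := by
  rcases hi.lt_or_eq with h | rfl
  · exact ⟨fun _ => (coeff_quad_eq_zero γ k i h).1, (coeff_quad_eq_zero γ k i h).2.1⟩
  · have h := coeff_sharp γ k 0 (Nat.zero_le _)
    have h0 := coeff_zero_sharp γ k
    rw [Nat.sub_zero] at h
    constructor
    · intro hk
      rw [h0.2 hk] at h
      simpa using h.1.symm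
    · rw [h0.1] at h
      simpa using h.2.symm

theorem coeff_zero_et (k : ℕ) : ∃ r : ℝ, 0 < r ∧ r ≤ 1 ∧ coeff 0 (quad γ k).et = r := by
  induction k with
  | zero => exact ⟨1, one_pos, le_rfl, by simp [quad]⟩
  | succ k ih =>
    obtain ⟨r, hr, hr1, h⟩ := ih
    refine ⟨(Real.sqrt (1 + ‖γ k‖ ^ 2))⁻¹ * r, mul_pos (sc_pos _) hr, ?_, ?_⟩
    · refine mul_le_one₀ ?_ hr.le hr1
      have := norm_sc_le_one (γ k)
      rwa [sc, Complex.norm_real, Real.norm_of_nonneg (sc_pos _).le] at this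
    · simp only [quad, coeff_C_mul, map_sub, h, (coeff_zero_sharp γ k).1, sc]
      push_cast
      ring

/-- This reads `γ k` off the polynomials: bounds for `ξ` and comparisons of two `ξ` become
statements about `γ k` after division by the constant coefficient of `η`. -/
theorem coeff_top_xi (k : ℕ) :
    coeff k (quad γ (k + 1)).xi = γ k * coeff 0 (quad γ (k + 1)).et := by
  have h := (coeff_sharp γ k k le_rfl).1
  obtain ⟨r, -, -, hr⟩ := coeff_zero_et γ k
  simp only [quad, coeff_C_mul, map_sub, map_add, (coeff_zero_sharp γ k).1,
    (coeff_quad_eq_zero_of_le γ k k le_rfl).2, h, Nat.sub_self, hr, Complex.conj_ofReal]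
  ring

theorem norm1_xis_le (k n : ℕ) : norm1 n (quad γ k).xis ≤ norm1 k (quad γ k).xi := by
  have h1 : norm1 n (quad γ k).xis ≤ norm1 (k + 1) (quad γ k).xis := by
    rcases le_total n (k + 1) with h | h
    · exact norm1_mono h _
    · obtain ⟨d, rfl⟩ := Nat.exists_eq_add_of_le h
      rw [norm1, Finset.sum_range_add, ← norm1]
      rw [Finset.sum_eq_zero fun i _ => by
        rw [(coeff_quad_eq_zero γ k _ (by omega)).2.2.2, norm_zero], add_zero]
  refine h1.trans (le_of_eq ?_)
  rw [norm1, Finset.sum_range_succ', (coeff_zero_sharp γ k).1, norm_zero, add_zero, norm1,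
    ← Finset.sum_range_reflect]
  refine Finset.sum_congr rfl fun i hi => ?_
  have hi' := Finset.mem_range.1 hi
  rw [(coeff_sharp γ k (k - 1 - i + 1) (by omega)).2, Complex.norm_conj]
  congr 3
  omega

end quad

/-! ### Rounding errors in the base case -/

section leaf

variable {u : ℝ}

theorem ens_cdiv (hu : 0 ≤ u) (hu1 : u ≤ 1 / 1000) (x : ℂ) {y : ℂ} (hy : y ≠ 0) :
    Ensures (cdiv x y) u fun r => ‖r - x / y‖ ≤ 12 * u * ‖x / y‖ := by
  refine (ens_cmul hu (by linarith) _ _).bind fun p hp => (ens_cnormSq hu (by linarith) _).bind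
    fun q hq => ?_
  have hy' : 0 < ‖y‖ := norm_pos_iff.2 hy
  have hA : 0 < ‖y‖ ^ 2 := by positivity
  have hq1 : (99 / 100) * ‖y‖ ^ 2 ≤ q := by
    have := (abs_le.1 hq).1
    nlinarith
  have hq0 : 0 < q := lt_of_lt_of_le (by positivity) hq1
  refine (ens_cdivReal hu p hq0.ne').mono fun r hr => ?_
  rw [Complex.norm_conj] at hp
  set ρ : ℝ := ‖x / y‖ with hρ
  have hρ' : ‖x‖ * ‖y‖ = ρ * ‖y‖ ^ 2 := by
    rw [hρ, norm_div]
    field_simp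
  have hqc : (q : ℂ) ≠ 0 := Complex.ofReal_ne_zero.2 hq0.ne'
  have hxy : x / y * (‖y‖ ^ 2 : ℝ) = x * conj y := by
    have h2 : ((‖y‖ ^ 2 : ℝ) : ℂ) = y * conj y := by
      rw [Complex.mul_conj, Complex.normSq_eq_norm_sq]
    rw [h2]
    field_simp
  have e1 : ‖p / q - x / y‖ ≤ 10 * u * ρ := by
    -- Numerator and denominator contribute `6 u` and `3 u`; the sum 9 becomes 10 on replacing
    -- `|y|²` by `q ≥ 0.99 |y|²`. The final division adds `2 u`, which gives 12.
    have h1 : p / q - x / y = ((p - x * conj y) + x / y * ((‖y‖ ^ 2 - q : ℝ) : ℂ)) / q := by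
      rw [← hxy]
      push_cast
      field_simp
      ring
    rw [h1, norm_div, Complex.norm_real, Real.norm_of_nonneg hq0.le, div_le_iff₀ hq0]
    calc _ ≤ 6 * u * (‖x‖ * ‖y‖) + ρ * (3 * u * ‖y‖ ^ 2) := by
          refine (norm_add_le _ _).trans (add_le_add hp ?_)
          rw [norm_mul, Complex.norm_real, Real.norm_eq_abs, abs_sub_comm]
          gcongr
      _ = 9 * u * ρ * ‖y‖ ^ 2 := by rw [hρ']; ring
      _ ≤ 10 * u * ρ * ((99 / 100) * ‖y‖ ^ 2) := by
          have : 0 ≤ u * ρ * ‖y‖ ^ 2 := by positivity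
          linarith
      _ ≤ _ := by gcongr
  have hρ0 : 0 ≤ ρ := norm_nonneg _
  have e2 : ‖p / (q : ℂ)‖ ≤ 2 * ρ := by
    calc ‖p / (q : ℂ)‖ = ‖(p / q - x / y) + x / y‖ := by ring_nf
      _ ≤ 10 * u * ρ + ρ := (norm_add_le _ _).trans (add_le_add e1 le_rfl)
      _ ≤ _ := by nlinarith
  calc ‖r - x / y‖ = ‖(r - p / q) + (p / q - x / y)‖ := by ring_nf
    _ ≤ u * (2 * ρ) + 10 * u * ρ :=
        (norm_add_le _ _).trans (add_le_add (hr.trans (by gcongr)) e1)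
    _ = _ := by ring

theorem div_error (hu : 0 ≤ u) (hu1 : u ≤ 1 / 1000) {s t : ℝ} (ht : 1 ≤ t)
    (hs : |s - t| ≤ 7 * u * t) {w r : ℂ} (hr : ‖r - w / s‖ ≤ u * ‖w / s‖) :
    ‖r - w / t‖ ≤ 10 * u * ‖w‖ := by
  have hs1 : (99 / 100) * t ≤ s := by
    have := (abs_le.1 hs).1
    nlinarith
  have hs0 : 0 < s := by linarith
  have hsc : (s : ℂ) ≠ 0 := Complex.ofReal_ne_zero.2 hs0.ne'
  have htc : (t : ℂ) ≠ 0 := Complex.ofReal_ne_zero.2 (by linarith)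
  have n1 : ‖w / (s : ℂ)‖ ≤ (100 / 99) * ‖w‖ := by
    rw [norm_div, Complex.norm_real, Real.norm_of_nonneg hs0.le, div_le_iff₀ hs0]
    nlinarith [norm_nonneg w]
  have e1 : ‖w / s - w / t‖ ≤ 8 * u * ‖w‖ := by
    have : w / (s : ℂ) - w / t = w / s * (((t - s) / t : ℝ) : ℂ) := by
      push_cast
      field_simp
    rw [this, norm_mul, Complex.norm_real, Real.norm_eq_abs, abs_div, abs_sub_comm,
      abs_of_pos (by linarith : 0 < t)]
    calc _ ≤ (100 / 99) * ‖w‖ * (7 * u) := by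
          gcongr
          rw [div_le_iff₀ (by linarith)]
          exact hs
      _ ≤ _ := by
          have : 0 ≤ u * ‖w‖ := by positivity
          linarith
  calc ‖r - w / t‖ = ‖(r - w / s) + (w / s - w / t)‖ := by ring_nf
    _ ≤ u * ((100 / 99) * ‖w‖) + 8 * u * ‖w‖ :=
        (norm_add_le _ _).trans (add_le_add (hr.trans (by gcongr)) e1)
    _ ≤ _ := by
        have : 0 ≤ u * ‖w‖ := by positivity
        linarith

theorem sqrt_error (hu : 0 ≤ u) (hu1 : u ≤ 1 / 1000) {N q d s : ℝ} (hN : 0 ≤ N)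
    (hq : |q - N| ≤ 3 * u * N) (hd : |d - (1 + q)| ≤ u * |1 + q|)
    (hs : 0 ≤ d → |s - Real.sqrt d| ≤ u * |Real.sqrt d|) :
    |s - Real.sqrt (1 + N)| ≤ 7 * u * Real.sqrt (1 + N) := by
  have hq0 : 0 ≤ q := by
    have := (abs_le.1 hq).1
    nlinarith
  rw [abs_of_nonneg (by linarith : 0 ≤ 1 + q)] at hd
  have hdD : |d - (1 + N)| ≤ 5 * u * (1 + N) := by
    calc |d - (1 + N)| = |(d - (1 + q)) + (q - N)| := by ring_nf
      _ ≤ u * (1 + q) + 3 * u * N := (abs_add_le _ _).trans (add_le_add hd hq)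
      _ ≤ _ := by
          have h1 := (abs_le.1 hq).2
          have h2 : u * (3 * u * N) ≤ u * N := by
            gcongr
            nlinarith
          nlinarith
  have hd0 : 0 ≤ d := by
    have := (abs_le.1 hdD).1
    nlinarith
  have hs' := hs hd0
  rw [abs_of_nonneg (Real.sqrt_nonneg _)] at hs'
  set D := 1 + N with hD
  have hD1 : 1 ≤ Real.sqrt D := Real.one_le_sqrt.2 (by linarith)
  have e1 : |Real.sqrt d - Real.sqrt D| ≤ 5 * u * Real.sqrt D := by
    have h1 : |Real.sqrt d - Real.sqrt D| * (Real.sqrt d + Real.sqrt D) = |d - D| := by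
      rw [← abs_of_nonneg (by positivity : 0 ≤ Real.sqrt d + Real.sqrt D), ← abs_mul]
      congr 1
      nlinarith [Real.sq_sqrt hd0, Real.sq_sqrt (by linarith : 0 ≤ D)]
    have h2 : |Real.sqrt d - Real.sqrt D| * Real.sqrt D ≤ 5 * u * Real.sqrt D * Real.sqrt D := by
      calc _ ≤ |Real.sqrt d - Real.sqrt D| * (Real.sqrt d + Real.sqrt D) := by
            gcongr
            linarith [Real.sqrt_nonneg d]
        _ ≤ 5 * u * D := h1.trans_le hdD
        _ = _ := by rw [mul_assoc (5 * u), Real.mul_self_sqrt (by linarith)]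
    exact le_of_mul_le_mul_right h2 (by linarith)
  have e2 : Real.sqrt d ≤ 2 * Real.sqrt D := by
    have := (abs_le.1 e1).2
    nlinarith
  calc |s - Real.sqrt D| = |(s - Real.sqrt d) + (Real.sqrt d - Real.sqrt D)| := by ring_nf
    _ ≤ u * (2 * Real.sqrt D) + 5 * u * Real.sqrt D :=
        (abs_add_le _ _).trans (add_le_add (hs'.trans (by gcongr)) e1)
    _ = _ := by ring

/-- The errors of `ξ` and `η` are measured against the polynomials of the computed `γ 0`, not of the
exact one. This is the form that the induction needs. -/
theorem ens_invNLFFT_one (hu : 0 ≤ u) (hu1 : u ≤ 1 / 1000) {n : ℕ} (hn : n ≤ 1) {a b : ℕ → ℂ}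
    (ha : a 0 ≠ 0) : Ensures (invNLFFT n a b) u fun out =>
      (∃ x e : ℂ, out.ξ = Pi.single 0 x ∧ out.η = Pi.single 0 e ∧
        ‖x - sc (out.γ 0) * out.γ 0‖ ≤ 10 * u * ‖out.γ 0‖ ∧ ‖e - sc (out.γ 0)‖ ≤ 10 * u) ∧
      ‖out.γ 0 - b 0 / a 0‖ ≤ 12 * u * ‖b 0 / a 0‖ := by
  rw [invNLFFT, dif_pos hn]
  refine (ens_cdiv hu hu1 _ ha).bind fun g hg => (ens_cnormSq hu (by linarith) _).bind
    fun q hq => (ens_rnd _).bind fun d hd => (ens_fsqrt d).bind fun s hs => ?_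
  have hs7 := sqrt_error hu hu1 (by positivity) hq hd hs
  have h1 : 1 ≤ Real.sqrt (1 + ‖g‖ ^ 2) := Real.one_le_sqrt.2 (by nlinarith [sq_nonneg ‖g‖])
  have hs0 : s ≠ 0 := by
    rintro rfl
    rw [zero_sub, abs_neg, abs_of_pos (by linarith)] at hs7
    nlinarith
  have hsc : sc g = ((Real.sqrt (1 + ‖g‖ ^ 2) : ℝ) : ℂ)⁻¹ := by rw [sc, Complex.ofReal_inv]
  refine (ens_cdivReal hu g hs0).bind fun x hx => (ens_fdiv hs0).bind fun e he => Ensures.pure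
    ⟨⟨x, e, rfl, rfl, ?_, ?_⟩, by simpa using hg⟩
  · simp only [Pi.single_eq_same]
    rw [hsc, inv_mul_eq_div]
    exact div_error hu hu1 h1 hs7 hx
  · simp only [Pi.single_eq_same]
    rw [hsc, ← one_div]
    have := div_error (w := 1) (r := e) hu hu1 h1 hs7 (by
      rw [← Complex.ofReal_one, ← Complex.ofReal_div, ← Complex.ofReal_sub, Complex.norm_real,
        Complex.norm_real]
      exact he)
    simpa using this

end leaf

/-! ### Well-conditioned inputs -/

section good

open PowerSeries

/-- Numerical constants are absorbed into spare powers of `R`, so that every later estimate has the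
form of a power of `R` times the error. -/
theorem pow_absorb {R : ℝ} (hR : 8 ≤ R) (i j : ℕ) : R ^ i * 8 ^ j ≤ R ^ (i + j) := by
  rw [pow_add]
  gcongr

/-- The first `n` coefficients of `f` and `h` form a well-conditioned input. -/
structure Good (R : ℝ) (n : ℕ) (f h : ℂ⟦X⟧) (σ A τ : ℝ) : Prop where
  lower : σ ≤ ‖coeff 0 f‖
  sq : normSq2 n f + normSq2 n h ≤ A
  bezout : ∃ x y, normSq2 n x + normSq2 n y ≤ R ^ 2 ∧ norm1 n (f * x + h * y - 1) ≤ τ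

theorem Good.mono {R : ℝ} {m n : ℕ} {f h : ℂ⟦X⟧} {σ A τ : ℝ} (H : Good R n f h σ A τ)
    (hmn : m ≤ n) : Good R m f h σ A τ := by
  obtain ⟨x, y, h1, h2⟩ := H.bezout
  exact ⟨H.lower, (add_le_add (normSq2_mono hmn _) (normSq2_mono hmn _)).trans H.sq, x, y,
    (add_le_add (normSq2_mono hmn _) (normSq2_mono hmn _)).trans h1, (norm1_mono hmn _).trans h2⟩

variable {R : ℝ} {n : ℕ} {f h : ℂ⟦X⟧} {σ A τ : ℝ}

theorem norm1_le_of_normSq2_add_le {c : ℝ} (hc : 0 ≤ c) (H : normSq2 n f + normSq2 n h ≤ c ^ 2) :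
    norm1 n f ≤ n * c ∧ norm1 n h ≤ n * c :=
  ⟨norm1_le_of_normSq2_le hc (by linarith [normSq2_nonneg n h]),
    norm1_le_of_normSq2_le hc (by linarith [normSq2_nonneg n f])⟩

theorem Good.norm1_le (H : Good R n f h σ A τ) (hn : (n : ℝ) ≤ R) (hA : A ≤ 2) :
    norm1 n f ≤ 2 * R ∧ norm1 n h ≤ 2 * R := by
  have := norm1_le_of_normSq2_add_le (c := 2) (by norm_num) (H.sq.trans (by linarith))
  exact ⟨this.1.trans (by linarith), this.2.trans (by linarith)⟩

/-- A pair `(η, ξ)` that nearly annihilates the input has `ξ` of the size of the second input. -/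
theorem Good.xi_le (H : Good R n f h σ A τ) (hR : 8 ≤ R) (hn : (n : ℝ) ≤ R) (hτ : τ ≤ 1 / 2)
    (γ : ℕ → ℂ) {k : ℕ} (hk : k ≤ n) {κ : ℝ} (hκ : κ ≤ 1)
    (hres : norm1 k (act2 (quad γ k) f h) ≤ κ * norm1 n h) :
    norm1 k (quad γ k).xi ≤ 6 * R ^ 3 * norm1 n h := by
  obtain ⟨x, y, hxy, he⟩ := H.bezout
  set q := quad γ k
  -- The Bezout relation times `ξ`, with `ξ f` replaced by `η h - act2`. The first term contains
  -- `h`, the residual is small relative to `h`, and the last term is at most half of the left side.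
  have hid : q.xi = h * (x * q.et + y * q.xi) - x * act2 q f h - q.xi * (f * x + h * y - 1) := by
    simp only [act2]
    ring
  obtain ⟨hx, hy⟩ := norm1_le_of_normSq2_add_le (by linarith : 0 ≤ R) hxy
  have hkR : (k : ℝ) ≤ R := le_trans (by exact_mod_cast hk) hn
  have hx' : norm1 k x ≤ R * R := (norm1_mono hk x).trans (hx.trans (by gcongr))
  have hy' : norm1 k y ≤ R * R := (norm1_mono hk y).trans (hy.trans (by gcongr))
  obtain ⟨n1, n2, -, -⟩ := norm1_quad_le γ k k
  have n1' : norm1 k q.et ≤ R := n1.trans hkR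
  have n2' : norm1 k q.xi ≤ R := n2.trans hkR
  have hB := norm1_nonneg n h
  have hxi := norm1_nonneg k q.xi
  have b1 : norm1 k (h * (x * q.et + y * q.xi)) ≤ norm1 n h * (R * R * R + R * R * R) := by
    refine (norm1_mul_le _ _ _).trans ?_
    gcongr
    · exact norm1_nonneg _ _
    · exact norm1_mono hk h
    · exact (norm1_add_le _ _ _).trans (add_le_add
        ((norm1_mul_le _ _ _).trans (mul_le_mul hx' n1' (norm1_nonneg _ _) (by positivity)))
        ((norm1_mul_le _ _ _).trans (mul_le_mul hy' n2' (norm1_nonneg _ _) (by positivity))))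
  have b2 : norm1 k (x * act2 q f h) ≤ R * R * (1 * norm1 n h) := by
    refine (norm1_mul_le _ _ _).trans ?_
    gcongr
    · exact norm1_nonneg _ _
    · exact hres.trans (by gcongr)
  have b3 : norm1 k (q.xi * (f * x + h * y - 1)) ≤ norm1 k q.xi * (1 / 2) := by
    refine (norm1_mul_le _ _ _).trans ?_
    gcongr
    exact (norm1_mono hk _).trans (he.trans hτ)
  have total : norm1 k q.xi ≤ norm1 n h * (R * R * R + R * R * R) + R * R * (1 * norm1 n h) +
      norm1 k q.xi * (1 / 2) := by
    calc norm1 k q.xi = norm1 k (h * (x * q.et + y * q.xi) - x * act2 q f h -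
          q.xi * (f * x + h * y - 1)) := congrArg _ hid
      _ ≤ _ := (norm1_sub_le _ _ _).trans (add_le_add ((norm1_sub_le _ _ _).trans
          (add_le_add b1 b2)) b3)
  have hRR : R * R * norm1 n h ≤ R * R * R * norm1 n h := by
    refine mul_le_mul_of_nonneg_right ?_ hB
    exact le_mul_of_one_le_right (by positivity) (by linarith)
  nlinarith

theorem norm1_xi_le (γ : ℕ → ℂ) (k n : ℕ) : norm1 n (quad γ k).xi ≤ norm1 k (quad γ k).xi := by
  rcases le_total n k with h | h
  · exact norm1_mono h _
  · obtain ⟨d, rfl⟩ := Nat.exists_eq_add_of_le h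
    rw [norm1, Finset.sum_range_add, ← norm1,
      Finset.sum_eq_zero fun i _ => by
        rw [(coeff_quad_eq_zero_of_le γ k _ (by omega)).2, norm_zero], add_zero]

/-- The loss is linear in the perturbation, so the total mass of the input grows only by a small
additive amount per level. -/
theorem normSq2_sub_le {c : ℝ} (hc : ∀ i < n, ‖coeff i f‖ ≤ c) (r : ℂ⟦X⟧) :
    normSq2 n (f - r) ≤ normSq2 n f + 2 * c * norm1 n r + norm1 n r ^ 2 := by
  calc normSq2 n (f - r) ≤ ∑ i ∈ Finset.range n,
        (‖coeff i f‖ ^ 2 + 2 * c * ‖coeff i r‖ + norm1 n r * ‖coeff i r‖) := by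
        refine Finset.sum_le_sum fun i hi => ?_
        have hi' := Finset.mem_range.1 hi
        have h1 := norm_sub_le (coeff i f) (coeff i r)
        have h2 := hc i hi'
        have h3 := norm_coeff_le_norm1 hi' r
        have h4 := norm_nonneg (coeff i r)
        rw [map_sub]
        have h5 : ‖coeff i f - coeff i r‖ ^ 2 ≤ (‖coeff i f‖ + ‖coeff i r‖) ^ 2 := by gcongr
        nlinarith
    _ = _ := by
        rw [Finset.sum_add_distrib, Finset.sum_add_distrib, ← Finset.mul_sum, ← Finset.mul_sum]
        simp only [normSq2, norm1]
        ring

/-- Well-conditioned inputs lead to well-conditioned inputs of the second recursive call. -/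
theorem Good.down (H : Good R n f h σ A τ) (hR : 8 ≤ R) (hn : (n : ℝ) ≤ R) (hA : A ≤ 2)
    (γ : ℕ → ℂ) {m : ℕ} (hm : m < n) {f' h' : ℂ⟦X⟧} {ρ : ℝ} (hρ0 : 0 ≤ ρ) (hρ : R ^ 5 * ρ ≤ 1)
    (h1 : norm1 n (act1 (quad γ m) f h - X ^ m * f') ≤ ρ)
    (h2 : norm1 n (act2 (quad γ m) f h - X ^ m * h') ≤ ρ * norm1 n h) :
    Good R (n - m) f' h' (σ - R ^ 5 * ρ) (A + R ^ 5 * ρ) (τ + R ^ 5 * ρ) := by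
  obtain ⟨x, y, hxy, he⟩ := H.bezout
  set q := quad γ m with hq
  set r1 := act1 q f h - X ^ m * f' with hr1
  set r2 := act2 q f h - X ^ m * h' with hr2
  obtain ⟨nf, nh⟩ := H.norm1_le hn hA
  have h0 := norm1_nonneg n h
  have h2' : norm1 n r2 ≤ 2 * R * ρ := h2.trans (by nlinarith)
  have hdet : q.et * q.ets + q.xi * q.xis = X ^ m := quad_det γ m
  have hmn : m + (n - m) = n := by omega
  obtain ⟨n1, n2, n3, n4⟩ := norm1_quad_le γ m n
  rw [← hq] at n1 n2 n3 n4
  have hRpos : 0 < R := by linarith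
  have p2 := mul_le_mul_of_nonneg_right (pow_absorb hR 2 3) hρ0
  have p3 := mul_le_mul_of_nonneg_right (pow_absorb hR 3 2) hρ0
  have p1 := mul_le_mul_of_nonneg_right (pow_absorb hR 1 4) hρ0
  have p0 := mul_le_mul_of_nonneg_right (pow_absorb hR 0 5) hρ0
  have p12 := mul_le_mul_of_nonneg_right (pow_absorb hR 1 1) hρ0
  norm_num at p0 p1 p2 p3 p12
  have hR2ρ : 0 ≤ R ^ 2 * ρ := by positivity
  have hR3ρ : 0 ≤ R ^ 3 * ρ := by positivity
  have hRρ : 0 ≤ R * ρ := by positivity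
  refine ⟨?_, ?_, ?_⟩
  -- The adjugate inverts the action. In degree `m` the term with `ξ♯` drops out because `ξ♯`
  -- vanishes at 0. As `η` has constant coefficient at most 1 in modulus, that of `f'` is, up to
  -- errors, at least that of `f`.
  · have hid : X ^ m * f = X ^ m * (q.et * f') - X ^ m * (q.xis * h') +
        (q.et * r1 - q.xis * r2) := by
      rw [hr1, hr2, act1, act2]
      linear_combination -f * hdet
    have hc0 : ∀ f g : ℂ⟦X⟧, coeff 0 (f * g) = coeff 0 f * coeff 0 g := fun f g => by simp
    have hc := congrArg (coeff m) hid
    rw [map_add, map_sub, coeff_X_pow_mul', coeff_X_pow_mul', coeff_X_pow_mul', if_pos le_rfl,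
      if_pos le_rfl, if_pos le_rfl, Nat.sub_self, hc0,
      hc0, (coeff_zero_sharp γ m).1, zero_mul, sub_zero] at hc
    have e1 : ‖coeff m (q.et * r1 - q.xis * r2)‖ ≤ R * ρ + R * (2 * R * ρ) := by
      refine (norm_coeff_le_norm1 hm _).trans ((norm1_sub_le _ _ _).trans (add_le_add ?_ ?_)) <;>
      refine (norm1_mul_le _ _ _).trans ?_ <;> gcongr <;>
      first
        | exact norm1_nonneg _ _
        | linarith
    have e2 : ‖coeff 0 q.et * coeff 0 f'‖ ≤ ‖coeff 0 f'‖ := by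
      rw [norm_mul]
      exact mul_le_of_le_one_left (norm_nonneg _) (norm_coeff_quad_le γ m 0).1
    have e3 := H.lower
    rw [hc] at e3
    have e4 := e3.trans (norm_add_le _ _)
    nlinarith
  · have hX1 : X ^ m * f' = act1 q f h - r1 := by rw [hr1]; ring
    have hX2 : X ^ m * h' = act2 q f h - r2 := by rw [hr2]; ring
    have hact := normSq2_act_le γ m n f h
    rw [← hq] at hact
    have hAs := H.sq
    have hc1 : ∀ i < n, ‖coeff i (act1 q f h)‖ ≤ 2 := fun i hi =>
      le_of_sq_le_sq (by
        linarith [sq_norm_coeff_le_normSq2 hi (act1 q f h), normSq2_nonneg n (act2 q f h)])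
        (by norm_num)
    have hc2 : ∀ i < n, ‖coeff i (act2 q f h)‖ ≤ 2 := fun i hi =>
      le_of_sq_le_sq (by
        linarith [sq_norm_coeff_le_normSq2 hi (act2 q f h), normSq2_nonneg n (act1 q f h)])
        (by norm_num)
    have g1 := normSq2_sub_le hc1 r1
    have g2 := normSq2_sub_le hc2 r2
    rw [← hX1] at g1
    rw [← hX2] at g2
    have s1 := normSq2_X_pow_mul m (n - m) f'
    have s2 := normSq2_X_pow_mul m (n - m) h'
    rw [hmn] at s1 s2
    have hsq1 : norm1 n r1 ^ 2 ≤ ρ := by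
      have : norm1 n r1 * norm1 n r1 ≤ ρ * 1 :=
        mul_le_mul h1 (by linarith) (norm1_nonneg _ _) hρ0
      nlinarith
    have hsq2 : norm1 n r2 ^ 2 ≤ 2 * R * ρ := by
      have : norm1 n r2 * norm1 n r2 ≤ (2 * R * ρ) * 1 :=
        mul_le_mul h2' (by linarith) (norm1_nonneg _ _) (by positivity)
      nlinarith
    linarith
  -- The adjoint action on `(x, y)`: pairing it with the transformed input gives `X ^ m * (f x + h
  -- y)` by the determinant identity. Being a contraction, it leaves the bound `R ^ 2` unchanged, so
  -- only the Bezout defect grows.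
  · refine ⟨q.et * x + q.xi * y, q.ets * y - q.xis * x, ?_, ?_⟩
    · exact ((add_le_add (normSq2_mono (Nat.sub_le _ _) _) (normSq2_mono (Nat.sub_le _ _) _)).trans
        (normSq2_adj_le γ m n x y)).trans hxy
    · have hadj := (normSq2_adj_le γ m n x y).trans hxy
      rw [← hq] at hadj
      obtain ⟨nx, ny⟩ := norm1_le_of_normSq2_add_le hRpos.le hadj
      have s := norm1_X_pow_mul m (n - m)
        (f' * (q.et * x + q.xi * y) + h' * (q.ets * y - q.xis * x) - 1)
      rw [hmn] at s
      rw [← s]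
      have hid : X ^ m * (f' * (q.et * x + q.xi * y) + h' * (q.ets * y - q.xis * x) - 1) =
          X ^ m * (f * x + h * y - 1) - r1 * (q.et * x + q.xi * y) -
            r2 * (q.ets * y - q.xis * x) := by
        rw [hr1, hr2, act1, act2]
        linear_combination (f * x + h * y) * hdet
      rw [hid]
      have e1 : norm1 n (X ^ m * (f * x + h * y - 1)) ≤ τ := by
        have s' := norm1_X_pow_mul m (n - m) (f * x + h * y - 1)
        rw [hmn] at s'
        rw [s']
        exact (norm1_mono (Nat.sub_le _ _) _).trans he
      have e2 : norm1 n (r1 * (q.et * x + q.xi * y)) ≤ ρ * (R * R) :=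
        (norm1_mul_le _ _ _).trans
          (mul_le_mul h1 (nx.trans (by gcongr)) (norm1_nonneg _ _) hρ0)
      have e3 : norm1 n (r2 * (q.ets * y - q.xis * x)) ≤ 2 * R * ρ * (R * R) :=
        (norm1_mul_le _ _ _).trans
          (mul_le_mul h2' (ny.trans (by gcongr)) (norm1_nonneg _ _) (by positivity))
      refine (norm1_sub_le _ _ _).trans ((add_le_add ((norm1_sub_le _ _ _).trans
        (add_le_add e1 e2)) e3).trans ?_)
      nlinarith

end good

/-! ### Accuracy of the divide-and-conquer recursion -/

section recursion

open PowerSeries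

theorem norm1_le_of_support {m : ℕ} {f : ℂ⟦X⟧} (h : ∀ i, m ≤ i → coeff i f = 0) (n : ℕ) :
    norm1 n f ≤ norm1 m f := by
  rcases le_total n m with hnm | hnm
  · exact norm1_mono hnm _
  · obtain ⟨d, rfl⟩ := Nat.exists_eq_add_of_le hnm
    rw [norm1, Finset.sum_range_add, ← norm1,
      Finset.sum_eq_zero fun i _ => by rw [h _ (by omega), norm_zero], add_zero]

theorem norm1_sharp_le {m : ℕ} {p : ℕ → ℂ} (hp : ∀ i, m ≤ i → p i = 0) (n : ℕ) :
    norm1 n (mk (sharp m p)) ≤ norm1 m (mk p) := by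
  refine (norm1_le_of_support (m := m + 1) (fun i hi => ?_) n).trans (le_of_eq ?_)
  · rw [coeff_mk, sharp, if_neg (by omega)]
  · rw [norm1, Finset.sum_range_succ', coeff_mk, sharp, if_pos (Nat.zero_le _), Nat.sub_zero,
      hp m le_rfl, map_zero, norm_zero, add_zero, norm1, ← Finset.sum_range_reflect]
    refine Finset.sum_congr rfl fun i hi => ?_
    have hi' := Finset.mem_range.1 hi
    rw [coeff_mk, sharp, if_pos (by omega), Complex.norm_conj, coeff_mk]
    congr 2
    omega

theorem sharp_sub (m : ℕ) (p q : ℕ → ℂ) :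
    mk (sharp m p) - mk (sharp m q) = mk (sharp m fun i => p i - q i) := by
  ext i
  simp only [map_sub, coeff_mk, sharp]
  split_ifs <;> simp

theorem quad_sharp (γ : ℕ → ℂ) (m : ℕ) :
    (quad γ m).ets = mk (sharp m fun i => coeff i (quad γ m).et) ∧
      (quad γ m).xis = mk (sharp m fun i => coeff i (quad γ m).xi) := by
  constructor <;> ext i <;> rw [coeff_mk, sharp] <;> split_ifs with h
  · exact (coeff_sharp γ m i h).1
  · exact (coeff_quad_eq_zero γ m i (by omega)).2.2.1
  · exact (coeff_sharp γ m i h).2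
  · exact (coeff_quad_eq_zero γ m i (by omega)).2.2.2

theorem norm1_take_le (n N : ℕ) (a : ℕ → ℂ) : norm1 N (mk (take n a)) ≤ norm1 n (mk a) := by
  refine (norm1_le_of_support (m := n) (fun i hi => ?_) N).trans (le_of_eq ?_)
  · rw [coeff_mk, take, if_neg (by omega)]
  · exact norm1_congr fun i hi => by rw [coeff_mk, coeff_mk, take, if_pos hi]

theorem norm1_mul_take_sub (n : ℕ) (f : ℂ⟦X⟧) (a : ℕ → ℂ) :
    norm1 n (f * mk (take n a) - f * mk a) = 0 := by
  rw [← mul_sub]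
  refine le_antisymm ((norm1_mul_le _ _ _).trans_eq ?_) (norm1_nonneg _ _)
  rw [norm1_eq_zero (f := mk (take n a) - mk a) fun i hi => by
    rw [map_sub, coeff_mk, coeff_mk, take, if_pos hi, sub_self], mul_zero]

/-- Since `28 < 2 ^ 5`, the factor `(28 ^ t) ^ 3` is at most `(2 ^ t) ^ 15 ≤ R ^ 15`. The constant
53 costs `R ^ 2`, and summing over `n ≤ R` coefficients costs one more power. -/
theorem ens_conv2_norm1 {u R : ℝ} (hu : 0 ≤ u) (hu1 : u ≤ 1) (hR : 8 ≤ R) {t n : ℕ}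
    (ht : (2 : ℝ) ^ t ≤ R) (hn : n ≤ 2 ^ t) {o : ℂ → ℂ → FP ℂ} {σ : ℂ}
    (hσ : ‖σ‖ = 1) (hσ' : conj σ = σ)
    (ho : ∀ x y, Ensures (o x y) u fun r => ‖r - (x + σ * y)‖ ≤ u * ‖x + σ * y‖)
    {p q r s : ℕ → ℂ} (hpq : ∀ j l, 2 ^ t ≤ j + l → p j * q l = 0)
    (hrs : ∀ j l, 2 ^ t ≤ j + l → r j * s l = 0) {p' q' r' s' : ℝ}
    (hp : norm1 (2 ^ t) (mk p) ≤ p') (hq : norm1 (2 ^ t) (mk q) ≤ q')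
    (hr : norm1 (2 ^ t) (mk r) ≤ r') (hs : norm1 (2 ^ t) (mk s) ≤ s') :
    Ensures (conv2 t o p q r s) u fun c =>
      norm1 n (mk c - (mk p * mk q + C σ * (mk r * mk s))) ≤
        R ^ 18 * u * (p' * q' + r' * s') := by
  refine (ens_conv2 hu hu1 t hσ hσ' ho hpq hrs).mono fun c hc => ?_
  have e : ∀ p : ℕ → ℂ, sum1 (2 ^ t) p = norm1 (2 ^ t) (mk p) := fun p => by simp [sum1, norm1]
  have hp0 := (norm1_nonneg _ _).trans hp
  have hq0 := (norm1_nonneg _ _).trans hq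
  have hr0 := (norm1_nonneg _ _).trans hr
  have hs0 := (norm1_nonneg _ _).trans hs
  have h28 : ((28 : ℝ) ^ t) ^ 3 ≤ R ^ 15 := by
    calc ((28 : ℝ) ^ t) ^ 3 ≤ ((32 : ℝ) ^ t) ^ 3 := by gcongr; norm_num
      _ = ((2 : ℝ) ^ t) ^ 15 := by
          rw [show (32 : ℝ) = 2 ^ 5 by norm_num, ← pow_mul, ← pow_mul, ← pow_mul]
          congr 1
          ring
      _ ≤ R ^ 15 := by gcongr
  have hnR : (n : ℝ) ≤ R := le_trans (by exact_mod_cast hn) ht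
  refine (norm1_le_of_coeff_le (c := 53 * R ^ 15 * u * (p' * q' + r' * s')) fun i hi => ?_).trans ?_
  · rw [map_sub, coeff_mk, map_add, coeff_C_mul]
    refine (hc.1 i (by omega)).trans ?_
    rw [e, e, e, e]
    have h1 : norm1 (2 ^ t) (mk p) * norm1 (2 ^ t) (mk q) ≤ p' * q' :=
      mul_le_mul hp hq (norm1_nonneg _ _) hp0
    have h2 : norm1 (2 ^ t) (mk r) * norm1 (2 ^ t) (mk s) ≤ r' * s' :=
      mul_le_mul hr hs (norm1_nonneg _ _) hr0
    calc _ ≤ 53 * ((28 : ℝ) ^ t) ^ 3 * u * (p' * q' + r' * s') :=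
          mul_le_mul_of_nonneg_left (add_le_add h1 h2) (by positivity)
      _ ≤ _ := by gcongr
  · calc (n : ℝ) * (53 * R ^ 15 * u * (p' * q' + r' * s'))
        ≤ R * (R ^ 2 * R ^ 15 * u * (p' * q' + r' * s')) := by
          gcongr
          nlinarith
      _ = _ := by ring

/-- The output belongs, up to the relative error `κ`, to the sequence `γ` that it contains, and
every initial segment of `γ` nearly annihilates the input. -/
structure Accurate (n : ℕ) (f h : ℂ⟦X⟧) (out : Output) (κ : ℝ) : Prop where
  intro ::
  eta_support : ∀ i, n ≤ i → out.η i = 0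
  xi_support : ∀ i, n ≤ i → out.ξ i = 0
  eta_error : norm1 n ((quad out.γ n).et - mk out.η) ≤ κ
  xi_error : norm1 n ((quad out.γ n).xi - mk out.ξ) ≤ κ * norm1 n h
  residual1 : ∀ k ≤ n, norm1 k (act1 (quad out.γ k) f h) ≤ κ
  residual2 : ∀ k ≤ n, norm1 k (act2 (quad out.γ k) f h) ≤ κ * norm1 n h

variable {R : ℝ} {n : ℕ} {f h : ℂ⟦X⟧} {σ A τ κ : ℝ} {out : Output}

theorem Accurate.sharp_error (H : Accurate n f h out κ) (hn : 0 < n) (N : ℕ) :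
    norm1 N ((quad out.γ n).ets - mk (sharp n out.η)) ≤ κ ∧
      norm1 N ((quad out.γ n).xis - mk (sharp n out.ξ)) ≤ κ * norm1 n h := by
  have e : ∀ (g : ℂ⟦X⟧) (v : ℕ → ℂ), mk (fun i => coeff i g - v i) = g - mk v := fun g v => by
    ext i
    simp
  constructor
  · rw [(quad_sharp _ _).1, sharp_sub]
    refine (norm1_sharp_le (fun i hi => ?_) N).trans ?_
    · rw [H.eta_support i hi, (coeff_quad_eq_zero_of_le _ n i hi).1 hn, sub_zero]
    · rw [e]
      exact H.eta_error
  · rw [(quad_sharp _ _).2, sharp_sub]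
    refine (norm1_sharp_le (fun i hi => ?_) N).trans ?_
    · rw [H.xi_support i hi, (coeff_quad_eq_zero_of_le _ n i hi).2, sub_zero]
    · rw [e]
      exact H.xi_error

theorem Accurate.error (H : Accurate n f h out κ) (hn : 0 < n) (N : ℕ) :
    norm1 N ((quad out.γ n).et - mk out.η) ≤ κ ∧
      norm1 N ((quad out.γ n).xi - mk out.ξ) ≤ κ * norm1 n h := by
  constructor
  · refine (norm1_le_of_support (fun i hi => ?_) N).trans H.eta_error
    rw [map_sub, coeff_mk, H.eta_support i hi, (coeff_quad_eq_zero_of_le _ n i hi).1 hn, sub_zero]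
  · refine (norm1_le_of_support (fun i hi => ?_) N).trans H.xi_error
    rw [map_sub, coeff_mk, H.xi_support i hi, (coeff_quad_eq_zero_of_le _ n i hi).2, sub_zero]

theorem Accurate.xi_le (H : Accurate n f h out κ) (G : Good R n f h σ A τ) (hR : 8 ≤ R)
    (hnR : (n : ℝ) ≤ R) (hτ : τ ≤ 1 / 2) (hκ : κ ≤ 1) (N k : ℕ) (hk : k ≤ n) :
    norm1 N (quad out.γ k).xi ≤ R ^ 4 * norm1 n h := by
  refine (norm1_xi_le _ _ _).trans ((G.xi_le hR hnR hτ _ hk hκ (H.residual2 k hk)).trans ?_)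
  have h0 := norm1_nonneg n h
  have := mul_le_mul_of_nonneg_right (pow_absorb hR 3 1) h0
  have h3 : 0 ≤ R ^ 3 * norm1 n h := by positivity
  norm_num at this
  linarith

theorem Accurate.output_le (H : Accurate n f h out κ) (G : Good R n f h σ A τ) (hR : 8 ≤ R)
    (hnR : (n : ℝ) ≤ R) (hτ : τ ≤ 1 / 2) (hκ : κ ≤ 1) :
    norm1 n (mk out.η) ≤ 2 * R ∧ norm1 n (mk out.ξ) ≤ R ^ 4 * norm1 n h := by
  have h0 := norm1_nonneg n h
  constructor
  · have e : mk out.η = (quad out.γ n).et - ((quad out.γ n).et - mk out.η) := by ring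
    rw [e]
    refine (norm1_sub_le _ _ _).trans ?_
    linarith [(norm1_quad_le out.γ n n).1, H.eta_error]
  · have e : mk out.ξ = (quad out.γ n).xi - ((quad out.γ n).xi - mk out.ξ) := by ring
    rw [e]
    refine (norm1_sub_le _ _ _).trans ?_
    have h1 := G.xi_le hR hnR hτ out.γ le_rfl hκ (H.residual2 n le_rfl)
    have h2 := H.xi_error
    have h3 : κ * norm1 n h ≤ R ^ 3 * norm1 n h := by
      gcongr
      exact hκ.trans (one_le_pow₀ (by linarith))
    have := mul_le_mul_of_nonneg_right (pow_absorb hR 3 1) h0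
    have h3 : 0 ≤ R ^ 3 * norm1 n h := by positivity
    norm_num at this
    linarith

theorem Accurate.norm1_output_le (H : Accurate n f h out κ) (G : Good R n f h σ A τ) (hR : 8 ≤ R)
    (hnR : (n : ℝ) ≤ R) (hτ : τ ≤ 1 / 2) (hκ : κ ≤ 1) (N : ℕ) :
    norm1 N (mk out.η) ≤ 2 * R ∧ norm1 N (mk out.ξ) ≤ R ^ 4 * norm1 n h ∧
      norm1 N (mk (sharp n out.η)) ≤ 2 * R ∧
      norm1 N (mk (sharp n out.ξ)) ≤ R ^ 4 * norm1 n h := by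
  obtain ⟨h1, h2⟩ := H.output_le G hR hnR hτ hκ
  exact ⟨(norm1_le_of_support (fun i hi => by rw [coeff_mk, H.eta_support i hi]) N).trans h1,
    (norm1_le_of_support (fun i hi => by rw [coeff_mk, H.xi_support i hi]) N).trans h2,
    (norm1_sharp_le H.eta_support N).trans h1, (norm1_sharp_le H.xi_support N).trans h2⟩

/-- The input of the second recursive call is close to the exact one. -/
theorem Accurate.down_error {m : ℕ} (H : Accurate m f h out κ) (G : Good R n f h σ A τ)
    (hR : 8 ≤ R) (hnR : (n : ℝ) ≤ R) (hA : A ≤ 2) (hm : 0 < m) (hmn : m < n)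
    (hκ0 : 0 ≤ κ) {w : ℝ} (hw : 0 ≤ w) {a b P Q : ℕ → ℂ} (hf : f = mk a) (hh : h = mk b)
    (hP : norm1 n (mk P - (mk (sharp m out.η) * mk (take n a) +
      C 1 * (mk (sharp m out.ξ) * mk (take n b)))) ≤
        w * (2 * R * (2 * R) + R ^ 4 * norm1 n h * norm1 n h))
    (hQ : norm1 n (mk Q - (mk out.η * mk (take n b) + C (-1) * (mk out.ξ * mk (take n a)))) ≤
        w * (2 * R * norm1 n h + R ^ 4 * norm1 n h * (2 * R))) :
    norm1 n (act1 (quad out.γ m) f h -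
        X ^ m * mk (take (n - m) fun i => P (m + i))) ≤ R ^ 7 * (κ + w) ∧
      norm1 n (act2 (quad out.γ m) f h - X ^ m * mk (take (n - m) fun i => Q (m + i))) ≤
        R ^ 7 * (κ + w) * norm1 n h := by
  obtain ⟨nf, nh⟩ := G.norm1_le hnR hA
  obtain ⟨s1, s2⟩ := H.sharp_error hm n
  obtain ⟨e1, e2⟩ := H.error hm n
  have h0 := norm1_nonneg n h
  have hBm : norm1 m h ≤ norm1 n h := norm1_mono hmn.le h
  -- The algorithm drops the first `m` coefficients of the products. Below `m` the error is thus the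
  -- residual of the first half, and from `m` on it is the error of the computed product.
  have split : ∀ (g : ℂ⟦X⟧) (v : ℕ → ℂ),
      norm1 n (g - X ^ m * mk (take (n - m) fun i => v (m + i))) ≤
        norm1 m g + norm1 n (g - mk v) := by
    intro g v
    have key : ∀ i, i < n → coeff i (g - X ^ m * mk (take (n - m) fun i => v (m + i))) =
        if i < m then coeff i g else coeff i (g - mk v) := by
      intro i hi
      rw [map_sub, map_sub, coeff_X_pow_mul', coeff_mk]
      by_cases h : i < m
      · rw [if_neg (by omega), if_pos h, sub_zero]
      · rw [if_pos (by omega), if_neg h, coeff_mk, take, if_pos (by omega)]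
        congr 2
        omega
    obtain ⟨d, rfl⟩ := Nat.exists_eq_add_of_le hmn.le
    rw [norm1, Finset.sum_range_add]
    refine add_le_add (le_of_eq (Finset.sum_congr rfl fun i hi => ?_)) ?_
    · have hi' := Finset.mem_range.1 hi
      rw [key i (by omega), if_pos hi']
    · rw [norm1, Finset.sum_range_add]
      refine le_add_of_nonneg_of_le (Finset.sum_nonneg fun _ _ => norm_nonneg _)
        (le_of_eq (Finset.sum_congr rfl fun i hi => ?_))
      have hi' := Finset.mem_range.1 hi
      rw [key _ (by omega), if_neg (by omega)]
  have t1 := norm1_mul_take_sub n (mk (sharp m out.η)) a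
  have t2 := norm1_mul_take_sub n (mk (sharp m out.ξ)) b
  have t3 := norm1_mul_take_sub n (mk out.η) b
  have t4 := norm1_mul_take_sub n (mk out.ξ) a
  rw [← hf] at t1 t4
  rw [← hh] at t2 t3
  set q := quad out.γ m
  set B := norm1 n h
  have m1 : ∀ {g g' : ℂ⟦X⟧} {c c' : ℝ}, norm1 n g ≤ c → norm1 n g' ≤ c' →
      norm1 n (g * g') ≤ c * c' := fun hg hg' =>
    (norm1_mul_le _ _ _).trans (mul_le_mul hg hg' (norm1_nonneg _ _)
      ((norm1_nonneg _ _).trans hg))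
  have hκB : κ * norm1 m h ≤ κ * B := by gcongr
  constructor
  · refine (split _ _).trans ?_
    have hid : act1 q f h - mk P = (q.ets - mk (sharp m out.η)) * f +
        (q.xis - mk (sharp m out.ξ)) * h -
        (mk (sharp m out.η) * mk (take n a) - mk (sharp m out.η) * f) -
        (mk (sharp m out.ξ) * mk (take n b) - mk (sharp m out.ξ) * h) -
        (mk P - (mk (sharp m out.η) * mk (take n a) +
          C 1 * (mk (sharp m out.ξ) * mk (take n b)))) := by
      rw [act1, map_one]
      ring
    have b1 : norm1 n (act1 q f h - mk P) ≤ κ * (2 * R) + κ * B * B + 0 + 0 +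
        w * (2 * R * (2 * R) + R ^ 4 * B * B) := by
      rw [hid]
      refine (norm1_sub_le _ _ _).trans (add_le_add ((norm1_sub_le _ _ _).trans (add_le_add
        ((norm1_sub_le _ _ _).trans (add_le_add ((norm1_add_le _ _ _).trans (add_le_add
          (m1 s1 nf) (m1 (s2.trans hκB) le_rfl))) t1.le)) t2.le)) hP)
    have b2 := H.residual1 m le_rfl
    have hBB : B * B ≤ 4 * R ^ 2 := by nlinarith
    have c1 : κ + (κ * (2 * R) + κ * B * B) ≤ R ^ 7 * κ := by
      have : κ * (B * B) ≤ κ * (4 * R ^ 2) := by gcongr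
      have p0 := mul_le_mul_of_nonneg_right (pow_absorb hR 0 7) hκ0
      have p1 := mul_le_mul_of_nonneg_right (pow_absorb hR 1 6) hκ0
      have p2 := mul_le_mul_of_nonneg_right (pow_absorb hR 2 5) hκ0
      have q1 : 0 ≤ R * κ := by positivity
      have q2 : 0 ≤ R ^ 2 * κ := by positivity
      norm_num at p0 p1 p2
      linarith
    have c2 : w * (2 * R * (2 * R) + R ^ 4 * B * B) ≤ R ^ 7 * w := by
      have : w * R ^ 4 * (B * B) ≤ w * R ^ 4 * (4 * R ^ 2) := by gcongr
      have p1 := mul_le_mul_of_nonneg_right (pow_absorb hR 2 5) hw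
      have p2 := mul_le_mul_of_nonneg_right (pow_absorb hR 6 1) hw
      have q1 : 0 ≤ R ^ 2 * w := by positivity
      have q2 : 0 ≤ R ^ 6 * w := by positivity
      norm_num at p1 p2
      linarith
    linarith
  · refine (split _ _).trans ?_
    have hid : act2 q f h - mk Q = (q.et - mk out.η) * h - (q.xi - mk out.ξ) * f -
        (mk out.η * mk (take n b) - mk out.η * h) +
        (mk out.ξ * mk (take n a) - mk out.ξ * f) -
        (mk Q - (mk out.η * mk (take n b) + C (-1) * (mk out.ξ * mk (take n a)))) := by
      rw [act2, map_neg, map_one]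
      ring
    have b1 : norm1 n (act2 q f h - mk Q) ≤ κ * B + κ * B * (2 * R) + 0 + 0 +
        w * (2 * R * B + R ^ 4 * B * (2 * R)) := by
      rw [hid]
      refine (norm1_sub_le _ _ _).trans (add_le_add ((norm1_add_le _ _ _).trans (add_le_add
        ((norm1_sub_le _ _ _).trans (add_le_add ((norm1_sub_le _ _ _).trans (add_le_add
          (m1 e1 le_rfl) (m1 (e2.trans hκB) nf))) t3.le)) t4.le)) hQ)
    have b2 := (H.residual2 m le_rfl).trans hκB
    have hκB0 : 0 ≤ κ * B := by positivity
    have hwB0 : 0 ≤ w * B := by positivity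
    have c1 : κ * B + (κ * B + κ * B * (2 * R)) ≤ R ^ 7 * (κ * B) := by
      have p0 := mul_le_mul_of_nonneg_right (pow_absorb hR 0 7) hκB0
      have p1 := mul_le_mul_of_nonneg_right (pow_absorb hR 1 6) hκB0
      have q1 : 0 ≤ R * (κ * B) := by positivity
      norm_num at p0 p1
      linarith
    have c2 : w * (2 * R * B + R ^ 4 * B * (2 * R)) ≤ R ^ 7 * (w * B) := by
      have p1 := mul_le_mul_of_nonneg_right (pow_absorb hR 1 6) hwB0
      have p2 := mul_le_mul_of_nonneg_right (pow_absorb hR 5 2) hwB0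
      have q1 : 0 ≤ R * (w * B) := by positivity
      have q2 : 0 ≤ R ^ 5 * (w * B) := by positivity
      norm_num at p1 p2
      linarith
    linarith

end recursion

/-! ### Joining the two halves of the recursion. -/

section combine

open PowerSeries

variable {R : ℝ} {n m : ℕ} {f h f' h' : ℂ⟦X⟧} {σ A τ σ' A' τ' κ κ' w : ℝ} {out1 out2 : Output}

theorem norm1_mul_le_of_le {n : ℕ} {g g' : ℂ⟦X⟧} {c c' : ℝ} (hg : norm1 n g ≤ c)
    (hg' : norm1 n g' ≤ c') : norm1 n (g * g') ≤ c * c' :=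
  (norm1_mul_le _ _ _).trans (mul_le_mul hg hg' (norm1_nonneg _ _) ((norm1_nonneg _ _).trans hg))

/-- The new second component is close to `η h - ξ f`, and both terms are `O(h)` because `ξ` is.
Errors relative to `h'` in the second call thereby become errors relative to `h`. -/
theorem Accurate.norm1_down_le (H : Accurate m f h out1 κ) (G : Good R n f h σ A τ)
    (hR : 8 ≤ R) (hnR : (n : ℝ) ≤ R) (hA : A ≤ 2) (hτ : τ ≤ 1 / 2) (hmn : m < n)
    (hκ : κ ≤ 1) {ρ : ℝ} (hρ : ρ ≤ 1)
    (h2 : norm1 n (act2 (quad out1.γ m) f h - X ^ m * h') ≤ ρ * norm1 n h) :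
    norm1 (n - m) h' ≤ R ^ 6 * norm1 n h := by
  have h0 := norm1_nonneg n h
  have hBm : norm1 m h ≤ norm1 n h := norm1_mono hmn.le h
  have hmR : (m : ℝ) ≤ R := le_trans (by exact_mod_cast hmn.le) hnR
  have s := norm1_X_pow_mul m (n - m) h'
  rw [show m + (n - m) = n by omega] at s
  have e : X ^ m * h' = act2 (quad out1.γ m) f h -
      (act2 (quad out1.γ m) f h - X ^ m * h') := by ring
  rw [← s, e]
  have hxi := H.xi_le (G.mono hmn.le) hR hmR hτ hκ n m le_rfl
  have hxi' : norm1 n (quad out1.γ m).xi ≤ R ^ 4 * norm1 n h := hxi.trans (by gcongr)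
  have b : norm1 n (act2 (quad out1.γ m) f h) ≤
      R * norm1 n h + R ^ 4 * norm1 n h * (2 * R) :=
    (norm1_sub_le _ _ _).trans (add_le_add
      (norm1_mul_le_of_le ((norm1_quad_le _ _ _).1.trans hnR) le_rfl)
      (norm1_mul_le_of_le hxi' (G.norm1_le hnR hA).1))
  refine (norm1_sub_le _ _ _).trans ((add_le_add b h2).trans ?_)
  have h3 : ρ * norm1 n h ≤ 1 * norm1 n h := by gcongr
  have p0 := mul_le_mul_of_nonneg_right (pow_absorb hR 0 6) h0
  have p1 := mul_le_mul_of_nonneg_right (pow_absorb hR 1 5) h0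
  have p5 := mul_le_mul_of_nonneg_right (pow_absorb hR 5 1) h0
  have q1 : 0 ≤ R * norm1 n h := by positivity
  have q5 : 0 ≤ R ^ 5 * norm1 n h := by positivity
  norm_num at p0 p1 p5
  linarith

/-- The residual after `m + j` steps is `X ^ m` times the residual of the second half, plus the
transfer errors multiplied by the polynomials of the second half. In the second component the larger
transfer error, which lacks a factor `norm1 n h`, is multiplied by `ξ`, which supplies it. -/
theorem Accurate.combine_residual (H2 : Accurate (n - m) f' h' out2 κ')
    (G : Good R n f h σ A τ) (G' : Good R (n - m) f' h' σ' A' τ') (hR : 8 ≤ R)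
    (hnR : (n : ℝ) ≤ R) (hA : A ≤ 2) (hτ' : τ' ≤ 1 / 2) (hmn : m < n) (hκ0 : 0 ≤ κ)
    (hκ0' : 0 ≤ κ') (hκ' : κ' ≤ 1) (hw : 0 ≤ w)
    (h1 : norm1 n (act1 (quad out1.γ m) f h - X ^ m * f') ≤ R ^ 7 * (κ + w))
    (h2 : norm1 n (act2 (quad out1.γ m) f h - X ^ m * h') ≤ R ^ 7 * (κ + w) * norm1 n h)
    (hB' : norm1 (n - m) h' ≤ R ^ 6 * norm1 n h) {j : ℕ} (hj : j ≤ n - m) :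
    norm1 (m + j) (act1 (quad out2.γ j) (act1 (quad out1.γ m) f h)
        (act2 (quad out1.γ m) f h)) ≤ R ^ 20 * (κ + κ' + w) ∧
      norm1 (m + j) (act2 (quad out2.γ j) (act1 (quad out1.γ m) f h)
        (act2 (quad out1.γ m) f h)) ≤ R ^ 20 * (κ + κ' + w) * norm1 n h := by
  set g1 := act1 (quad out1.γ m) f h
  set g2 := act2 (quad out1.γ m) f h
  set q := quad out2.γ j with hq
  set B := norm1 n h with hB
  have h0 : 0 ≤ B := norm1_nonneg n h
  have hjn : m + j ≤ n := by omega
  have hjR : ((m + j : ℕ) : ℝ) ≤ R := le_trans (by exact_mod_cast hjn) hnR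
  have hdR : ((n - m : ℕ) : ℝ) ≤ R := le_trans (by exact_mod_cast Nat.sub_le _ _) hnR
  obtain ⟨n1, n2, n3, n4⟩ := norm1_quad_le out2.γ j (m + j)
  rw [← hq] at n1 n2 n3 n4
  have hB2 : B ≤ 2 * R := (G.norm1_le hnR hA).2
  have hxi : norm1 (m + j) q.xi ≤ R ^ 10 * B := by
    refine (H2.xi_le G' hR hdR hτ' hκ' (m + j) j hj).trans ?_
    calc R ^ 4 * norm1 (n - m) h' ≤ R ^ 4 * (R ^ 6 * B) := by gcongr
      _ = _ := by ring
  have r1 := (norm1_mono hjn _).trans h1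
  have r2 := (norm1_mono hjn _).trans h2
  have hs : 0 ≤ κ + w := by positivity
  constructor
  · have e : act1 q g1 g2 = X ^ m * act1 q f' h' +
        (q.ets * (g1 - X ^ m * f') + q.xis * (g2 - X ^ m * h')) := by
      simp only [act1]
      ring
    have b0 := H2.residual1 j hj
    rw [← norm1_X_pow_mul m] at b0
    have b : norm1 (m + j) (act1 q g1 g2) ≤
        κ' + (R * (R ^ 7 * (κ + w)) + R * (R ^ 7 * (κ + w) * B)) := by
      rw [e]
      exact (norm1_add_le _ _ _).trans (add_le_add b0 ((norm1_add_le _ _ _).trans (add_le_add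
        (norm1_mul_le_of_le (n3.trans hjR) r1) (norm1_mul_le_of_le (n4.trans hjR) r2))))
    have hB3 : R * (R ^ 7 * (κ + w) * B) ≤ R * (R ^ 7 * (κ + w) * (2 * R)) := by gcongr
    have p1 := mul_le_mul_of_nonneg_right (pow_absorb hR 8 12) hs
    have p2 := mul_le_mul_of_nonneg_right (pow_absorb hR 9 11) hs
    have p3 := mul_le_mul_of_nonneg_right (pow_absorb hR 0 20) hκ0'
    have q1 : 0 ≤ R ^ 8 * (κ + w) := by positivity
    have q2 : 0 ≤ R ^ 9 * (κ + w) := by positivity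
    norm_num at p1 p2 p3
    linarith
  · have e : act2 q g1 g2 = X ^ m * act2 q f' h' +
        (q.et * (g2 - X ^ m * h') - q.xi * (g1 - X ^ m * f')) := by
      simp only [act2]
      ring
    have b0 := H2.residual2 j hj
    rw [← norm1_X_pow_mul m] at b0
    have b : norm1 (m + j) (act2 q g1 g2) ≤
        κ' * (R ^ 6 * B) + (R * (R ^ 7 * (κ + w) * B) + R ^ 10 * B * (R ^ 7 * (κ + w))) := by
      rw [e]
      exact (norm1_add_le _ _ _).trans (add_le_add (b0.trans (by gcongr))
        ((norm1_sub_le _ _ _).trans (add_le_add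
        (norm1_mul_le_of_le (n1.trans hjR) r2) (norm1_mul_le_of_le hxi r1))))
    have hsB : 0 ≤ (κ + w) * B := by positivity
    have hκB : 0 ≤ κ' * B := by positivity
    have p1 := mul_le_mul_of_nonneg_right (pow_absorb hR 8 12) hsB
    have p2 := mul_le_mul_of_nonneg_right (pow_absorb hR 17 3) hsB
    have p3 := mul_le_mul_of_nonneg_right (pow_absorb hR 6 14) hκB
    have q1 : 0 ≤ R ^ 8 * ((κ + w) * B) := by positivity
    have q2 : 0 ≤ R ^ 17 * ((κ + w) * B) := by positivity
    have q3 : 0 ≤ R ^ 6 * (κ' * B) := by positivity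
    norm_num at p1 p2 p3
    linarith

/-- The products are compared by exchanging one factor at a time. Each product in the formula for
`ξ` has exactly one factor of type `ξ`, hence one factor `norm1 n h`, which keeps the error of `ξ`
relative; for `η` it is enough that `norm1 n h ≤ 2 R`. -/
theorem Accurate.combine_error (H1 : Accurate m f h out1 κ) (H2 : Accurate (n - m) f' h' out2 κ')
    (G : Good R n f h σ A τ) (G' : Good R (n - m) f' h' σ' A' τ') (hR : 8 ≤ R)
    (hnR : (n : ℝ) ≤ R) (hA : A ≤ 2) (hτ : τ ≤ 1 / 2) (hτ' : τ' ≤ 1 / 2) (hm : 0 < m) (hmn : m < n)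
    (hκ0 : 0 ≤ κ) (hκ : κ ≤ 1) (hκ0' : 0 ≤ κ') (hκ' : κ' ≤ 1) (hw : 0 ≤ w)
    (hB' : norm1 (n - m) h' ≤ R ^ 6 * norm1 n h) {P Q : ℕ → ℂ}
    (hP : norm1 n (mk P - (mk (sharp m out1.η) * mk out2.ξ + C 1 * (mk out1.ξ * mk out2.η))) ≤
      w * (2 * R * (R ^ 4 * norm1 (n - m) h') + R ^ 4 * norm1 n h * (2 * R)))
    (hQ : norm1 n (mk Q - (mk out1.η * mk out2.η + C (-1) * (mk (sharp m out1.ξ) * mk out2.ξ))) ≤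
      w * (2 * R * (2 * R) + R ^ 4 * norm1 n h * (R ^ 4 * norm1 (n - m) h'))) :
    norm1 n ((quad out1.γ m).et * (quad out2.γ (n - m)).et -
        (quad out1.γ m).xis * (quad out2.γ (n - m)).xi - mk Q) ≤ R ^ 20 * (κ + κ' + w) ∧
      norm1 n ((quad out1.γ m).ets * (quad out2.γ (n - m)).xi +
        (quad out1.γ m).xi * (quad out2.γ (n - m)).et - mk P) ≤
          R ^ 20 * (κ + κ' + w) * norm1 n h := by
  set q := quad out1.γ m with hq
  set p := quad out2.γ (n - m) with hp
  set B := norm1 n h with hB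
  set B' := norm1 (n - m) h' with hBB'
  have h0 : 0 ≤ B := norm1_nonneg n h
  have hmR : (m : ℝ) ≤ R := le_trans (by exact_mod_cast hmn.le) hnR
  have hdR : ((n - m : ℕ) : ℝ) ≤ R := le_trans (by exact_mod_cast Nat.sub_le _ _) hnR
  have hB2 : B ≤ 2 * R := (G.norm1_le hnR hA).2
  have hBm : norm1 m h ≤ B := norm1_mono hmn.le h
  obtain ⟨n1, n2, n3, n4⟩ := norm1_quad_le out1.γ m n
  rw [← hq] at n1 n2 n3 n4
  obtain ⟨s1, s2⟩ := H1.sharp_error hm n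
  obtain ⟨e1, e2⟩ := H1.error hm n
  obtain ⟨d1, d2⟩ := H2.error (by omega) n
  obtain ⟨o1, o2, o3, o4⟩ := H1.norm1_output_le (G.mono hmn.le) hR hmR hτ hκ n
  obtain ⟨l1, l2, -, -⟩ := H2.norm1_output_le G' hR hdR hτ' hκ' n
  have hκB : κ * norm1 m h ≤ κ * B := by gcongr
  have x1 : norm1 n q.xi ≤ R ^ 4 * B :=
    (H1.xi_le (G.mono hmn.le) hR hmR hτ hκ n m le_rfl).trans (by gcongr)
  have x2 : norm1 n q.xis ≤ R ^ 4 * B :=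
    (norm1_xis_le _ _ _).trans ((H1.xi_le (G.mono hmn.le) hR hmR hτ hκ m m le_rfl).trans
      (by gcongr))
  have hR4 : R ^ 4 * B' ≤ R ^ 10 * B := by
    calc R ^ 4 * B' ≤ R ^ 4 * (R ^ 6 * B) := by gcongr
      _ = _ := by ring
  have l2' : norm1 n (mk out2.ξ) ≤ R ^ 10 * B := l2.trans hR4
  have d2' : norm1 n (p.xi - mk out2.ξ) ≤ κ' * (R ^ 6 * B) := d2.trans (by gcongr)
  constructor
  · have e : q.et * p.et - q.xis * p.xi - mk Q = (q.et - mk out1.η) * mk out2.η +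
        q.et * (p.et - mk out2.η) - (q.xis - mk (sharp m out1.ξ)) * mk out2.ξ -
        q.xis * (p.xi - mk out2.ξ) -
        (mk Q - (mk out1.η * mk out2.η + C (-1) * (mk (sharp m out1.ξ) * mk out2.ξ))) := by
      rw [map_neg, map_one]
      ring
    have b : norm1 n (q.et * p.et - q.xis * p.xi - mk Q) ≤ κ * (2 * R) + R * κ' +
        κ * B * (R ^ 10 * B) + R ^ 4 * B * (κ' * (R ^ 6 * B)) +
        w * (2 * R * (2 * R) + R ^ 4 * B * (R ^ 10 * B)) := by
      rw [e]
      refine (norm1_sub_le _ _ _).trans (add_le_add ((norm1_sub_le _ _ _).trans (add_le_add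
        ((norm1_sub_le _ _ _).trans (add_le_add ((norm1_add_le _ _ _).trans (add_le_add
          (norm1_mul_le_of_le e1 l1) (norm1_mul_le_of_le (n1.trans hnR) d1)))
          (norm1_mul_le_of_le (s2.trans hκB) l2')))
          (norm1_mul_le_of_le x2 d2'))) (hQ.trans (by gcongr)))
    have hBB : B * B ≤ 4 * R ^ 2 := by nlinarith
    have c1 : κ * R ^ 10 * (B * B) ≤ κ * R ^ 10 * (4 * R ^ 2) := by gcongr
    have c2 : κ' * R ^ 10 * (B * B) ≤ κ' * R ^ 10 * (4 * R ^ 2) := by gcongr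
    have c3 : w * R ^ 14 * (B * B) ≤ w * R ^ 14 * (4 * R ^ 2) := by gcongr
    have p1 := mul_le_mul_of_nonneg_right (pow_absorb hR 1 19) hκ0
    have p2 := mul_le_mul_of_nonneg_right (pow_absorb hR 12 8) hκ0
    have p3 := mul_le_mul_of_nonneg_right (pow_absorb hR 1 19) hκ0'
    have p4 := mul_le_mul_of_nonneg_right (pow_absorb hR 12 8) hκ0'
    have p5 := mul_le_mul_of_nonneg_right (pow_absorb hR 2 18) hw
    have p6 := mul_le_mul_of_nonneg_right (pow_absorb hR 16 4) hw
    have q1 : 0 ≤ R * κ := by positivity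
    have q2 : 0 ≤ R ^ 12 * κ := by positivity
    have q3 : 0 ≤ R * κ' := by positivity
    have q4 : 0 ≤ R ^ 12 * κ' := by positivity
    have q5 : 0 ≤ R ^ 2 * w := by positivity
    have q6 : 0 ≤ R ^ 16 * w := by positivity
    norm_num at p1 p2 p3 p4 p5 p6
    linarith
  · have e : q.ets * p.xi + q.xi * p.et - mk P = (q.ets - mk (sharp m out1.η)) * mk out2.ξ +
        q.ets * (p.xi - mk out2.ξ) + (q.xi - mk out1.ξ) * mk out2.η +
        q.xi * (p.et - mk out2.η) -
        (mk P - (mk (sharp m out1.η) * mk out2.ξ + C 1 * (mk out1.ξ * mk out2.η))) := by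
      rw [map_one]
      ring
    have b : norm1 n (q.ets * p.xi + q.xi * p.et - mk P) ≤ κ * (R ^ 10 * B) +
        R * (κ' * (R ^ 6 * B)) + κ * B * (2 * R) + R ^ 4 * B * κ' +
        w * (2 * R * (R ^ 10 * B) + R ^ 4 * B * (2 * R)) := by
      rw [e]
      refine (norm1_sub_le _ _ _).trans (add_le_add ((norm1_add_le _ _ _).trans (add_le_add
        ((norm1_add_le _ _ _).trans (add_le_add ((norm1_add_le _ _ _).trans (add_le_add
          (norm1_mul_le_of_le s1 l2') (norm1_mul_le_of_le (n3.trans hnR) d2')))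
          (norm1_mul_le_of_le (e2.trans hκB) l1)))
          (norm1_mul_le_of_le x1 d1))) (hP.trans (by gcongr)))
    have hκB0 : 0 ≤ κ * B := by positivity
    have hκB0' : 0 ≤ κ' * B := by positivity
    have hwB0 : 0 ≤ w * B := by positivity
    have p1 := mul_le_mul_of_nonneg_right (pow_absorb hR 10 10) hκB0
    have p2 := mul_le_mul_of_nonneg_right (pow_absorb hR 1 19) hκB0
    have p3 := mul_le_mul_of_nonneg_right (pow_absorb hR 7 13) hκB0'
    have p4 := mul_le_mul_of_nonneg_right (pow_absorb hR 4 16) hκB0'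
    have p5 := mul_le_mul_of_nonneg_right (pow_absorb hR 11 9) hwB0
    have p6 := mul_le_mul_of_nonneg_right (pow_absorb hR 5 15) hwB0
    have q1 : 0 ≤ R ^ 10 * (κ * B) := by positivity
    have q2 : 0 ≤ R * (κ * B) := by positivity
    have q3 : 0 ≤ R ^ 7 * (κ' * B) := by positivity
    have q4 : 0 ≤ R ^ 4 * (κ' * B) := by positivity
    have q5 : 0 ≤ R ^ 11 * (w * B) := by positivity
    have q6 : 0 ≤ R ^ 5 * (w * B) := by positivity
    norm_num at p1 p2 p3 p4 p5 p6
    linarith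

end combine

/-! ### The join, the base case and the induction on the depth of the recursion. -/

section induction

open PowerSeries

/-- The join of two outputs is accurate. -/
theorem Accurate.combine {R : ℝ} {n m : ℕ} {f h f' h' : ℂ⟦X⟧} {σ A τ σ' A' τ' κ κ' w : ℝ}
    {out1 out2 : Output} (H1 : Accurate m f h out1 κ) (H2 : Accurate (n - m) f' h' out2 κ')
    (G : Good R n f h σ A τ) (G' : Good R (n - m) f' h' σ' A' τ') (hR : 8 ≤ R)
    (hnR : (n : ℝ) ≤ R) (hA : A ≤ 2) (hτ : τ ≤ 1 / 2) (hτ' : τ' ≤ 1 / 2) (hm : 0 < m) (hmn : m < n)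
    (hκ0 : 0 ≤ κ) (hκ : κ ≤ 1) (hκ0' : 0 ≤ κ') (hκ' : κ' ≤ 1) (hw : 0 ≤ w)
    (hρ : R ^ 7 * (κ + w) ≤ 1)
    (h1 : norm1 n (act1 (quad out1.γ m) f h - X ^ m * f') ≤ R ^ 7 * (κ + w))
    (h2 : norm1 n (act2 (quad out1.γ m) f h - X ^ m * h') ≤ R ^ 7 * (κ + w) * norm1 n h)
    {P Q : ℕ → ℂ}
    (hP : norm1 n (mk P - (mk (sharp m out1.η) * mk out2.ξ + C 1 * (mk out1.ξ * mk out2.η))) ≤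
      w * (2 * R * (R ^ 4 * norm1 (n - m) h') + R ^ 4 * norm1 n h * (2 * R)))
    (hQ : norm1 n (mk Q - (mk out1.η * mk out2.η + C (-1) * (mk (sharp m out1.ξ) * mk out2.ξ))) ≤
      w * (2 * R * (2 * R) + R ^ 4 * norm1 n h * (R ^ 4 * norm1 (n - m) h'))) :
    Accurate n f h ⟨fun i => if i < m then out1.γ i else out2.γ (i - m), take n P, take n Q⟩
      (R ^ 20 * (κ + κ' + w)) := by
  have hB' := H1.norm1_down_le G hR hnR hA hτ hmn hκ hρ h2
  obtain ⟨e1, e2⟩ := H1.combine_error H2 G G' hR hnR hA hτ hτ' hm hmn hκ0 hκ hκ0' hκ' hw hB' hP hQ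
  set γ : ℕ → ℂ := fun i => if i < m then out1.γ i else out2.γ (i - m) with hγ
  have q1 : ∀ k ≤ m, quad γ k = quad out1.γ k := fun k hk => quad_congr fun i hi => by
    rw [hγ]
    exact if_pos (by omega)
  have q2 : ∀ j, quad (fun i => γ (m + i)) j = quad out2.γ j := fun j => quad_congr fun i hi => by
    simp [hγ]
  have hq := quad_add γ m (n - m)
  rw [show m + (n - m) = n by omega, q2, q1 m le_rfl] at hq
  have htake : ∀ (g : ℂ⟦X⟧) (v : ℕ → ℂ), norm1 n (g - mk (take n v)) = norm1 n (g - mk v) :=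
    fun g v => norm1_congr fun i hi => by
      rw [map_sub, map_sub, coeff_mk, coeff_mk, take, if_pos hi]
  have hκκ : κ ≤ R ^ 20 * (κ + κ' + w) := by
    calc κ ≤ 1 * (κ + κ' + w) := by linarith
      _ ≤ _ := by
          gcongr
          exact one_le_pow₀ (by linarith)
  have hBm : norm1 m h ≤ norm1 n h := norm1_mono hmn.le h
  have h0 := norm1_nonneg n h
  -- Initial segments of length at most `m` belong to the first half alone; longer ones are handled
  -- by the composition law `act_add`.
  have hres : ∀ k ≤ n, norm1 k (act1 (quad γ k) f h) ≤ R ^ 20 * (κ + κ' + w) ∧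
      norm1 k (act2 (quad γ k) f h) ≤ R ^ 20 * (κ + κ' + w) * norm1 n h := by
    intro k hk
    rcases le_total k m with hkm | hkm
    · rw [q1 k hkm]
      exact ⟨(H1.residual1 k hkm).trans hκκ, (H1.residual2 k hkm).trans
        (mul_le_mul hκκ hBm (norm1_nonneg _ _) (hκ0.trans hκκ))⟩
    · obtain ⟨j, rfl⟩ := Nat.exists_eq_add_of_le hkm
      rw [(act_add γ m j f h).1, (act_add γ m j f h).2, q2, q1 m le_rfl]
      exact H2.combine_residual G G' hR hnR hA hτ' hmn hκ0 hκ0' hκ' hw h1 h2 hB' (by omega)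
  refine Accurate.intro (fun i hi => if_neg (by omega)) (fun i hi => if_neg (by omega)) ?_ ?_
    (fun k hk => (hres k hk).1) (fun k hk => (hres k hk).2)
  · rw [htake, hq.1]
    exact e1
  · rw [htake, hq.2.1]
    exact e2

theorem ens_invNLFFT_base {R u : ℝ} (hR : 8 ≤ R) (hu : 0 ≤ u) (hu1 : u ≤ 1 / 1000)
    {a b : ℕ → ℂ} (ha : 1 / R ≤ ‖a 0‖) :
    Ensures (invNLFFT 1 a b) u fun out => Accurate 1 (mk a) (mk b) out (R ^ 18 * u) := by
  have hR0 : 0 < R := by linarith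
  have ha0 : 0 < ‖a 0‖ := lt_of_lt_of_le (by positivity) ha
  refine (ens_invNLFFT_one hu hu1 le_rfl (norm_pos_iff.1 ha0)).mono ?_
  rintro ⟨γ, ξ, η⟩ ⟨⟨x, e, rfl, rfl, hx, he⟩, hg⟩
  dsimp only at hx he hg
  have hn1 : ∀ g : ℂ⟦X⟧, norm1 1 g = ‖coeff 0 g‖ := fun g => by simp [norm1]
  have hb : ‖b 0 / a 0‖ ≤ R * ‖b 0‖ := by
    rw [norm_div, div_le_iff₀ ha0]
    have : 1 ≤ R * ‖a 0‖ := by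
      rw [div_le_iff₀ hR0] at ha
      linarith
    nlinarith [norm_nonneg (b 0)]
  have hγ : ‖γ 0‖ ≤ 2 * R * ‖b 0‖ := by
    calc ‖γ 0‖ = ‖(γ 0 - b 0 / a 0) + b 0 / a 0‖ := by ring_nf
      _ ≤ 12 * u * ‖b 0 / a 0‖ + ‖b 0 / a 0‖ := (norm_add_le _ _).trans (add_le_add hg le_rfl)
      _ ≤ 2 * ‖b 0 / a 0‖ := by nlinarith [norm_nonneg (b 0 / a 0)]
      _ ≤ _ := by linarith
  have hRu : R * 8 ^ 17 * u ≤ R ^ 18 * u := by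
    have := pow_absorb hR 1 17
    rw [pow_one] at this
    gcongr
  have hRu0 : 8 * u ≤ R * u := by gcongr
  have hb0 := norm_nonneg (b 0)
  have hRub : 0 ≤ R * u * ‖b 0‖ := by positivity
  norm_num at hRu
  refine Accurate.intro (fun i hi => Pi.single_eq_of_ne (by omega) _)
    (fun i hi => Pi.single_eq_of_ne (by omega) _) ?_ ?_ ?_ ?_
  · rw [hn1, map_sub, norm_sub_rev]
    simp only [quad, coeff_mk, Pi.single_eq_same, mul_zero, sub_zero, mul_one, coeff_zero_C]
    refine he.trans ?_
    nlinarith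
  · rw [hn1, hn1, map_sub, norm_sub_rev]
    simp only [quad, coeff_mk, Pi.single_eq_same, coeff_C_mul, zero_add, mul_one, coeff_zero_C]
    refine hx.trans ?_
    have h1 : 10 * u * ‖γ 0‖ ≤ 10 * u * (2 * R * ‖b 0‖) := by gcongr
    have h2 := mul_le_mul_of_nonneg_right hRu hb0
    linarith
  · intro k hk
    interval_cases k
    · simp only [norm1, Finset.range_zero, Finset.sum_empty]
      positivity
    -- After one step the first residual is exactly zero, because `η♯` and `ξ♯` carry a factor `X`.
    · rw [hn1]
      simp only [quad, act1, map_add]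
      simp only [coeff_zero_eq_constantCoeff, map_mul, constantCoeff_X]
      simp only [zero_mul, mul_zero, add_zero, norm_zero]
      positivity
  · intro k hk
    interval_cases k
    · simp only [norm1, Finset.range_zero, Finset.sum_empty]
      have := norm1_nonneg 1 (mk b)
      positivity
    · rw [hn1, hn1]
      -- The residual is `a 0` times the error of the quotient, so the relative error `12 u` of `γ
      -- 0` becomes `12 u ‖b 0‖`, with no loss from a small `a 0`.
      have e : coeff 0 (act2 (quad γ 1) (mk a) (mk b)) =
          -(sc (γ 0) * a 0 * (γ 0 - b 0 / a 0)) := by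
        have : a 0 ≠ 0 := norm_pos_iff.1 ha0
        simp only [quad, act2, map_sub, mul_zero, sub_zero, zero_add, mul_one]
        simp only [coeff_zero_eq_constantCoeff, map_mul, constantCoeff_C]
        rw [← coeff_zero_eq_constantCoeff_apply, ← coeff_zero_eq_constantCoeff_apply, coeff_mk,
          coeff_mk]
        field_simp
        ring
      rw [e, norm_neg, norm_mul, norm_mul, coeff_mk]
      calc ‖sc (γ 0)‖ * ‖a 0‖ * ‖γ 0 - b 0 / a 0‖ ≤ 1 * ‖a 0‖ * (12 * u * ‖b 0 / a 0‖) := by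
            gcongr
            exact norm_sc_le_one _
        _ = 12 * u * ‖b 0‖ := by
            rw [norm_div]
            field_simp
        _ ≤ _ := by
            have h2 := mul_le_mul_of_nonneg_right hRu hb0
            have h3 := mul_le_mul_of_nonneg_right hRu0 hb0
            linarith

set_option maxHeartbeats 1000000 in
/-- The forward and residual errors of the algorithm. -/
theorem ens_invNLFFT {R u δ : ℝ} (hR : 8 ≤ R) (hu : 0 ≤ u) (hu1 : u ≤ 1 / 1000) {D : ℕ}
    (hδ : R ^ (21 * D + 31) * u ≤ δ) (hδ1 : δ ≤ 1) (d : ℕ) : d ≤ D → ∀ n : ℕ, 1 ≤ n → n ≤ 2 ^ d →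
      4 * (n : ℝ) ≤ R → ∀ (a b : ℕ → ℂ) (σ A τ : ℝ), Good R n (mk a) (mk b) σ A τ →
        1 / R + d * δ ≤ σ → A + d * δ ≤ 2 → τ + d * δ ≤ 1 / 2 →
          Ensures (invNLFFT n a b) u fun out =>
            Accurate n (mk a) (mk b) out (R ^ (21 * d + 18) * u) := by
  have hR0 : 0 < R := by linarith
  have hδ0 : 0 ≤ δ := le_trans (by positivity) hδ
  have base : ∀ n : ℕ, 1 ≤ n → n ≤ 1 → ∀ (d : ℕ) (a b : ℕ → ℂ) (σ A τ : ℝ),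
      Good R n (mk a) (mk b) σ A τ → 1 / R + d * δ ≤ σ → Ensures (invNLFFT n a b) u fun out =>
        Accurate n (mk a) (mk b) out (R ^ 18 * u) := by
    intro n h1 h2 d a b σ A τ G hσ
    obtain rfl : n = 1 := by omega
    refine ens_invNLFFT_base hR hu hu1 ?_
    have := G.lower
    rw [coeff_mk] at this
    have : 0 ≤ d * δ := by positivity
    linarith
  have widen : ∀ {n : ℕ} {f h : ℂ⟦X⟧} {out : Output} {κ κ' : ℝ}, κ ≤ κ' →
      Accurate n f h out κ → Accurate n f h out κ' := by
    intro n f h out κ κ' hκ H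
    have h0 := norm1_nonneg n h
    exact Accurate.intro H.eta_support H.xi_support (H.eta_error.trans hκ)
      (H.xi_error.trans (by gcongr)) (fun k hk => (H.residual1 k hk).trans hκ)
      (fun k hk => (H.residual2 k hk).trans (by gcongr))
  induction d with
  | zero =>
    intro _ n h1 h2 hnR a b σ A τ G hσ hA hτ
    exact base n h1 (by simpa using h2) 0 a b σ A τ G hσ
  | succ d ih =>
    intro hdD n h1 h2 hnR a b σ A τ G hσ hA hτ
    by_cases hn1 : n ≤ 1
    · refine (base n h1 hn1 _ a b σ A τ G hσ).mono fun out => widen ?_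
      gcongr
      · linarith
      · omega
    have ih := ih (by omega)
    rw [pow_succ] at h2
    rw [invNLFFT, dif_neg hn1]
    set m := (n + 1) / 2 with hm
    have hm0 : 0 < m := by omega
    have hmn : m < n := by omega
    set κ := R ^ (21 * d + 18) * u with hκ
    set w := R ^ 18 * u with hw
    have hw0 : 0 ≤ w := by positivity
    have hwκ : w ≤ κ := by
      rw [hw, hκ]
      gcongr
      · linarith
      · omega
    have hκ0 : 0 ≤ κ := hw0.trans hwκ
    -- `Good.down` worsens the conditioning by `R ^ 5 * (R ^ 7 * (κ + w)) ≤ R ^ 13 * κ`. The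
    -- exponent `31 = 18 + 13` in the hypothesis on `δ` makes this at most `δ`, so the budget `d *
    -- δ` lasts for `d` levels.
    have hκδ : R ^ 13 * κ ≤ δ := by
      refine le_trans ?_ hδ
      rw [hκ, show R ^ 13 * (R ^ (21 * d + 18) * u) = R ^ (21 * d + 31) * u by ring]
      gcongr
      · linarith
      · omega
    have hκ1 : κ ≤ 1 := by
      refine le_trans (le_mul_of_one_le_left hκ0 (one_le_pow₀ ?_)) (hκδ.trans hδ1)
      linarith
    have hρδ : R ^ 5 * (R ^ 7 * (κ + w)) ≤ δ := by
      calc R ^ 5 * (R ^ 7 * (κ + w)) ≤ R ^ 5 * (R ^ 7 * (R * κ)) := by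
            gcongr
            nlinarith
        _ = R ^ 13 * κ := by ring
        _ ≤ δ := hκδ
    have hρ1 : R ^ 7 * (κ + w) ≤ 1 := by
      refine le_trans (le_mul_of_one_le_left (by positivity) (one_le_pow₀ (n := 5) ?_))
        (hρδ.trans hδ1)
      linarith
    push_cast at hσ hA hτ
    have hdδ : 0 ≤ d * δ := by positivity
    have hA2 : A ≤ 2 := by linarith
    have hτ2 : τ ≤ 1 / 2 := by linarith
    have hnR' : (n : ℝ) ≤ R := by linarith [(Nat.cast_nonneg n : (0 : ℝ) ≤ n)]
    have hmR : 4 * (m : ℝ) ≤ R := le_trans (by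
      have : (m : ℝ) ≤ n := by exact_mod_cast hmn.le
      linarith) hnR
    have hmR' : (m : ℝ) ≤ R := by linarith [(Nat.cast_nonneg m : (0 : ℝ) ≤ m)]
    have hdR : 4 * ((n - m : ℕ) : ℝ) ≤ R := le_trans (by
      have : ((n - m : ℕ) : ℝ) ≤ n := by exact_mod_cast Nat.sub_le _ _
      linarith) hnR
    have hdR' : ((n - m : ℕ) : ℝ) ≤ R := by linarith [(Nat.cast_nonneg (n - m) : (0 : ℝ) ≤ _)]
    have hu1' : u ≤ 1 := by linarith
    have hadd : ∀ x y, Ensures (cadd x y) u fun r => ‖r - (x + 1 * y)‖ ≤ u * ‖x + 1 * y‖ :=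
      fun x y => by simpa using ens_cadd hu x y
    have hsub : ∀ x y, Ensures (csub x y) u fun r => ‖r - (x + -1 * y)‖ ≤ u * ‖x + -1 * y‖ :=
      fun x y => by simpa [← sub_eq_add_neg] using ens_csub hu x y
    have hsupp : ∀ {N k l : ℕ} {p q : ℕ → ℂ}, (∀ j, k ≤ j → p j = 0) → (∀ j, l ≤ j → q j = 0) →
        k + l ≤ N + 1 → ∀ i j, N ≤ i + j → p i * q j = 0 := by
      intro N k l p q hp hq hN i j hij
      by_cases hi : k ≤ i
      · rw [hp i hi, zero_mul]
      · rw [hq j (by omega), mul_zero]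
    have hsharp : ∀ (p : ℕ → ℂ) j, m + 1 ≤ j → sharp m p j = 0 := fun p j hj => if_neg (by omega)
    have htake : ∀ (p : ℕ → ℂ) j, n ≤ j → take n p j = 0 := fun p j hj => if_neg (by omega)
    have ht : n + m ≤ 2 ^ Nat.clog 2 (n + m) := Nat.le_pow_clog one_lt_two _
    have ht' : n ≤ 2 ^ Nat.clog 2 n := Nat.le_pow_clog one_lt_two _
    -- The length is at most `2 (n + m) ≤ 4 n`; this is why `4 n ≤ R` is assumed.
    have htR : (2 : ℝ) ^ Nat.clog 2 (n + m) ≤ R := by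
      refine le_trans ?_ hnR
      have := two_pow_clog_le (n := n + m) (by omega)
      exact_mod_cast this.trans (by omega)
    have htR' : (2 : ℝ) ^ Nat.clog 2 n ≤ R := by
      refine le_trans ?_ hnR
      have := two_pow_clog_le (n := n) (by omega)
      exact_mod_cast this.trans (by omega)
    obtain ⟨nf, nh⟩ := G.norm1_le hnR' hA2
    have Gm := G.mono hmn.le
    have hBm : norm1 m (mk b) ≤ norm1 n (mk b) := norm1_mono hmn.le _
    refine (ih m hm0 (by omega) hmR a b σ A τ Gm (by linarith) (by linarith)
      (by linarith)).bind fun up H1 => ?_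
    obtain ⟨o1, o2, o3, o4⟩ := H1.norm1_output_le Gm hR hmR' hτ2 hκ1 (2 ^ Nat.clog 2 (n + m))
    obtain ⟨l1, l2, l3, l4⟩ := H1.norm1_output_le Gm hR hmR' hτ2 hκ1 (2 ^ Nat.clog 2 n)
    have hRB : R ^ 4 * norm1 m (mk b) ≤ R ^ 4 * norm1 n (mk b) := by gcongr
    refine (ens_conv2_norm1 (n := n) hu hu1' hR htR (by omega) (by simp) (by simp) hadd
      (hsupp (hsharp _) (htake _) (by omega)) (hsupp (hsharp _) (htake _) (by omega))
      o3 ((norm1_take_le _ _ _).trans nf) (o4.trans hRB) (norm1_take_le _ _ _)).bind fun P hP => ?_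
    refine (ens_conv2_norm1 (n := n) hu hu1' hR htR (by omega) (by simp) (by simp) hsub
      (hsupp H1.eta_support (htake _) (by omega)) (hsupp H1.xi_support (htake _) (by omega))
      o1 (norm1_take_le _ _ _) (o2.trans hRB) ((norm1_take_le _ _ _).trans nf)).bind fun Q hQ => ?_
    obtain ⟨r1, r2⟩ := H1.down_error G hR hnR' hA2 hm0 hmn hκ0 hw0 rfl rfl hP hQ
    have G' := G.down hR hnR' hA2 up.γ hmn (by positivity) (hρδ.trans hδ1) r1 r2
    refine (ih (n - m) (by omega) (by omega) hdR _ _ _ _ _ G' (by linarith) (by linarith)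
      (by linarith)).bind fun down H2 => ?_
    have hτ' : τ + R ^ 5 * (R ^ 7 * (κ + w)) ≤ 1 / 2 := by linarith
    obtain ⟨k1, k2, -, -⟩ := H2.norm1_output_le G' hR hdR' hτ' hκ1 (2 ^ Nat.clog 2 n)
    refine (ens_conv2_norm1 (n := n) hu hu1' hR htR' ht' (by simp) (by simp) hadd
      (hsupp (hsharp _) H2.xi_support (by omega))
      (hsupp H1.xi_support H2.eta_support (by omega)) l3 k2 (l2.trans hRB) k1).bind fun X hX => ?_
    refine (ens_conv2_norm1 (n := n) hu hu1' hR htR' ht' (by simp) (by simp) hsub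
      (hsupp H1.eta_support H2.eta_support (by omega))
      (hsupp (hsharp _) H2.xi_support (by omega)) l1 k1 (l4.trans hRB) k2).bind fun Y hY => ?_
    have HF := H1.combine H2 G G' hR hnR' hA2 hτ2 hτ' hm0 hmn hκ0 hκ1 hκ0 hκ1 hw0 hρ1 r1 r2 hX hY
    refine Ensures.pure (widen ?_ HF)
    -- One level costs `R ^ 21`, which is the slope 21 of the exponent `21 * d + 18`.
    calc R ^ 20 * (κ + κ + w) ≤ R ^ 20 * (R * κ) := by
          gcongr
          nlinarith
      _ = _ := by
          rw [hκ]
          ring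

end induction

/-! ### Exact layer stripping -/

section strip

open PowerSeries

/-- The exact inverse nonlinear Fourier transform. -/
def stripSeq (a b : ℕ → ℂ) (k : ℕ) : ℂ := (strip a b k).2 0 / (strip a b k).1 0

variable {a b : ℕ → ℂ}

theorem sc_eq_inv (g : ℂ) : sc g = ((Real.sqrt (1 + ‖g‖ ^ 2) : ℝ) : ℂ)⁻¹ := by
  rw [sc, Complex.ofReal_inv]

theorem strip_succ_fst (k j : ℕ) : (strip a b (k + 1)).1 j = sc (stripSeq a b k) *
    ((strip a b k).1 j + conj (stripSeq a b k) * (strip a b k).2 j) := by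
  rw [sc_eq_inv, inv_mul_eq_div]
  rfl

theorem strip_succ_snd (k j : ℕ) : (strip a b (k + 1)).2 j = sc (stripSeq a b k) *
    ((strip a b k).2 (j + 1) - stripSeq a b k * (strip a b k).1 (j + 1)) := by
  rw [sc_eq_inv, inv_mul_eq_div]
  rfl

/-- A step multiplies the constant coefficient of the first component by `sqrt (1 + |γ_k|²)`, so
layer stripping never breaks down. -/
theorem strip_fst_zero_ne (ha : a 0 ≠ 0) (k : ℕ) : (strip a b k).1 0 ≠ 0 ∧
    (strip a b k).1 0 = sc (stripSeq a b k) * (strip a b (k + 1)).1 0 := by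
  have key : ∀ k, (strip a b k).1 0 ≠ 0 →
      (strip a b k).1 0 = sc (stripSeq a b k) * (strip a b (k + 1)).1 0 := by
    intro k hk
    have h := sc_mul_sc (stripSeq a b k)
    have h2 : (strip a b k).2 0 = stripSeq a b k * (strip a b k).1 0 := by
      rw [stripSeq, div_mul_cancel₀ _ hk]
    rw [strip_succ_fst, h2]
    linear_combination -(strip a b k).1 0 * h
  have ne : ∀ k, (strip a b k).1 0 ≠ 0 := by
    intro k
    induction k with
    | zero => exact ha
    | succ k ih =>
      intro h
      have := key k ih
      rw [h, mul_zero] at this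
      exact ih this
  exact ⟨ne k, key k (ne k)⟩

theorem strip_snd_zero (ha : a 0 ≠ 0) (k : ℕ) :
    (strip a b k).2 0 = stripSeq a b k * (strip a b k).1 0 := by
  rw [stripSeq, div_mul_cancel₀ _ (strip_fst_zero_ne ha k).1]

/-- Exact layer stripping is the action of the exact polynomials. -/
theorem act_stripSeq (ha : a 0 ≠ 0) (k : ℕ) :
    act1 (quad (stripSeq a b) k) (mk a) (mk b) = X ^ k * mk (strip a b k).1 ∧
      act2 (quad (stripSeq a b) k) (mk a) (mk b) = X ^ k * mk (strip a b k).2 := by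
  induction k with
  | zero => simp [quad, act1, act2, strip]
  | succ k ih =>
    rw [(act_succ _ _ _ _).1, (act_succ _ _ _ _).2, ih.1, ih.2]
    have e1 : (mk (strip a b (k + 1)).1 : ℂ⟦X⟧) = C (sc (stripSeq a b k)) *
        (mk (strip a b k).1 + C (conj (stripSeq a b k)) * mk (strip a b k).2) := by
      ext j
      simp only [coeff_mk, coeff_C_mul, map_add, strip_succ_fst]
    have e2 : X * (mk (strip a b (k + 1)).2 : ℂ⟦X⟧) = C (sc (stripSeq a b k)) *
        (mk (strip a b k).2 - C (stripSeq a b k) * mk (strip a b k).1) := by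
      ext j
      cases j with
      | zero =>
        rw [coeff_zero_X_mul, coeff_C_mul, map_sub, coeff_C_mul, coeff_mk, coeff_mk,
          strip_snd_zero ha, sub_self, mul_zero]
      | succ j =>
        simp only [coeff_succ_X_mul, coeff_mk, coeff_C_mul, map_sub, strip_succ_snd]
    constructor
    · rw [e1]
      ring
    · rw [pow_succ, mul_assoc, e2]
      ring

theorem norm1_act_stripSeq (ha : a 0 ≠ 0) (k : ℕ) :
    norm1 k (act1 (quad (stripSeq a b) k) (mk a) (mk b)) = 0 ∧
      norm1 k (act2 (quad (stripSeq a b) k) (mk a) (mk b)) = 0 := by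
  rw [(act_stripSeq ha k).1, (act_stripSeq ha k).2]
  exact ⟨norm1_X_pow_mul k 0 _, norm1_X_pow_mul k 0 _⟩

/-- One step reads `b_k / a_k(0) = γ_k a_{k+1} / a_{k+1}(0) + X b_{k+1} / a_{k+1}(0)`. Iteration
gives the triangular system with matrix `matL`. -/
theorem series_eq_sum_strip (ha : a 0 ≠ 0) (n : ℕ) : C (a 0)⁻¹ * (mk b : ℂ⟦X⟧) =
    ∑ k ∈ Finset.range n, X ^ k * (C (stripSeq a b k / (strip a b (k + 1)).1 0) *
        mk (strip a b (k + 1)).1) +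
      X ^ n * (C ((strip a b n).1 0)⁻¹ * mk (strip a b n).2) := by
  induction n with
  | zero => simp [strip]
  | succ n ih =>
    have h0 := strip_fst_zero_ne (b := b) ha n
    have h1 := (strip_fst_zero_ne (b := b) ha (n + 1)).1
    have hs := sc_mul_sc (stripSeq a b n)
    have hc : ((strip a b n).1 0)⁻¹ =
        sc (stripSeq a b n) * (1 + stripSeq a b n * conj (stripSeq a b n)) *
          ((strip a b (n + 1)).1 0)⁻¹ := by
      rw [h0.2]
      have := sc_ne_zero (stripSeq a b n)
      field_simp
      linear_combination -hs
    have step : C ((strip a b n).1 0)⁻¹ * (mk (strip a b n).2 : ℂ⟦X⟧) =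
        C (stripSeq a b n / (strip a b (n + 1)).1 0) * mk (strip a b (n + 1)).1 +
          X * (C ((strip a b (n + 1)).1 0)⁻¹ * mk (strip a b (n + 1)).2) := by
      ext j
      cases j with
      | zero =>
        rw [map_add, coeff_zero_X_mul, coeff_C_mul, coeff_C_mul, coeff_mk, coeff_mk,
          strip_snd_zero ha, div_mul_cancel₀ _ h1, add_zero]
        have := h0.1
        field_simp
      | succ j =>
        rw [map_add, coeff_succ_X_mul, coeff_C_mul, coeff_C_mul, coeff_C_mul, coeff_mk, coeff_mk,
          coeff_mk, strip_succ_snd, strip_succ_fst _ (j + 1), hc]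
        ring
    rw [ih, Finset.sum_range_succ, step, pow_succ]
    ring

theorem coeff_eq_sum_strip (ha : a 0 ≠ 0) {n i : ℕ} (hi : i < n) : (a 0)⁻¹ * b i =
    ∑ k ∈ Finset.range n, (if k ≤ i then
      (strip a b (k + 1)).1 (i - k) / (strip a b (k + 1)).1 0 else 0) * stripSeq a b k := by
  have h := congrArg (coeff i) (series_eq_sum_strip (b := b) ha n)
  rw [coeff_C_mul, coeff_mk, map_add, map_sum, coeff_X_pow_mul', if_neg (by omega), add_zero] at h
  rw [h]
  refine Finset.sum_congr rfl fun k _ => ?_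
  rw [coeff_X_pow_mul']
  split_ifs
  · rw [coeff_C_mul, coeff_mk]
    ring
  · rw [zero_mul]

theorem matL_mulVec (ha : a 0 ≠ 0) (n : ℕ) :
    matL n a b *ᵥ (fun k : Fin n => stripSeq a b k) = (a 0)⁻¹ • fun k : Fin n => b k := by
  ext i
  rw [Pi.smul_apply, smul_eq_mul, coeff_eq_sum_strip ha i.2, ← Fin.sum_univ_eq_sum_range
    (fun k => (if k ≤ (i : ℕ) then (strip a b (k + 1)).1 (i - k) / (strip a b (k + 1)).1 0 else 0) *
      stripSeq a b k)]
  rfl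

end strip

/-! ### Conditioning of the inverse transform -/

section conditioning

open PowerSeries

theorem coeff_mul_eq_sum_range (n : ℕ) (f g : ℂ⟦X⟧) :
    coeff n (f * g) = ∑ k ∈ Finset.range (n + 1), coeff k f * coeff (n - k) g := by
  rw [coeff_mul]
  exact Finset.Nat.sum_antidiagonal_eq_sum_range_succ_mk (fun p => coeff p.1 f * coeff p.2 g) n

/-- If `f` is small modulo `X ^ n`, only its coefficient of degree `n` matters in degree `n` of a
product. In this way residual bounds yield relations between constant coefficients. -/
theorem norm_coeff_mul_sub_le (n : ℕ) (f : ℂ⟦X⟧) {g : ℂ⟦X⟧} {c : ℝ} (hg : ∀ i, ‖coeff i g‖ ≤ c) :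
    ‖coeff n (f * g) - coeff n f * coeff 0 g‖ ≤ norm1 n f * c := by
  rw [coeff_mul_eq_sum_range, Finset.sum_range_succ, Nat.sub_self, add_sub_cancel_right, norm1,
    Finset.sum_mul]
  refine (norm_sum_le _ _).trans (Finset.sum_le_sum fun i _ => ?_)
  rw [norm_mul]
  exact mul_le_mul_of_nonneg_left (hg _) (norm_nonneg _)

theorem coeff_mul_of_support {K : ℕ} {f g : ℂ⟦X⟧} (hf : ∀ i, K < i → coeff i f = 0)
    (hg : ∀ i, K < i → coeff i g = 0) (n : ℕ) :
    coeff n (f * g) = ∑ j ∈ Finset.range (K + 1), ∑ l ∈ Finset.range (K + 1),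
      if j + l = n then coeff j f * coeff l g else 0 := by
  rw [coeff_mul, ← Finset.sum_product', ← Finset.sum_filter]
  symm
  refine Finset.sum_subset (fun p hp => ?_) fun p hp hp' => ?_
  · exact Finset.HasAntidiagonal.mem_antidiagonal.2 (Finset.mem_filter.1 hp).2
  · rw [Finset.HasAntidiagonal.mem_antidiagonal] at hp
    simp only [Finset.mem_filter, Finset.mem_product, Finset.mem_range, hp, and_true] at hp'
    by_cases h : K < p.1
    · rw [hf _ h, zero_mul]
    · rw [hg p.2 (by omega), mul_zero]

/-- The coefficients of a product of reversed polynomials. -/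
theorem coeff_mul_reverse {K : ℕ} {f g f' g' : ℂ⟦X⟧} (hf : ∀ i, K < i → coeff i f = 0)
    (hg : ∀ i, K < i → coeff i g = 0) (hf' : ∀ i, K < i → coeff i f' = 0)
    (hg' : ∀ i, K < i → coeff i g' = 0) (rf : ∀ i ≤ K, coeff i f' = conj (coeff (K - i) f))
    (rg : ∀ i ≤ K, coeff i g' = conj (coeff (K - i) g)) {i : ℕ} (hi : i ≤ 2 * K) :
    coeff i (f' * g') = conj (coeff (2 * K - i) (f * g)) := by
  rw [coeff_mul_of_support hf hg, coeff_mul_of_support hf' hg', map_sum,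
    ← Finset.sum_range_reflect]
  refine Finset.sum_congr rfl fun j hj => ?_
  rw [map_sum, ← Finset.sum_range_reflect]
  refine Finset.sum_congr rfl fun l hl => ?_
  have hj' := Finset.mem_range.1 hj
  have hl' := Finset.mem_range.1 hl
  rw [rf _ (by omega), rg _ (by omega), show K - (K + 1 - 1 - j) = j by omega,
    show K - (K + 1 - 1 - l) = l by omega, apply_ite conj, map_mul, map_zero]
  exact if_congr (by omega) rfl rfl

/-- In degree `K` the identity `X ^ K f = act1 η - act2 ξ♯` says that `f(0)` is nearly `η(0)` times
a coefficient of `act1`, and the latter is at most 2 by contraction. The residuals use up at most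
half of `2 / R`. -/
theorem et_lower_bound {R : ℝ} {f h : ℂ⟦X⟧} (γ : ℕ → ℂ) (K : ℕ) {κ B : ℝ}
    (hA : normSq2 (K + 1) f + normSq2 (K + 1) h ≤ 2) (hf : 2 / R ≤ ‖coeff 0 f‖)
    (h1 : norm1 K (act1 (quad γ K) f h) ≤ κ) (h2 : norm1 K (act2 (quad γ K) f h) ≤ κ * B)
    (hκ : κ + κ * B ≤ 1 / R) : 1 / (2 * R) ≤ ‖coeff 0 (quad γ K).et‖ := by
  set q := quad γ K with hq
  have hid : X ^ K * f = act1 q f h * q.et - act2 q f h * q.xis := by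
    rw [act1, act2]
    linear_combination -f * quad_det γ K
  have hc := congrArg (coeff K) hid
  rw [coeff_X_pow_mul', if_pos le_rfl, Nat.sub_self, map_sub] at hc
  have b1 := norm_coeff_mul_sub_le K (act1 q f h) fun i => (norm_coeff_quad_le γ K i).1
  have b2 := norm_coeff_mul_sub_le K (act2 q f h) fun i => (norm_coeff_quad_le γ K i).2.2.2
  rw [(coeff_zero_sharp γ K).1, mul_zero, sub_zero] at b2
  rw [← hq] at b1 b2
  have b3 : ‖coeff K (act1 q f h)‖ ≤ 2 := by
    have := (normSq2_act_le γ K (K + 1) f h).trans hA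
    rw [← hq] at this
    have := sq_norm_coeff_le_normSq2 (Nat.lt_succ_self K) (act1 q f h)
    have := normSq2_nonneg (K + 1) (act2 q f h)
    exact le_of_sq_le_sq (by linarith) (by norm_num)
  have b4 : ‖coeff 0 f‖ ≤ κ * 1 + ‖coeff K (act1 q f h)‖ * ‖coeff 0 q.et‖ + κ * B * 1 := by
    rw [hc]
    refine (norm_sub_le _ _).trans (add_le_add ?_ (b2.trans (by gcongr)))
    calc ‖coeff K (act1 q f h * q.et)‖ = ‖(coeff K (act1 q f h * q.et) -
          coeff K (act1 q f h) * coeff 0 q.et) + coeff K (act1 q f h) * coeff 0 q.et‖ := by ring_nf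
      _ ≤ _ := by
          refine (norm_add_le _ _).trans ?_
          rw [norm_mul]
          gcongr
          exact b1.trans (by gcongr)
  have b5 : ‖coeff K (act1 q f h)‖ * ‖coeff 0 q.et‖ ≤ 2 * ‖coeff 0 q.et‖ := by gcongr
  have e1 : (2 : ℝ) / R = 2 * (1 / R) := by ring
  have e2 : (1 : ℝ) / (2 * R) = 1 / 2 * (1 / R) := by
    rw [one_div, mul_inv]
    ring
  rw [e2]
  linarith

/-- Let `M_q` and `M_p` be the matrices of `γ` and `γ'`, with rows `(ets, xis)` and `(-xi, et)`. The
product of `M_q` with the adjugate of `M_p` has rows `(V', -D')` and `(D, V)`. Both matrices nearly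
annihilate `(f, h)` modulo `X ^ K` and `f` is invertible, so these entries are small in low degrees.
Comparing coefficients in `X ^ K M_q = (M_q adj M_p) M_p` gives `η_q(0) ≈ c η_p(0)` in degree `K`
and, after conjugation, `γ_k η_q(0) ≈ c γ'_k η_p(0)` in degree `K + 1`, with the same `c = coeff K
V`. Eliminating `c` bounds `(γ_k - γ'_k) η_q(0)`. -/
theorem coeff_difference {R : ℝ} {f h x : ℂ⟦X⟧} (hx : f * x = 1) {γ γ' : ℕ → ℂ} {k : ℕ} (hR : 0 ≤ R)
    (hkR : (k : ℝ) + 2 ≤ R) (hxR : norm1 (k + 2) x ≤ R) {κ B β : ℝ}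
    (hβ : ∀ N, norm1 N (quad γ' (k + 1)).xi ≤ β)
    (h1 : norm1 (k + 1) (act1 (quad γ (k + 1)) f h) ≤ κ)
    (h2 : norm1 (k + 1) (act2 (quad γ (k + 1)) f h) ≤ κ * B)
    (h1' : norm1 (k + 1) (act1 (quad γ' (k + 1)) f h) = 0)
    (h2' : norm1 (k + 1) (act2 (quad γ' (k + 1)) f h) = 0) :
    ‖γ k - γ' k‖ * ‖coeff 0 (quad γ (k + 1)).et‖ ≤
      κ * (R ^ 2 * β + R * β + R ^ 2 * B) + ‖γ' k‖ * (κ * (R * β * B + R ^ 2 * B)) := by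
  have top := coeff_top_xi γ k
  have top' := coeff_top_xi γ' k
  set K := k + 1 with hK
  set q := quad γ K with hq
  set p := quad γ' K with hp
  set u1 := act1 q f h with hu1
  set u2 := act2 q f h with hu2
  set v1 := act1 p f h with hv1
  set v2 := act2 p f h with hv2
  set D := q.et * p.xi - q.xi * p.et with hD
  set D' := q.ets * p.xis - q.xis * p.ets with hD'
  set V := q.et * p.ets + q.xi * p.xis with hV
  set V' := q.ets * p.et + q.xis * p.xi with hV'
  have eD : D = x * (p.et * u2 - q.et * v2) := by
    rw [hD, hu2, hv2, act2, act2]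
    linear_combination (-(q.et * p.xi - q.xi * p.et)) * hx
  have eD' : D' = x * (p.xis * u1 - q.xis * v1) := by
    rw [hD', hu1, hv1, act1, act1]
    linear_combination (-(q.ets * p.xis - q.xis * p.ets)) * hx
  have eV : V = x * (q.et * v1 - p.xis * u2) := by
    rw [hV, hu2, hv1, act1, act2]
    linear_combination (-(q.et * p.ets + q.xi * p.xis)) * hx
  have eV' : V' = x * (p.et * u1 - q.xis * v2) := by
    rw [hV', hu1, hv2, act1, act2]
    linear_combination (-(q.ets * p.et + q.xis * p.xi)) * hx
  have hKR : ((K : ℕ) : ℝ) ≤ R := by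
    rw [hK]
    push_cast
    linarith
  have hK1R : ((K + 1 : ℕ) : ℝ) ≤ R := by
    rw [hK]
    push_cast
    linarith
  have hβ0 : 0 ≤ β := (norm1_nonneg 0 _).trans (hβ 0)
  have pxis : ∀ N, norm1 N p.xis ≤ β := fun N => (norm1_xis_le _ _ _).trans (hβ _)
  obtain ⟨n1, n2, n3, n4⟩ := norm1_quad_le γ K K
  obtain ⟨m1, m2, m3, m4⟩ := norm1_quad_le γ' K K
  rw [← hq] at n1 n2 n3 n4
  rw [← hp] at m1 m2 m3 m4
  have xK : norm1 K x ≤ R := (norm1_mono (by omega) x).trans hxR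
  have z1 : norm1 K v1 ≤ 0 := h1'.le
  have z2 : norm1 K v2 ≤ 0 := h2'.le
  have bD : norm1 K D ≤ R * (R * (κ * B) + R * 0) := by
    rw [eD]
    exact norm1_mul_le_of_le xK ((norm1_sub_le _ _ _).trans (add_le_add
      (norm1_mul_le_of_le (m1.trans hKR) h2) (norm1_mul_le_of_le (n1.trans hKR) z2)))
  have bV : norm1 K V ≤ R * (R * 0 + β * (κ * B)) := by
    rw [eV]
    exact norm1_mul_le_of_le xK ((norm1_sub_le _ _ _).trans (add_le_add
      (norm1_mul_le_of_le (n1.trans hKR) z1) (norm1_mul_le_of_le (pxis _) h2)))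
  have bV' : norm1 K V' ≤ R * (R * κ + R * 0) := by
    rw [eV']
    exact norm1_mul_le_of_le xK ((norm1_sub_le _ _ _).trans (add_le_add
      (norm1_mul_le_of_le (m1.trans hKR) h1) (norm1_mul_le_of_le (n4.trans hKR) z2)))
  -- One degree more than the residual bounds provide; it is gained because `ξ♯` vanishes at 0.
  have bD' : norm1 (K + 1) D' ≤ R * (β * κ + R * 0) := by
    rw [eD']
    refine norm1_mul_le_of_le hxR ((norm1_sub_le _ _ _).trans (add_le_add
      ((norm1_succ_mul_le K (coeff_zero_sharp γ' K).1 _).trans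
        (mul_le_mul (pxis _) h1 (norm1_nonneg _ _) hβ0))
      ((norm1_succ_mul_le K (coeff_zero_sharp γ K).1 _).trans
        (mul_le_mul ((norm1_quad_le γ K (K + 1)).2.2.2.trans hK1R) z1 (norm1_nonneg _ _) hR))))
  have z := coeff_quad_eq_zero γ K
  have z' := coeff_quad_eq_zero γ' K
  have s := coeff_sharp γ K
  have s' := coeff_sharp γ' K
  rw [← hq] at z s
  rw [← hp] at z' s'
  -- `V'` is the reversal of `V` with respect to degree `2 K`, and `K` is the middle degree. This
  -- makes the constant `c` the same in both comparisons.
  have revV : coeff K V' = conj (coeff K V) := by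
    rw [hV, hV', map_add, map_add, map_add,
      coeff_mul_reverse (K := K) (f := q.et) (g := p.ets) (fun i hi => (z i hi).1)
        (fun i hi => (z' i hi).2.2.1) (fun i hi => (z i hi).2.2.1) (fun i hi => (z' i hi).1)
        (fun i hi => (s i hi).1) (fun i hi => by
          rw [(s' (K - i) (by omega)).1, Complex.conj_conj]
          congr 2
          omega) (by omega),
      coeff_mul_reverse (K := K) (f := q.xi) (g := p.xis) (fun i hi => (z i hi).2.1)
        (fun i hi => (z' i hi).2.2.2) (fun i hi => (z i hi).2.2.2) (fun i hi => (z' i hi).2.1)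
        (fun i hi => (s i hi).2) (fun i hi => by
          rw [(s' (K - i) (by omega)).2, Complex.conj_conj]
          congr 2
          omega) (by omega), show 2 * K - K = K by omega]
  have revD : coeff (K + 1) D' = conj (coeff k D) := by
    rw [hD, hD', map_sub, map_sub, map_sub,
      coeff_mul_reverse (K := K) (f := q.et) (g := p.xi) (fun i hi => (z i hi).1)
        (fun i hi => (z' i hi).2.1) (fun i hi => (z i hi).2.2.1) (fun i hi => (z' i hi).2.2.2)
        (fun i hi => (s i hi).1) (fun i hi => (s' i hi).2) (by omega),
      coeff_mul_reverse (K := K) (f := q.xi) (g := p.et) (fun i hi => (z i hi).2.1)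
        (fun i hi => (z' i hi).1) (fun i hi => (z i hi).2.2.2) (fun i hi => (z' i hi).2.2.1)
        (fun i hi => (s i hi).2) (fun i hi => (s' i hi).1) (by omega),
      show 2 * K - (K + 1) = k by omega]
  have det' := quad_det γ' K
  rw [← hp] at det'
  have id1 : X ^ K * q.et = V * p.et + D * p.xis := by
    rw [hV, hD]
    linear_combination -q.et * det'
  have id2 : X ^ K * q.xis = V' * p.xis - D' * p.et := by
    rw [hV', hD']
    linear_combination -q.xis * det'
  obtain ⟨c0, -⟩ := coeff_zero_sharp γ' K
  rw [← hp] at c0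
  have nq := norm_coeff_quad_le γ' K
  rw [← hp] at nq
  have E1 : ‖coeff 0 q.et - coeff K V * coeff 0 p.et‖ ≤ norm1 K V * 1 + norm1 K D * 1 := by
    have hc := congrArg (coeff K) id1
    rw [coeff_X_pow_mul', if_pos le_rfl, Nat.sub_self, map_add] at hc
    have b1 := norm_coeff_mul_sub_le K V fun i => (nq i).1
    have b2 := norm_coeff_mul_sub_le K D fun i => (nq i).2.2.2
    rw [c0, mul_zero, sub_zero] at b2
    rw [hc, add_sub_right_comm]
    exact (norm_add_le _ _).trans (add_le_add b1 b2)
  have E2 : ‖coeff 1 q.xis - coeff K V' * coeff 1 p.xis‖ ≤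
      norm1 K V' * β + (norm1 (K + 1) D' * 1 + norm1 K D) := by
    have hc := congrArg (coeff (K + 1)) id2
    rw [coeff_X_pow_mul', if_pos (by omega), Nat.add_sub_cancel_left, map_sub] at hc
    rw [coeff_zero_eq_constantCoeff_apply] at c0
    obtain ⟨g, hg⟩ := X_dvd_iff.2 c0
    have hgc : ∀ i, coeff i g = coeff (i + 1) p.xis := fun i => by
      rw [hg, coeff_succ_X_mul]
    have b1 := norm_coeff_mul_sub_le (c := β) K V' (g := g) fun i => by
      rw [hgc]
      exact (norm_coeff_le_norm1 (Nat.lt_succ_self _) _).trans (pxis _)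
    have b2 := norm_coeff_mul_sub_le (K + 1) D' fun i => (nq i).1
    have e1 : coeff (K + 1) (V' * p.xis) = coeff K (V' * g) := by
      rw [hg, mul_left_comm, coeff_succ_X_mul]
    -- Degree `K + 1` is outside the range of `bD'`; by reversal this coefficient is the conjugate
    -- of one of `D` in degree `k < K`.
    have b3 : ‖coeff (K + 1) D' * coeff 0 p.et‖ ≤ norm1 K D := by
      rw [norm_mul, revD, Complex.norm_conj]
      exact (mul_le_of_le_one_right (norm_nonneg _) (nq 0).1).trans
        (norm_coeff_le_norm1 (by omega) D)
    rw [hc, e1, ← zero_add 1, ← hgc, sub_right_comm]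
    refine (norm_sub_le _ _).trans (add_le_add b1 ?_)
    calc ‖coeff (K + 1) (D' * p.et)‖ = ‖(coeff (K + 1) (D' * p.et) -
          coeff (K + 1) D' * coeff 0 p.et) + coeff (K + 1) D' * coeff 0 p.et‖ := by ring_nf
      _ ≤ _ := (norm_add_le _ _).trans (add_le_add b2 b3)
  obtain ⟨r, -, -, hr⟩ := coeff_zero_et γ K
  obtain ⟨r', -, -, hr'⟩ := coeff_zero_et γ' K
  rw [← hq] at hr
  rw [← hp] at hr'
  rw [(s 1 (by omega)).2, (s' 1 (by omega)).2, revV, ← map_mul, ← map_sub, Complex.norm_conj,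
    show K - 1 = k by omega, top, top'] at E2
  have hid : (γ k - γ' k) * coeff 0 q.et = (γ k * coeff 0 q.et -
      coeff K V * (γ' k * coeff 0 p.et)) - γ' k * (coeff 0 q.et - coeff K V * coeff 0 p.et) := by
    ring
  rw [← norm_mul, hid]
  refine (norm_sub_le _ _).trans (add_le_add (E2.trans ?_) ?_)
  · calc _ ≤ R * (R * κ + R * 0) * β + (R * (β * κ + R * 0) * 1 + R * (R * (κ * B) + R * 0)) := by
          gcongr
      _ = _ := by ring
  · rw [norm_mul]
    refine mul_le_mul_of_nonneg_left (E1.trans ?_) (norm_nonneg _)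
    calc _ ≤ R * (R * 0 + β * (κ * B)) * 1 + R * (R * (κ * B) + R * 0) * 1 := by gcongr
      _ = _ := by ring

end conditioning

/-! ### The forward error -/

section forward

open PowerSeries

theorem norm_le_norm2 {n : ℕ} (v : Fin n → ℂ) (i : Fin n) : ‖v i‖ ≤ norm2 v :=
  PiLp.norm_apply_le (WithLp.toLp 2 v) i

theorem norm2_nonneg {n : ℕ} (v : Fin n → ℂ) : 0 ≤ norm2 v := norm_nonneg _

theorem norm2_sq {n : ℕ} (v : Fin n → ℂ) : norm2 v ^ 2 = ∑ i, ‖v i‖ ^ 2 :=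
  EuclideanSpace.norm_sq_eq _

theorem norm2_le_of_le {n : ℕ} {v : Fin n → ℂ} {c : ℝ} (h : ∀ i, ‖v i‖ ≤ c) (hc : 0 ≤ c) :
    norm2 v ≤ n * c := by
  refine le_of_sq_le_sq ?_ (by positivity)
  rw [norm2_sq]
  calc ∑ i, ‖v i‖ ^ 2 ≤ ∑ _i : Fin n, c ^ 2 :=
        Finset.sum_le_sum fun i _ => pow_le_pow_left₀ (norm_nonneg _) (h i) 2
    _ = n * c ^ 2 := by simp
    _ ≤ (n : ℝ) ^ 2 * c ^ 2 := by
        refine mul_le_mul_of_nonneg_right ?_ (sq_nonneg c)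
        exact_mod_cast Nat.le_self_pow two_ne_zero n
    _ = (n * c) ^ 2 := by ring

variable {R : ℝ} {n : ℕ} {a b : ℕ → ℂ} {x : ℂ⟦X⟧}

/-- Each term in `coeff_difference` contains `norm1 n (mk b)`, directly or through the bound on the
exact `ξ`. Division by `η(0)`, bounded below by `et_lower_bound`, costs only `2 R`. -/
theorem seq_error (hR : 8 ≤ R) (hnR : (n : ℝ) + 2 ≤ R) (hx : mk a * x = 1)
    (hx1 : norm1 (n + 1) x ≤ R) (hx2 : normSq2 n x ≤ R ^ 2)
    (hN : ∀ N, normSq2 N (mk a) + normSq2 N (mk b) ≤ 1) (ha : 2 / R ≤ ‖a 0‖) {γ : ℕ → ℂ} {κ : ℝ}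
    (h1 : ∀ k ≤ n, norm1 k (act1 (quad γ k) (mk a) (mk b)) ≤ κ)
    (h2 : ∀ k ≤ n, norm1 k (act2 (quad γ k) (mk a) (mk b)) ≤ κ * norm1 n (mk b))
    (hκ : κ + κ * norm1 n (mk b) ≤ 1 / R) {k : ℕ} (hk : k < n) :
    ‖γ k - stripSeq a b k‖ ≤ R ^ 15 * κ * norm1 n (mk b) := by
  have hR0 : 0 < R := by linarith
  have ha0 : a 0 ≠ 0 := norm_pos_iff.1 (lt_of_lt_of_le (by positivity) ha)
  have hκ0 : 0 ≤ κ := (norm1_nonneg _ _).trans (h1 0 (Nat.zero_le n))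
  have G : Good R n (mk a) (mk b) (2 / R) 1 0 := by
    refine ⟨by rwa [coeff_mk], hN n, x, 0, ?_, ?_⟩
    · rwa [normSq2_zero, add_zero]
    · rw [hx, mul_zero, add_zero, sub_self, norm1_eq_zero fun i _ => map_zero _]
  set B := norm1 n (mk b) with hB
  have hB0 : 0 ≤ B := norm1_nonneg _ _
  have hB2 : B ≤ 2 * R := (G.norm1_le (by linarith) (by norm_num)).2
  set γ' := stripSeq a b with hγ'
  obtain ⟨z1, z2⟩ := norm1_act_stripSeq (b := b) ha0 (k + 1)
  rw [← hγ'] at z1 z2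
  have hβ : ∀ N, norm1 N (quad γ' (k + 1)).xi ≤ R ^ 4 * B := fun N => by
    refine (norm1_xi_le _ _ _).trans ((G.xi_le hR (by linarith) (by norm_num) γ' hk zero_le_one
      (by rw [z2]; positivity)).trans (mul_le_mul_of_nonneg_right ?_ hB0))
    have := pow_absorb hR 3 1
    norm_num at this
    nlinarith [pow_pos hR0 3]
  have hA : normSq2 (k + 1 + 1) (mk a) + normSq2 (k + 1 + 1) (mk b) ≤ 2 :=
    (hN _).trans (by norm_num)
  have ha' : 2 / R ≤ ‖coeff 0 (mk a)‖ := by rwa [coeff_mk]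
  have e1 := et_lower_bound γ (k + 1) hA ha' (h1 _ hk) (h2 _ hk) hκ
  have e2 := et_lower_bound (κ := 0) (B := B) γ' (k + 1) hA ha' z1.le (by rw [z2, zero_mul])
    (by rw [zero_mul, add_zero]; positivity)
  have inv_bound : ∀ {t e c : ℝ}, 0 ≤ t → 1 / (2 * R) ≤ e → t * e ≤ c → t ≤ 2 * R * c := by
    intro t e c ht he h
    have : t * (1 / (2 * R)) ≤ c := (mul_le_mul_of_nonneg_left he ht).trans h
    rw [mul_one_div, div_le_iff₀ (by positivity)] at this
    linarith
  have hγb : ‖γ' k‖ ≤ 2 * R * (R ^ 4 * B) := by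
    refine inv_bound (norm_nonneg _) e2 ?_
    rw [← norm_mul, ← coeff_top_xi]
    exact (norm_coeff_le_norm1 (Nat.lt_succ_self k) _).trans (hβ _)
  have hγb' : ‖γ' k‖ ≤ 4 * R ^ 6 := by
    calc _ ≤ 2 * R * (R ^ 4 * (2 * R)) := hγb.trans (by gcongr)
      _ = _ := by ring
  have hkn : (k : ℝ) + 1 ≤ n := by exact_mod_cast hk
  have D := inv_bound (norm_nonneg _) e1 (coeff_difference (κ := κ) (B := B) hx hR0.le
    (by linarith) ((norm1_mono (by omega) x).trans hx1) hβ (h1 _ hk) (h2 _ hk) z1 z2)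
  have hκB : 0 ≤ κ * B := mul_nonneg hκ0 hB0
  have step : κ * (R ^ 2 * (R ^ 4 * B) + R * (R ^ 4 * B) + R ^ 2 * B) +
      ‖γ' k‖ * (κ * (R * (R ^ 4 * B) * B + R ^ 2 * B)) ≤ 9 * R ^ 12 * (κ * B) := by
    have s1 : κ * (R * (R ^ 4 * B) * B + R ^ 2 * B) ≤ κ * (R * (R ^ 4 * B) * (2 * R) + R ^ 2 * B) := by
      gcongr
    calc _ ≤ κ * (R ^ 2 * (R ^ 4 * B) + R * (R ^ 4 * B) + R ^ 2 * B) +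
        4 * R ^ 6 * (κ * (R * (R ^ 4 * B) * (2 * R) + R ^ 2 * B)) := by
          gcongr
      _ = (R ^ 6 + R ^ 5 + R ^ 2 + 8 * R ^ 12 + 4 * R ^ 8) * (κ * B) := by ring
      _ ≤ _ := by
        refine mul_le_mul_of_nonneg_right ?_ hκB
        have p : ∀ i ≤ 8, R ^ i ≤ R ^ 8 := fun i hi => pow_le_pow_right₀ (by linarith) hi
        have := pow_absorb hR 8 4
        norm_num at this
        linarith [p 6 (by norm_num), p 5 (by norm_num), p 2 (by norm_num), pow_pos hR0 8]
  calc _ ≤ 2 * R * (9 * R ^ 12 * (κ * B)) := D.trans (by gcongr)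
    _ = 18 * R ^ 13 * (κ * B) := by ring
    _ ≤ R ^ 15 * (κ * B) := by
        refine mul_le_mul_of_nonneg_right ?_ hκB
        have := pow_absorb hR 13 2
        norm_num at this
        linarith [pow_pos hR0 13]
    _ = _ := by ring

/-- In `b = a(0) L γ` the entries of `a(0) L` are at most 1: the constant coefficients of the first
components never decrease in modulus, and all their coefficients are at most 1 by contraction. This
converts errors relative to `b` into errors relative to `γ`. -/
theorem norm1_le_norm2_stripSeq (ha : a 0 ≠ 0)
    (hN : ∀ N, normSq2 N (mk a) + normSq2 N (mk b) ≤ 1) (n : ℕ) :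
    norm1 n (mk b) ≤ n * (n * norm2 fun k : Fin n => stripSeq a b k) := by
  have hmono : ∀ k, ‖a 0‖ ≤ ‖(strip a b k).1 0‖ := by
    intro k
    induction k with
    | zero => exact le_rfl
    | succ k ih =>
      refine ih.trans ?_
      rw [(strip_fst_zero_ne ha k).2, norm_mul]
      exact mul_le_of_le_one_left (norm_nonneg _) (norm_sc_le_one _)
  have hcoef : ∀ k j, ‖(strip a b k).1 j‖ ≤ 1 := by
    intro k j
    have h := (normSq2_act_le (stripSeq a b) k (k + (j + 1)) (mk a) (mk b)).trans (hN _)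
    rw [(act_stripSeq ha k).1, (act_stripSeq ha k).2, normSq2_X_pow_mul, normSq2_X_pow_mul] at h
    have h1 := sq_norm_coeff_le_normSq2 (Nat.lt_succ_self j) (mk (strip a b k).1 : ℂ⟦X⟧)
    have h2 := normSq2_nonneg (j + 1) (mk (strip a b k).2 : ℂ⟦X⟧)
    rw [coeff_mk] at h1
    exact (sq_le_one_iff₀ (norm_nonneg _)).1 (by linarith)
  have ha0 : 0 < ‖a 0‖ := norm_pos_iff.2 ha
  refine norm1_le_of_coeff_le fun i hi => ?_
  have h := coeff_eq_sum_strip (b := b) ha hi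
  have h' : b i = a 0 * ∑ k ∈ Finset.range n, (if k ≤ i then
      (strip a b (k + 1)).1 (i - k) / (strip a b (k + 1)).1 0 else 0) * stripSeq a b k := by
    rw [← h, mul_inv_cancel_left₀ ha]
  rw [coeff_mk, h', Finset.mul_sum]
  calc _ ≤ ∑ k ∈ Finset.range n, norm2 fun k : Fin n => stripSeq a b k := by
        refine (norm_sum_le _ _).trans (Finset.sum_le_sum fun k hk => ?_)
        rw [← mul_assoc, norm_mul]
        refine (mul_le_of_le_one_left (norm_nonneg _) ?_).trans
          (norm_le_norm2 (fun k : Fin n => stripSeq a b k) ⟨k, Finset.mem_range.1 hk⟩)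
        split_ifs
        · rw [norm_mul, norm_div, mul_div_assoc',
            div_le_one (ha0.trans_le (hmono (k + 1)))]
          exact (mul_le_of_le_one_right (norm_nonneg _) (hcoef _ _)).trans (hmono (k + 1))
        · simp
    _ = _ := by simp

/-- The forward error of the algorithm. -/
theorem ens_forward {M u : ℝ} (hM : 1 ≤ M) (hn : 1 ≤ n) (hx : mk a * x = 1)
    (hxM : ∀ i, ‖coeff i x‖ ≤ M) (hN : ∀ N, normSq2 N (mk a) + normSq2 N (mk b) ≤ 1) (hu : 0 ≤ u)
    (hR : R = 8 * n * M) (hRu : R ^ (21 * Nat.clog 2 n + 40) * u ≤ 1) :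
    Ensures (invNLFFT n a b) u fun out => norm2 (fun k : Fin n => out.γ k - stripSeq a b k) ≤
      R ^ (21 * Nat.clog 2 n + 40) * u * norm2 fun k : Fin n => stripSeq a b k := by
  have hn' : (1 : ℝ) ≤ n := by exact_mod_cast hn
  have hnM : (n : ℝ) ≤ n * M := le_mul_of_one_le_right (by positivity) hM
  have hMn : M ≤ n * M := le_mul_of_one_le_left (by positivity) hn'
  have hR8 : 8 ≤ R := by
    rw [hR]
    linarith
  have hR0 : 0 < R := by linarith
  -- The constant coefficients satisfy `a(0) x(0) = 1`.
  have ha1 : 1 / M ≤ ‖a 0‖ := by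
    have h0 := congrArg (coeff 0) hx
    rw [coeff_mul_eq_sum_range, Finset.sum_range_one, coeff_mk, coeff_zero_one] at h0
    have h1 := hxM 0
    rw [div_le_iff₀ (by linarith)]
    calc (1 : ℝ) = ‖a 0‖ * ‖coeff 0 x‖ := by
          rw [← norm_mul, h0, norm_one]
      _ ≤ _ := by gcongr
  have ha : 2 / R ≤ ‖a 0‖ := by
    refine le_trans ?_ ha1
    rw [div_le_div_iff₀ hR0 (by linarith), hR]
    linarith
  have ha0 : a 0 ≠ 0 := norm_pos_iff.1 (lt_of_lt_of_le (by positivity) ha)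
  set D := Nat.clog 2 n with hD
  set δ := R ^ (21 * D + 31) * u with hδ
  have hδ0 : 0 ≤ δ := by positivity
  have hδ9 : R ^ 9 * δ ≤ 1 := by
    refine le_of_eq_of_le ?_ hRu
    rw [hδ]
    ring
  have hu1 : u ≤ 1 / 1000 := by
    have : R ^ 4 ≤ R ^ (21 * D + 40) := pow_le_pow_right₀ (by linarith) (by omega)
    have h8 : (8 : ℝ) ^ 4 ≤ R ^ 4 := by gcongr
    have : 8 ^ 4 * u ≤ 1 := (mul_le_mul_of_nonneg_right (h8.trans this) hu).trans hRu
    norm_num at this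
    linarith
  have hx1 : norm1 (n + 1) x ≤ R := by
    refine (norm1_le_of_coeff_le fun i _ => hxM i).trans ?_
    push_cast
    rw [hR]
    nlinarith
  have hx2 : normSq2 n x ≤ R ^ 2 := by
    calc normSq2 n x ≤ ∑ _i ∈ Finset.range n, M ^ 2 :=
          Finset.sum_le_sum fun i _ => pow_le_pow_left₀ (norm_nonneg _) (hxM i) 2
      _ = n * M ^ 2 := by simp
      _ ≤ R ^ 2 := by
          rw [hR]
          nlinarith [sq_nonneg M]
  have G : Good R n (mk a) (mk b) (2 / R) 1 0 := by
    refine ⟨by rwa [coeff_mk], hN n, x, 0, ?_, ?_⟩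
    · rwa [normSq2_zero, add_zero]
    · rw [hx, mul_zero, add_zero, sub_self, norm1_eq_zero fun i _ => map_zero _]
  have hDn : (D : ℝ) ≤ R := by
    have : D ≤ n := Nat.clog_le_of_le_pow (Nat.lt_two_pow_self.le)
    have : (D : ℝ) ≤ n := by exact_mod_cast this
    rw [hR]
    linarith
  have hRδ : R ^ 2 * δ ≤ 1 := by
    refine le_trans (mul_le_mul_of_nonneg_right ?_ hδ0) hδ9
    exact pow_le_pow_right₀ (by linarith) (by norm_num)
  have hDδ : D * δ ≤ 1 / R := by
    rw [le_div_iff₀ hR0]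
    calc D * δ * R ≤ R * δ * R := by gcongr
      _ = R ^ 2 * δ := by ring
      _ ≤ 1 := hRδ
  have hR8' : 1 / R ≤ 1 / 8 := one_div_le_one_div_of_le (by norm_num) hR8
  have hδ1 : δ ≤ 1 := by
    refine le_trans ?_ hδ9
    exact le_mul_of_one_le_left hδ0 (one_le_pow₀ (by linarith))
  refine (ens_invNLFFT hR8 hu hu1 le_rfl hδ1 D le_rfl n hn (Nat.le_pow_clog (by norm_num) n)
    (by rw [hR]; linarith) a b _ _ _ G
    (by rw [show (2 : ℝ) / R = 1 / R + 1 / R by ring]; linarith) (by linarith)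
    (by linarith)).mono fun out H => ?_
  set κ := R ^ (21 * D + 18) * u with hκ
  have hκ0 : 0 ≤ κ := by positivity
  have hB0 := norm1_nonneg n (mk b : ℂ⟦X⟧)
  have hκ3 : R ^ 22 * κ ≤ 1 := by
    refine le_of_eq_of_le ?_ hRu
    rw [hκ]
    ring
  have hκB : κ + κ * norm1 n (mk b) ≤ 1 / R := by
    have hB := (G.norm1_le (by rw [hR]; linarith) (by norm_num)).2
    have h3 : R ^ 3 * κ ≤ 1 := by
      refine le_trans (mul_le_mul_of_nonneg_right ?_ hκ0) hκ3
      exact pow_le_pow_right₀ (by linarith) (by norm_num)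
    rw [le_div_iff₀ hR0]
    calc (κ + κ * norm1 n (mk b)) * R ≤ (κ + κ * (2 * R)) * R := by gcongr
      _ = (R + 2 * R ^ 2) * κ := by ring
      _ ≤ R ^ 3 * κ := by
          refine mul_le_mul_of_nonneg_right ?_ hκ0
          nlinarith
      _ ≤ 1 := h3
  set V := norm2 fun k : Fin n => stripSeq a b k with hV
  have hV0 : 0 ≤ V := norm2_nonneg _
  have hBV := norm1_le_norm2_stripSeq ha0 hN n
  have hnR : (n : ℝ) ≤ R := by
    rw [hR]
    linarith
  -- The exponents add up to `18 + 15 + 3 = 36`: the induction, `seq_error`, and three factors `n ≤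
  -- R` from changes of norm. The surplus up to 40 keeps the smallness conditions uniform.
  calc norm2 (fun k : Fin n => out.γ k - stripSeq a b k)
      ≤ n * (R ^ 15 * κ * norm1 n (mk b)) := norm2_le_of_le (fun k => seq_error hR8
        (by rw [hR]; linarith) hx hx1 hx2 hN ha H.residual1 H.residual2 hκB k.2) (by positivity)
    _ ≤ R * (R ^ 15 * κ * (R * (R * V))) := by
        gcongr
        refine hBV.trans ?_
        rw [← hV]
        gcongr
    _ = R ^ (21 * D + 36) * (u * V) := by
        rw [hκ]
        ring
    _ ≤ R ^ (21 * D + 40) * (u * V) := by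
        gcongr
        · linarith
        · omega
    _ = _ := by ring

end forward

/-! ### The backward error -/

/-- With `e = w - v`, the rank-one matrix `F = -e w* / ‖w‖²` maps `w` to `-e`, so `(L + L F) w = L
v`. Its norm is at most `‖e‖ / ‖w‖ ≤ 2 ε`, and the condition number of `L` does not enter. -/
theorem exists_backward_error {n : ℕ} (L : Matrix (Fin n) (Fin n) ℂ) {v w r : Fin n → ℂ} {ε : ℝ}
    (hε : 0 ≤ ε) (hε1 : ε ≤ 1 / 2) (hL : L *ᵥ v = r)
    (h : norm2 (fun k => w k - v k) ≤ ε * norm2 v) :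
    ∃ E : Matrix (Fin n) (Fin n) ℂ, (L + E) *ᵥ w = r ∧ ‖E‖ ≤ 2 * ε * ‖L‖ := by
  have tri : norm2 v ≤ norm2 w + norm2 (fun k => w k - v k) := by
    have := norm_sub_le (WithLp.toLp 2 w) (WithLp.toLp 2 fun k => w k - v k)
    rwa [← WithLp.toLp_sub, show (w - fun k => w k - v k) = v from by ext; simp] at this
  have hv0 := norm2_nonneg v
  have hvw : norm2 v ≤ 2 * norm2 w := by nlinarith
  rcases eq_or_ne w 0 with rfl | hw
  · have : norm2 v ≤ 0 := by simpa [norm2] using hvw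
    obtain rfl : v = 0 := by
      ext i
      exact norm_le_zero_iff.1 ((norm_le_norm2 v i).trans this)
    exact ⟨0, by simpa using hL, by simp; positivity⟩
  have hw0 : 0 < norm2 w := norm_pos_iff.2 fun h => hw (congrArg WithLp.ofLp h)
  set e : Fin n → ℂ := fun k => w k - v k with he
  have hwe : w - e = v := by
    ext
    simp [he]
  have hww : star w ⬝ᵥ w = ((norm2 w ^ 2 : ℝ) : ℂ) := by
    rw [norm2_sq, dotProduct, Complex.ofReal_sum]
    refine Finset.sum_congr rfl fun i _ => ?_
    rw [Pi.star_apply, ← Complex.normSq_eq_norm_sq, Complex.normSq_eq_conj_mul_self]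
    rfl
  set F : Matrix (Fin n) (Fin n) ℂ :=
    (-(((norm2 w ^ 2)⁻¹ : ℝ) : ℂ)) • Matrix.vecMulVec e (star w) with hF
  have hFw : F *ᵥ w = -e := by
    rw [hF, Matrix.smul_mulVec, Matrix.vecMulVec_mulVec, hww]
    ext i
    have : ((norm2 w : ℝ) : ℂ) ≠ 0 := Complex.ofReal_ne_zero.2 hw0.ne'
    simp
    field_simp
  refine ⟨L * F, ?_, ?_⟩
  · rw [Matrix.add_mulVec, ← Matrix.mulVec_mulVec, hFw, ← Matrix.mulVec_add, ← sub_eq_add_neg, hwe,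
      hL]
  have hvec : ‖Matrix.vecMulVec e (star w)‖ ≤ norm2 e * norm2 w := by
    rw [Matrix.l2_opNorm_def]
    refine ContinuousLinearMap.opNorm_le_bound _ (mul_nonneg (norm2_nonneg _) hw0.le) fun x => ?_
    have hx : (Matrix.toEuclideanLin.trans LinearMap.toContinuousLinearMap)
        (Matrix.vecMulVec e (star w)) x = inner ℂ (WithLp.toLp 2 w) x • WithLp.toLp 2 e := by
      ext i
      simp [Matrix.vecMulVec_mulVec, EuclideanSpace.inner_eq_star_dotProduct, dotProduct_comm,
        mul_comm]
    rw [hx, norm_smul, mul_comm (norm2 e), mul_right_comm]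
    exact mul_le_mul_of_nonneg_right (norm_inner_le_norm _ _) (norm_nonneg _)
  refine (Matrix.l2_opNorm_mul _ _).trans ?_
  rw [mul_comm]
  refine mul_le_mul_of_nonneg_right ?_ (norm_nonneg _)
  rw [hF, norm_smul, norm_neg, Complex.norm_real, Real.norm_of_nonneg (by positivity)]
  calc _ ≤ (norm2 w ^ 2)⁻¹ * ((ε * (2 * norm2 w)) * norm2 w) := by
        gcongr
        refine hvec.trans ?_
        gcongr
        exact h.trans (by gcongr)
    _ = 2 * ε := by
        field_simp

/-! ### Laurent polynomials -/

section laurent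

open LaurentPolynomial

theorem coeff_conjL (f : ℂ[T;T⁻¹]) (k : ℤ) : (conjL f).coeff k = conj (f.coeff (-k)) := by
  rw [conjL, invert_apply, AddMonoidAlgebra.coeff_mapRingHom]

theorem conjL_conjL (f : ℂ[T;T⁻¹]) : conjL (conjL f) = f := by
  ext k
  rw [coeff_conjL, coeff_conjL, neg_neg, Complex.conj_conj]

theorem conjL_add (f g : ℂ[T;T⁻¹]) : conjL (f + g) = conjL f + conjL g := by
  rw [conjL, map_add, map_add]
  rfl

theorem conjL_sub (f g : ℂ[T;T⁻¹]) : conjL (f - g) = conjL f - conjL g := by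
  rw [conjL, map_sub, map_sub]
  rfl

theorem conjL_mul (f g : ℂ[T;T⁻¹]) : conjL (f * g) = conjL f * conjL g := by
  rw [conjL, map_mul, map_mul]
  rfl

theorem conjL_one : conjL 1 = 1 := by
  rw [conjL, map_one, map_one]

theorem conjL_zero : conjL 0 = 0 := by
  rw [conjL, map_zero, map_zero]

theorem conjL_C (c : ℂ) : conjL (C c) = C (conj c) := by
  ext k
  rw [coeff_conjL, C_apply, C_apply, apply_ite conj, map_zero]
  exact if_congr neg_eq_zero rfl rfl

theorem conjL_T (n : ℤ) : conjL (T n) = T (-n) := by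
  ext k
  rw [coeff_conjL, T_apply, T_apply, apply_ite conj, map_zero, map_one]
  exact if_congr (by omega) rfl rfl

theorem coeff_C_mul_eq (c : ℂ) (f : ℂ[T;T⁻¹]) (k : ℤ) : (C c * f).coeff k = c * f.coeff k := by
  rw [← smul_eq_C_mul, AddMonoidAlgebra.coeff_smul_apply, smul_eq_mul]

theorem coeff_T_mul_eq (n : ℤ) (f : ℂ[T;T⁻¹]) (k : ℤ) : (T n * f).coeff k = f.coeff (k - n) := by
  induction f using LaurentPolynomial.induction_on' with
  | add f g hf hg =>
    rw [mul_add, AddMonoidAlgebra.coeff_add, AddMonoidAlgebra.coeff_add, Finsupp.add_apply,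
      Finsupp.add_apply, hf, hg]
  | C_mul_T m c =>
    rw [mul_left_comm, ← T_add, coeff_C_mul_eq, coeff_C_mul_eq, T_apply, T_apply]
    exact congrArg _ (if_congr (by omega) rfl rfl)

theorem eq_sum_of_isPoly {f : ℂ[T;T⁻¹]} (hf : IsPoly f) {N : ℕ}
    (hN : ∀ k : ℤ, (N : ℤ) ≤ k → f.coeff k = 0) :
    f = ∑ i ∈ Finset.range N, C (f.coeff (i : ℤ)) * T (i : ℤ) := by
  ext k
  rw [AddMonoidAlgebra.coeff_sum, Finset.sum_apply']
  simp only [coeff_C_mul_eq, T_apply]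
  rcases lt_or_ge k 0 with hk | hk
  · rw [hf k hk, Finset.sum_eq_zero fun i _ => by rw [if_neg (by omega), mul_zero]]
  · lift k to ℕ using hk
    simp only [Nat.cast_inj, mul_ite, mul_one, mul_zero]
    rw [Finset.sum_ite_eq']
    split_ifs with h
    · rfl
    · exact hN _ (by simpa using h)

theorem exists_coeff_bound (f : ℂ[T;T⁻¹]) : ∃ N : ℕ, ∀ k : ℤ, (N : ℤ) ≤ k → f.coeff k = 0 := by
  refine ⟨f.coeff.support.sup Int.toNat + 1, fun k hk => ?_⟩
  by_contra h
  have := Finset.le_sup (f := Int.toNat) (Finsupp.mem_support_iff.2 h)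
  omega

theorem coeff_mul_conjL {f : ℂ[T;T⁻¹]} (hf : IsPoly f) {N : ℕ}
    (hN : ∀ k : ℤ, (N : ℤ) ≤ k → f.coeff k = 0) (k : ℤ) : (f * conjL f).coeff k =
      ∑ i ∈ Finset.range N, f.coeff (i : ℤ) * conj (f.coeff (i - k)) := by
  conv_lhs =>
    enter [1, 1, 1]
    rw [eq_sum_of_isPoly hf hN]
  rw [Finset.sum_mul, AddMonoidAlgebra.coeff_sum, Finset.sum_apply']
  refine Finset.sum_congr rfl fun i _ => ?_
  rw [mul_assoc, coeff_C_mul_eq, coeff_T_mul_eq, coeff_conjL, neg_sub]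

theorem coeff_mul_conjL_top {f : ℂ[T;T⁻¹]} (hf : IsPoly f) {N : ℕ}
    (hN : ∀ k : ℤ, (N : ℤ) < k → f.coeff k = 0) :
    (f * conjL f).coeff (N : ℤ) = f.coeff (N : ℤ) * conj (f.coeff 0) := by
  rw [coeff_mul_conjL hf (N := N + 1) fun k hk => hN k (by omega), Finset.sum_range_succ, sub_self,
    Finset.sum_eq_zero fun i hi => by
      rw [hf (i - N) (by have := Finset.mem_range.1 hi; omega), map_zero, mul_zero], zero_add]

variable {α b : ℂ[T;T⁻¹]}

theorem coeff_one_eq (k : ℤ) : (1 : ℂ[T;T⁻¹]).coeff k = if k = 0 then 1 else 0 := by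
  rw [← map_one C, C_apply]

/-- If `α` had top degree `N ≥ n` with `N > 0`, the coefficient of degree `N` in `α α* + b b* = 1`
would be `α_N` times the conjugate of `α_0`, as `b` does not reach this degree. Hence `α_N = 0`, and
one descends from a large `N`. -/
theorem coeff_fst_eq_zero (hα : IsPoly α) (hb : IsPoly b) (h : α * conjL α + b * conjL b = 1)
    (h0 : α.coeff 0 ≠ 0) {n : ℕ} (hn : ∀ k : ℤ, (n : ℤ) ≤ k → b.coeff k = 0) (k : ℤ) (hk : n ≤ k)
    (hk0 : 0 < k) : α.coeff k = 0 := by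
  have key : ∀ N : ℕ, (∀ k : ℤ, (N : ℤ) ≤ k → n ≤ k → 0 < k → α.coeff k = 0) →
      ∀ k : ℤ, n ≤ k → 0 < k → α.coeff k = 0 := by
    intro N
    induction N with
    | zero => exact fun h k hk hk0 => h k (by omega) hk hk0
    | succ N ih =>
      refine fun hN => ih fun k hk hnk hk0 => ?_
      rcases eq_or_lt_of_le hk with rfl | hk
      · have hc := DFunLike.congr_fun (congrArg AddMonoidAlgebra.coeff h) (N : ℤ)
        rw [AddMonoidAlgebra.coeff_add, Finsupp.add_apply, coeff_mul_conjL_top hα fun k hk =>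
          hN k (by push_cast; omega) (by omega) (by omega),
          coeff_mul_conjL_top hb fun k hk => hn k (by omega), hn _ hnk, zero_mul, add_zero,
          coeff_one_eq, if_neg hk0.ne'] at hc
        exact (mul_eq_zero.1 hc).resolve_right ((map_ne_zero _).2 h0)
      · exact hN k (by push_cast; omega) hnk hk0
  obtain ⟨N, hN⟩ := exists_coeff_bound α
  exact key N (fun k hk _ _ => hN k hk) k hk hk0

/-- Parseval's identity, read off as the coefficient of degree 0. -/
theorem normSq2_coeffs_le (hα : IsPoly α) (hb : IsPoly b) (h : α * conjL α + b * conjL b = 1)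
    (N : ℕ) : normSq2 N (PowerSeries.mk (coeffs α)) + normSq2 N (PowerSeries.mk (coeffs b)) ≤ 1 := by
  obtain ⟨M, hM⟩ := exists_coeff_bound α
  obtain ⟨M', hM'⟩ := exists_coeff_bound b
  set K := max N (max M M') with hK
  have hc := DFunLike.congr_fun (congrArg AddMonoidAlgebra.coeff h) (0 : ℤ)
  have term : ∀ f : ℂ[T;T⁻¹], ∑ i ∈ Finset.range K, f.coeff (i : ℤ) * conj (f.coeff (i - 0)) =
      ((normSq2 K (PowerSeries.mk (coeffs f)) : ℝ) : ℂ) := by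
    intro f
    rw [normSq2, Complex.ofReal_sum]
    refine Finset.sum_congr rfl fun i _ => ?_
    rw [sub_zero, Complex.mul_conj, Complex.normSq_eq_norm_sq, PowerSeries.coeff_mk]
    rfl
  rw [AddMonoidAlgebra.coeff_add, Finsupp.add_apply,
    coeff_mul_conjL hα (N := K) fun k hk => hM k (by omega),
    coeff_mul_conjL hb (N := K) fun k hk => hM' k (by omega), term, term, coeff_one_eq, if_pos rfl] at hc
  have : normSq2 K (PowerSeries.mk (coeffs α)) + normSq2 K (PowerSeries.mk (coeffs b)) = 1 := by
    exact_mod_cast hc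
  exact (add_le_add (normSq2_mono (le_max_left _ _) _) (normSq2_mono (le_max_left _ _) _)).trans
    this.le

end laurent

/-! ### Layer stripping and the nonlinear Fourier transform -/

section layers

open LaurentPolynomial

theorem strip_succ' (a b : ℕ → ℂ) (k : ℕ) :
    strip a b (k + 1) = strip (strip a b 1).1 (strip a b 1).2 k := by
  induction k with
  | zero => rfl
  | succ k ih =>
    conv_lhs => rw [strip, ih]
    rfl

theorem stripSeq_succ (a b : ℕ → ℂ) (k : ℕ) :
    stripSeq a b (k + 1) = stripSeq (strip a b 1).1 (strip a b 1).2 k := by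
  rw [stripSeq, stripSeq, strip_succ']

theorem of_congr {R : Type*} {p q r s p' q' r' s' : R} (h1 : p = p') (h2 : q = q') (h3 : r = r')
    (h4 : s = s') : !![p, q; r, s] = !![p', q'; r', s'] := by
  rw [h1, h2, h3, h4]

/-- Conjugation of matrices by `diag (1, z⁻¹)`. -/
def shift (M : Matrix (Fin 2) (Fin 2) ℂ[T;T⁻¹]) : Matrix (Fin 2) (Fin 2) ℂ[T;T⁻¹] :=
  !![1, 0; 0, T (-1)] * M * !![1, 0; 0, T 1]

theorem T_mul_T_neg (n : ℤ) : (T n * T (-n) : ℂ[T;T⁻¹]) = 1 := by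
  rw [← T_add, add_neg_cancel, T_zero]

theorem T_one_mul_T_neg : (T 1 * T (-1) : ℂ[T;T⁻¹]) = 1 := T_mul_T_neg 1

theorem shift_of (p q r s : ℂ[T;T⁻¹]) :
    shift !![p, q; r, s] = !![p, T 1 * q; T (-1) * r, s] := by
  rw [shift, Matrix.mul_fin_two, Matrix.mul_fin_two]
  refine of_congr (by ring) (by ring) (by ring) ?_
  linear_combination s * T_one_mul_T_neg

theorem shift_one : shift 1 = 1 := by
  rw [Matrix.one_fin_two, shift_of, mul_zero, mul_zero]

theorem shift_mul (M N : Matrix (Fin 2) (Fin 2) ℂ[T;T⁻¹]) : shift (M * N) = shift M * shift N := by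
  have h : (!![1, 0; 0, T 1] * !![1, 0; 0, T (-1)] : Matrix (Fin 2) (Fin 2) ℂ[T;T⁻¹]) = 1 := by
    rw [Matrix.mul_fin_two, Matrix.one_fin_two]
    simp [T_one_mul_T_neg, -T_mul]
  calc shift (M * N) = !![1, 0; 0, T (-1)] * M * 1 * N * !![1, 0; 0, T 1] := by
        rw [shift, mul_one, mul_assoc _ M N]
    _ = _ := by
        rw [← h, shift, shift]
        simp only [mul_assoc]

theorem shift_prod (l : List (Matrix (Fin 2) (Fin 2) ℂ[T;T⁻¹])) :
    (l.map shift).prod = shift l.prod := by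
  induction l with
  | nil => exact shift_one.symm
  | cons M l ih => rw [List.map_cons, List.prod_cons, List.prod_cons, shift_mul, ih]

theorem factor_eq (k : ℕ) (g : ℂ) : factor k g = !![C (sc g), C (sc g) * (C g * T (k : ℤ));
    C (sc g) * -(C (conj g) * T (-(k : ℤ))), C (sc g)] := by
  rw [factor, Matrix.smul_of]
  simp [sc]

theorem factor_succ (k : ℕ) (g : ℂ) : factor (k + 1) g = shift (factor k g) := by
  rw [factor_eq, factor_eq, shift_of]
  push_cast
  rw [neg_add, T_add, T_add]
  exact of_congr rfl (by ring) (by ring) rfl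

/-- Conjugation by `diag (1, z⁻¹)` raises the index of a factor by one and is multiplicative, so
removing the first factor leaves the transform of the shifted sequence. -/
theorem nlft_succ {n : ℕ} (γ : Fin (n + 1) → ℂ) :
    nlft γ = factor 0 (γ 0) * shift (nlft fun k : Fin n => γ k.succ) := by
  rw [nlft, List.ofFn_succ, List.prod_cons, nlft, ← shift_prod, List.map_ofFn]
  congr 3
  ext1 k
  rw [Function.comp_apply, Fin.val_succ, factor_succ]

theorem factor_zero_mul_shift (g : ℂ) (α b : ℂ[T;T⁻¹]) :
    factor 0 g * shift (pairMatrix (conjL α) b) =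
      pairMatrix (conjL (C (sc g) * (α - C (conj g) * (T 1 * b))))
        (C (sc g) * (T 1 * b + C g * α)) := by
  rw [factor_eq, pairMatrix, pairMatrix, shift_of, Matrix.mul_fin_two]
  simp only [conjL_conjL, conjL_mul, conjL_add, conjL_sub, conjL_C, conjL_T, conj_sc,
    Complex.conj_conj, Nat.cast_zero, neg_zero, neg_neg, T_zero]
  exact of_congr (by ring) (by ring) (by ring) (by ring)

theorem pairMatrix_injective {a b a' b' : ℂ[T;T⁻¹]} (h : pairMatrix a b = pairMatrix a' b') :
    a = a' ∧ b = b' := by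
  have h1 := congrFun (congrFun h 0) 0
  have h2 := congrFun (congrFun h 0) 1
  simpa [pairMatrix] using And.intro h1 h2

/-- Layer stripping undoes the outermost factor of any transform and so recovers its sequence. This
is the uniqueness of `γ`. -/
theorem exists_of_nlft {n : ℕ} (γ : Fin n → ℂ) : ∃ α b : ℂ[T;T⁻¹], IsPoly α ∧ IsPoly b ∧
    α.coeff 0 ≠ 0 ∧ nlft γ = pairMatrix (conjL α) b ∧
      ∀ k : Fin n, stripSeq (coeffs α) (coeffs b) k = γ k := by
  induction n with
  | zero =>
    refine ⟨1, 0, fun k hk => by rw [coeff_one_eq, if_neg hk.ne], fun k _ => rfl,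
      by rw [coeff_one_eq]; simp, ?_, fun k => k.elim0⟩
    rw [nlft, List.ofFn_zero, List.prod_nil, conjL_one, pairMatrix, conjL_zero, conjL_one,
      neg_zero, Matrix.one_fin_two]
  | succ n ih =>
    obtain ⟨α, b, hα, hb, h0, h, hs⟩ := ih fun k => γ k.succ
    set g := γ 0 with hg
    set α' := C (sc g) * (α - C (conj g) * (T 1 * b)) with hα'
    set b' := C (sc g) * (T 1 * b + C g * α) with hb'
    have cα : ∀ k, α'.coeff k = sc g * (α.coeff k - conj g * b.coeff (k - 1)) := fun k => by
      rw [hα', coeff_C_mul_eq, AddMonoidAlgebra.coeff_sub, Finsupp.sub_apply, coeff_C_mul_eq,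
        coeff_T_mul_eq]
    have cb : ∀ k, b'.coeff k = sc g * (b.coeff (k - 1) + g * α.coeff k) := fun k => by
      rw [hb', coeff_C_mul_eq, AddMonoidAlgebra.coeff_add, Finsupp.add_apply, coeff_C_mul_eq,
        coeff_T_mul_eq]
    have b1 : b.coeff (-1) = 0 := hb _ (by norm_num)
    have hs0 := sc_ne_zero g
    have hg0 : stripSeq (coeffs α') (coeffs b') 0 = g := by
      simp only [stripSeq, strip, coeffs, Nat.cast_zero, cα, cb, zero_sub, b1, mul_zero, sub_zero,
        zero_add]
      field_simp
    have hsc := sc_mul_sc g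
    have h1 : strip (coeffs α') (coeffs b') 1 = (coeffs α, coeffs b) := by
      refine Prod.ext ?_ ?_
      · ext j
        rw [strip_succ_fst, hg0]
        simp only [strip, coeffs, cα, cb]
        linear_combination α.coeff j * hsc
      · ext j
        rw [strip_succ_snd, hg0]
        simp only [strip, coeffs, cα, cb]
        rw [show ((j + 1 : ℕ) : ℤ) - 1 = j by push_cast; ring]
        linear_combination b.coeff j * hsc
    refine ⟨α', b', fun k hk => ?_, fun k hk => ?_, ?_, ?_, fun k => ?_⟩
    · rw [cα, hα k hk, hb _ (by omega)]
      ring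
    · rw [cb, hα k hk, hb _ (by omega)]
      ring
    · rw [cα, zero_sub, b1]
      simpa using ⟨hs0, h0⟩
    · rw [nlft_succ, h, factor_zero_mul_shift]
    · refine Fin.cases hg0 (fun k => ?_) k
      rw [Fin.val_succ, stripSeq_succ, h1, hs]

/-- Stripping one layer preserves `α α* + b b* = 1` and the positivity at 0, and lowers the degree
bound on `b` by one. This is the existence of `γ`. -/
theorem nlft_stripSeq (n : ℕ) : ∀ α b : ℂ[T;T⁻¹], IsPoly α → IsPoly b →
    α * conjL α + b * conjL b = 1 → 0 < (α.coeff 0).re → (α.coeff 0).im = 0 →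
      (∀ k : ℤ, (n : ℤ) ≤ k → b.coeff k = 0) →
        nlft (fun k : Fin n => stripSeq (coeffs α) (coeffs b) k) = pairMatrix (conjL α) b := by
  induction n with
  | zero =>
    intro α b hα hb h hr hi hn
    obtain rfl : b = 0 := by
      ext k
      rcases lt_or_ge k 0 with hk | hk
      · exact hb k hk
      · exact hn k (by simpa using hk)
    have h0 : α.coeff 0 ≠ 0 := fun h0 => by simp [h0] at hr
    have hα' : α = C (α.coeff 0) := by
      ext k
      rw [C_apply]
      split_ifs with hk
      · rw [hk]
      · rcases lt_or_gt_of_ne hk with hk | hk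
        · exact hα k hk
        · exact coeff_fst_eq_zero hα hb h h0 hn k (by simpa using hk.le) hk
    have hc : α.coeff 0 = ((α.coeff 0).re : ℂ) := Complex.ext rfl hi
    set r := (α.coeff 0).re
    rw [hc] at hα'
    have h1 : r * r = 1 := by
      rw [hα', zero_mul, add_zero, conjL_C, ← map_mul, Complex.conj_ofReal] at h
      have := DFunLike.congr_fun (congrArg AddMonoidAlgebra.coeff h) (0 : ℤ)
      rw [C_apply, if_pos rfl, coeff_one_eq, if_pos rfl] at this
      exact_mod_cast this
    -- The positivity of the constant coefficient excludes `-1`.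
    have hr1 : r = 1 := by nlinarith
    rw [hr1, Complex.ofReal_one, map_one] at hα'
    rw [hα', nlft, List.ofFn_zero, List.prod_nil, conjL_one, pairMatrix, conjL_zero, conjL_one,
      neg_zero, Matrix.one_fin_two]
  | succ n ih =>
    intro α b hα hb h hr hi hn
    have h0 : α.coeff 0 ≠ 0 := fun h0 => by simp [h0] at hr
    have hdeg := coeff_fst_eq_zero hα hb h h0 hn
    set g := stripSeq (coeffs α) (coeffs b) 0 with hg
    have hgb : b.coeff 0 = g * α.coeff 0 := strip_snd_zero (a := coeffs α) (b := coeffs b) h0 0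
    have hsc := sc_mul_sc g
    have hscC : C (sc g) * C (sc g) * (1 + C g * C (conj g)) = (1 : ℂ[T;T⁻¹]) := by
      rw [← map_one C, ← map_mul, ← map_mul, ← map_add, ← map_mul, hsc]
    set α' := C (sc g) * (α + C (conj g) * b) with hα'
    set b' := T (-1) * (C (sc g) * (b - C g * α)) with hb'
    have hTb : T 1 * b' = C (sc g) * (b - C g * α) := by
      rw [hb', ← mul_assoc, T_one_mul_T_neg, one_mul]
    have cα : ∀ k, α'.coeff k = sc g * (α.coeff k + conj g * b.coeff k) := fun k => by
      rw [hα', coeff_C_mul_eq, AddMonoidAlgebra.coeff_add, Finsupp.add_apply, coeff_C_mul_eq]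
    have cb : ∀ k, b'.coeff k = sc g * (b.coeff (k + 1) - g * α.coeff (k + 1)) := fun k => by
      rw [hb', coeff_T_mul_eq, sub_neg_eq_add, coeff_C_mul_eq, AddMonoidAlgebra.coeff_sub,
        Finsupp.sub_apply, coeff_C_mul_eq]
    have h1 : strip (coeffs α) (coeffs b) 1 = (coeffs α', coeffs b') := by
      refine Prod.ext ?_ ?_
      · ext j
        rw [strip_succ_fst, ← hg]
        simp only [strip, coeffs, cα]
      · ext j
        rw [strip_succ_snd, ← hg]
        simp only [strip, coeffs, cb]
        push_cast
        rfl
    have hα0 : α'.coeff 0 = (Real.sqrt (1 + ‖g‖ ^ 2) : ℝ) * α.coeff 0 := by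
      rw [cα, hgb]
      have : ((Real.sqrt (1 + ‖g‖ ^ 2) : ℝ) : ℂ) = (sc g)⁻¹ := by rw [sc_eq_inv, inv_inv]
      rw [this]
      have := sc_ne_zero g
      field_simp
      linear_combination hsc
    have hnorm : α' * conjL α' + b' * conjL b' = 1 := by
      rw [hα', hb']
      simp only [conjL_mul, conjL_add, conjL_sub, conjL_C, conjL_T, conj_sc, Complex.conj_conj]
      rw [neg_neg]
      linear_combination C (sc g) * C (sc g) * (b - C g * α) * (conjL b - C (conj g) * conjL α) *
        T_one_mul_T_neg + (α * conjL α + b * conjL b) * hscC + h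
    have IH := ih α' b' (fun k hk => by rw [cα, hα k hk, hb k hk]; ring) (fun k hk => by
        rw [cb]
        rcases eq_or_lt_of_le (show k + 1 ≤ 0 by omega) with hk | hk
        · rw [hk, hgb, sub_self, mul_zero]
        · rw [hα _ hk, hb _ hk]
          ring) hnorm
      (by rw [hα0, Complex.re_ofReal_mul]; positivity)
      (by rw [hα0, Complex.im_ofReal_mul, hi, mul_zero]) fun k hk => by
        rw [cb, hn _ (by push_cast; omega), hdeg _ (by push_cast; omega) (by omega)]
        ring
    have e1 : (fun k : Fin n => stripSeq (coeffs α) (coeffs b) (k.succ : Fin (n + 1))) =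
        fun k : Fin n => stripSeq (coeffs α') (coeffs b') k := by
      ext k
      rw [Fin.val_succ, stripSeq_succ, h1]
    rw [nlft_succ, e1, IH, Fin.val_zero, ← hg, factor_zero_mul_shift, hTb]
    congr 1
    · congr 1
      rw [hα']
      linear_combination α * hscC
    · rw [hα']
      linear_combination b * hscC

end layers

/-! ### Values on the unit circle -/

section values

open LaurentPolynomial

theorem evalL_add (f g : ℂ[T;T⁻¹]) (z : ℂ) : evalL (f + g) z = evalL f z + evalL g z :=
  Finsupp.sum_add_index' (fun _ => zero_mul _) fun _ _ _ => add_mul _ _ _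

theorem evalL_zero (z : ℂ) : evalL 0 z = 0 := Finsupp.sum_zero_index

theorem evalL_sum {ι : Type*} (s : Finset ι) (f : ι → ℂ[T;T⁻¹]) (z : ℂ) :
    evalL (∑ i ∈ s, f i) z = ∑ i ∈ s, evalL (f i) z :=
  map_sum (AddMonoidHom.mk' (fun f => evalL f z) fun f g => evalL_add f g z) f s

theorem evalL_C_mul_T (c : ℂ) (m : ℤ) (z : ℂ) : evalL (C c * T m) z = c * z ^ m := by
  rw [← single_eq_C_mul_T, evalL, AddMonoidAlgebra.coeff_single]
  exact Finsupp.sum_single_index (zero_mul _)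

theorem evalL_mul (f g : ℂ[T;T⁻¹]) {z : ℂ} (hz : z ≠ 0) :
    evalL (f * g) z = evalL f z * evalL g z := by
  induction f using LaurentPolynomial.induction_on' with
  | add f f' hf hf' => rw [add_mul, evalL_add, evalL_add, hf, hf', add_mul]
  | C_mul_T m c =>
    induction g using LaurentPolynomial.induction_on' with
    | add g g' hg hg' => rw [mul_add, evalL_add, evalL_add, hg, hg', mul_add]
    | C_mul_T m' c' =>
      rw [show C c * T m * (C c' * T m') = C (c * c') * T (m + m') by rw [map_mul, T_add]; ring,
        evalL_C_mul_T, evalL_C_mul_T, evalL_C_mul_T, zpow_add₀ hz]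
      ring

theorem evalL_conjL (f : ℂ[T;T⁻¹]) {z : ℂ} (hz : ‖z‖ = 1) :
    evalL (conjL f) z = conj (evalL f z) := by
  induction f using LaurentPolynomial.induction_on' with
  | add f g hf hg => rw [conjL_add, evalL_add, evalL_add, hf, hg, map_add]
  | C_mul_T m c =>
    rw [conjL_mul, conjL_C, conjL_T, evalL_C_mul_T, evalL_C_mul_T, map_mul, map_zpow₀,
      ← Complex.inv_eq_conj hz, zpow_neg, inv_zpow]

theorem sq_norm_evalL_add {α b : ℂ[T;T⁻¹]} (h : α * conjL α + b * conjL b = 1) {z : ℂ}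
    (hz : ‖z‖ = 1) : ‖evalL α z‖ ^ 2 + ‖evalL b z‖ ^ 2 = 1 := by
  have hz0 : z ≠ 0 := fun h => by simp [h] at hz
  have h' : evalL (α * conjL α + b * conjL b) z = evalL 1 z := by rw [h]
  rw [evalL_add, evalL_mul _ _ hz0, evalL_mul _ _ hz0, evalL_conjL _ hz, evalL_conjL _ hz,
    Complex.mul_conj, Complex.mul_conj, Complex.normSq_eq_norm_sq, Complex.normSq_eq_norm_sq,
    show (1 : ℂ[T;T⁻¹]) = C 1 * T 0 by rw [map_one, T_zero, mul_one], evalL_C_mul_T, zpow_zero,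
    mul_one] at h'
  exact_mod_cast h'

theorem norm_evalL_le_iSup (b : ℂ[T;T⁻¹]) (z : Circle) :
    ‖evalL b z‖ ≤ ⨆ z : Circle, ‖evalL b z‖ := by
  refine le_ciSup (f := fun z : Circle => ‖evalL b z‖)
    ⟨∑ k ∈ b.coeff.support, ‖b.coeff k‖, ?_⟩ z
  rintro _ ⟨w, rfl⟩
  refine (norm_sum_le _ _).trans (Finset.sum_le_sum fun k _ => ?_)
  rw [norm_mul, norm_zpow, Circle.norm_coe, one_zpow, mul_one]

theorem evalL_eq_eval {f : ℂ[T;T⁻¹]} (hf : IsPoly f) {N : ℕ}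
    (hN : ∀ k : ℤ, (N : ℤ) ≤ k → f.coeff k = 0) (z : ℂ) :
    evalL f z = ((PowerSeries.mk (coeffs f)).trunc N).eval z := by
  conv_lhs => rw [eq_sum_of_isPoly hf hN]
  rw [evalL_sum, Polynomial.eval, PowerSeries.eval₂_trunc_eq_sum_range]
  refine Finset.sum_congr rfl fun i _ => ?_
  rw [evalL_C_mul_T, PowerSeries.coeff_mk, zpow_natCast]
  rfl

end values

/-! ### The reciprocal of an outer polynomial -/

section reciprocal

open Polynomial Metric

/-- Cauchy's estimate on the unit circle itself. With `Q` the truncation of the formal inverse, `P Q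
- 1 = z ^ (j + 1) r`, hence `1 / (z ^ (j + 1) P) = Q / z ^ (j + 1) - r / P`. The last quotient is
holomorphic in the disk and continuous on its closure, so the integral over the circle picks out the
coefficient of degree `j` of `Q`. -/
theorem exists_mul_eq_one_of_le_norm_eval {P : ℂ[X]} {η : ℝ} (hη : 0 < η)
    (hP : ∀ z : ℂ, ‖z‖ = 1 → η ≤ ‖P.eval z‖) (hP0 : ∀ z : ℂ, ‖z‖ < 1 → P.eval z ≠ 0) :
    ∃ x : PowerSeries ℂ, (P : PowerSeries ℂ) * x = 1 ∧ ∀ j, ‖PowerSeries.coeff j x‖ ≤ η⁻¹ := by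
  have hne : ∀ z ∈ closedBall (0 : ℂ) 1, P.eval z ≠ 0 := by
    intro z hz
    rw [mem_closedBall_zero_iff] at hz
    rcases hz.lt_or_eq with h | h
    · exact hP0 z h
    · exact norm_pos_iff.1 (hη.trans_le (hP z h))
  have hc0 : PowerSeries.constantCoeff (P : PowerSeries ℂ) ≠ 0 := by
    rw [Polynomial.constantCoeff_coe, Polynomial.coeff_zero_eq_eval_zero]
    exact hne 0 (by simp)
  refine ⟨(P : PowerSeries ℂ)⁻¹, PowerSeries.mul_inv_cancel _ hc0, fun j => ?_⟩
  set x := (P : PowerSeries ℂ)⁻¹ with hx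
  have hPx : (P : PowerSeries ℂ) * x = 1 := PowerSeries.mul_inv_cancel _ hc0
  set Q := x.trunc (j + 1) with hQ
  have hdvd : (X : ℂ[X]) ^ (j + 1) ∣ P * Q - 1 := by
    obtain ⟨y, hy⟩ : (PowerSeries.X : PowerSeries ℂ) ^ (j + 1) ∣ x - Q := by
      rw [PowerSeries.X_pow_dvd_iff]
      intro m hm
      rw [map_sub, Polynomial.coeff_coe, hQ, PowerSeries.coeff_trunc, if_pos hm, sub_self]
    have h1 : ((P * Q - 1 : ℂ[X]) : PowerSeries ℂ) =
        PowerSeries.X ^ (j + 1) * (-(P : PowerSeries ℂ) * y) := by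
      rw [Polynomial.coe_sub, Polynomial.coe_mul, Polynomial.coe_one]
      linear_combination -(P : PowerSeries ℂ) * hy + hPx
    rw [Polynomial.X_pow_dvd_iff]
    intro d hd
    rw [← Polynomial.coeff_coe, h1, PowerSeries.coeff_X_pow_mul', if_neg (by omega)]
  obtain ⟨r, hr⟩ := hdvd
  have hcont : ContinuousOn (fun z => r.eval z / P.eval z) (closedBall (0 : ℂ) 1) :=
    r.continuous.continuousOn.div P.continuous.continuousOn hne
  have hint0 : (∮ z in C(0, 1), r.eval z / P.eval z) = 0 :=
    Complex.circleIntegral_eq_zero_of_differentiable_on_off_countable zero_le_one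
      Set.countable_empty hcont fun z hz =>
        r.differentiableAt.div P.differentiableAt (hne z (ball_subset_closedBall hz.1))
  have hz0 : ∀ z ∈ sphere (0 : ℂ) 1, z ≠ 0 := fun z hz h => by simp [h] at hz
  have hcirc : (∮ z in C(0, 1), (z ^ (j + 1) * P.eval z)⁻¹) =
      (2 * Real.pi * Complex.I) * PowerSeries.coeff j x := by
    have e1 : ∀ z ∈ sphere (0 : ℂ) 1, (z ^ (j + 1) * P.eval z)⁻¹ =
        (∑ i ∈ Finset.range (j + 1), PowerSeries.coeff i x * (z - 0) ^ ((i : ℤ) - (j + 1))) -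
          r.eval z / P.eval z := by
      intro z hz
      have h0 := hz0 z hz
      have hPz := hne z (sphere_subset_closedBall hz)
      have hev := congrArg (Polynomial.eval z) hr
      simp only [Polynomial.eval_sub, Polynomial.eval_mul, Polynomial.eval_one,
        Polynomial.eval_pow, Polynomial.eval_X] at hev
      have hQz : (∑ i ∈ Finset.range (j + 1), PowerSeries.coeff i x * (z - 0) ^ ((i : ℤ) - (j + 1))) =
          Q.eval z / z ^ (j + 1) := by
        rw [hQ, Polynomial.eval, PowerSeries.eval₂_trunc_eq_sum_range, Finset.sum_div]
        refine Finset.sum_congr rfl fun i _ => ?_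
        rw [sub_zero, zpow_sub₀ h0, zpow_natCast, mul_div_assoc]
        norm_cast
      rw [hQz]
      field_simp
      linear_combination -hev
    have hci : ∀ i ∈ Finset.range (j + 1), CircleIntegrable
        (fun z : ℂ => PowerSeries.coeff i x * (z - 0) ^ ((i : ℤ) - (j + 1))) 0 1 := fun i _ => by
      refine ContinuousOn.circleIntegrable zero_le_one fun z hz => ?_
      refine ContinuousAt.continuousWithinAt (continuousAt_const.mul ?_)
      exact (continuousAt_id.sub continuousAt_const).zpow₀ _ (Or.inl (by simpa using hz0 z hz))
    rw [circleIntegral.integral_congr zero_le_one e1, circleIntegral.integral_sub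
      (CircleIntegrable.fun_sum _ hci)
      ((hcont.mono sphere_subset_closedBall).circleIntegrable zero_le_one), hint0, sub_zero,
      circleIntegral.integral_fun_sum hci, Finset.sum_range_succ, Finset.sum_eq_zero fun i hi => by
        have := Finset.mem_range.1 hi
        rw [circleIntegral.integral_const_mul, circleIntegral.integral_sub_zpow_of_ne (by omega),
          mul_zero], zero_add, circleIntegral.integral_const_mul,
      show (j : ℤ) - (j + 1) = -1 by ring]
    simp only [zpow_neg_one]
    rw [circleIntegral.integral_sub_center_inv 0 one_ne_zero, mul_comm]
  have hbound := circleIntegral.norm_two_pi_i_inv_smul_integral_le_of_norm_le_const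
    (f := fun z : ℂ => (z ^ (j + 1) * P.eval z)⁻¹) (c := 0) (R := 1) (C := η⁻¹) zero_le_one
    fun z hz => by
      rw [mem_sphere_zero_iff_norm] at hz
      rw [norm_inv, norm_mul, norm_pow, hz, one_pow, one_mul]
      exact inv_anti₀ hη (hP z hz)
  rwa [hcirc, smul_eq_mul, inv_mul_cancel_left₀ Complex.two_pi_I_ne_zero, one_mul] at hbound

/-- On the circle `|α|² = 1 - |b|² ≥ 1 - (1 - η)² ≥ η²`. -/
theorem exists_reciprocal {η : ℝ} (hη : 0 < η) (hη1 : η < 1) {α b : LaurentPolynomial ℂ}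
    (hα : IsOuter α) (h : α * conjL α + b * conjL b = 1)
    (hb : (⨆ z : Circle, ‖evalL b z‖) ≤ 1 - η) :
    ∃ x : PowerSeries ℂ, PowerSeries.mk (coeffs α) * x = 1 ∧
      ∀ j, ‖PowerSeries.coeff j x‖ ≤ η⁻¹ := by
  obtain ⟨N, hN⟩ := exists_coeff_bound α
  have hP : (((PowerSeries.mk (coeffs α)).trunc N : ℂ[X]) : PowerSeries ℂ) =
      PowerSeries.mk (coeffs α) := by
    ext i
    rw [Polynomial.coeff_coe, PowerSeries.coeff_trunc]
    split_ifs with hi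
    · rfl
    · rw [PowerSeries.coeff_mk]
      exact (hN i (by omega)).symm
  rw [← hP]
  refine exists_mul_eq_one_of_le_norm_eval hη (fun z hz => ?_) fun z hz => ?_
  · rw [← evalL_eq_eval hα.1 hN]
    have h1 := sq_norm_evalL_add h hz
    have h2 : ‖evalL b z‖ ≤ 1 - η :=
      (norm_evalL_le_iSup b ⟨z, mem_sphere_zero_iff_norm.2 hz⟩).trans hb
    have h3 : ‖evalL b z‖ ^ 2 ≤ (1 - η) ^ 2 := pow_le_pow_left₀ (norm_nonneg _) h2 2
    refine le_of_sq_le_sq ?_ (norm_nonneg _)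
    nlinarith
  · rw [← evalL_eq_eval hα.1 hN]
    exact hα.2 z hz

end reciprocal

/-! ### The error in terms of the growth function -/

section total

open PowerSeries

theorem growth_le_growth {C C' : ℝ} (hC : 0 ≤ C) (h : C ≤ C') {n : ℕ} {η : ℝ}
    (hΛ : 0 ≤ Real.log n ^ 2 + Real.log n * Real.log η⁻¹) :
    growth C n η ≤ C / C' * growth C' n η := by
  rcases hC.eq_or_lt with rfl | hC
  · simp [growth]
  rw [growth, growth, div_mul_eq_mul_div, mul_left_comm, mul_div_cancel_left₀ _ (by linarith)]
  gcongr

/-- The exponent is at most `(63 + 60) log n`, and the logarithm of the base at most `4 log n + log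
η⁻¹`. -/
theorem pow_le_growth {n : ℕ} (hn : 2 ≤ n) {η : ℝ} (hη : 0 < η) (hη1 : η < 1) :
    (8 * n * η⁻¹) ^ (21 * Nat.clog 2 n + 40) ≤ growth 1000 n η := by
  have hn' : (2 : ℝ) ≤ n := by exact_mod_cast hn
  have hη' : 1 < η⁻¹ := (one_lt_inv₀ hη).2 hη1
  have hD := clog_le_three_mul_log hn
  have h2 := Real.log_two_gt_d9
  have hl : Real.log 2 ≤ Real.log n := Real.log_le_log (by norm_num) hn'
  have hm : 0 < Real.log η⁻¹ := Real.log_pos hη'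
  have hlog : Real.log (8 * n * η⁻¹) = 3 * Real.log 2 + Real.log n + Real.log η⁻¹ := by
    rw [Real.log_mul (by positivity) (by positivity), Real.log_mul (by norm_num) (by positivity),
      show (8 : ℝ) = 2 ^ 3 by norm_num, Real.log_pow]
    norm_num
  rw [← Real.exp_log (by positivity : 0 < 8 * (n : ℝ) * η⁻¹), ← Real.exp_nat_mul, hlog, growth]
  set l := Real.log n
  set m := Real.log η⁻¹
  push_cast
  calc Real.exp ((21 * (Nat.clog 2 n : ℝ) + 40) * (3 * Real.log 2 + l + m))
      ≤ Real.exp ((123 * l) * (4 * l + m)) := by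
        gcongr <;> linarith
    _ ≤ Real.exp (1000 * (l ^ 2 + l * m)) := by
        refine Real.exp_le_exp.2 ?_
        nlinarith [mul_pos (show 0 < l by linarith) hm, sq_nonneg l]
    _ ≤ _ := le_mul_of_one_le_left (Real.exp_pos _).le (by norm_num)

/-- The case `n = 1` is separate: there `growth` does not depend on `η` and leaves no room for a
power of `η⁻¹`, but a single division has an error free of `η`. -/
theorem ens_forward_growth {n : ℕ} {η u : ℝ} (hn : 1 ≤ n) (hη : 0 < η) (hη1 : η < 1)
    {a b : ℕ → ℂ} {x : ℂ⟦X⟧} (hx : mk a * x = 1) (hxη : ∀ i, ‖coeff i x‖ ≤ η⁻¹)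
    (hN : ∀ N, normSq2 N (mk a) + normSq2 N (mk b) ≤ 1) (hu : 0 ≤ u)
    (hG : growth 1000 n η * u ≤ 1) :
    Ensures (invNLFFT n a b) u fun out => norm2 (fun k : Fin n => out.γ k - stripSeq a b k) ≤
      growth 1000 n η * u * norm2 fun k : Fin n => stripSeq a b k := by
  rcases hn.eq_or_lt with rfl | hn2
  · have ha : a 0 ≠ 0 := by
      intro h
      have h0 := congrArg (coeff 0) hx
      rw [coeff_mul_eq_sum_range, Finset.sum_range_one, coeff_mk, h, zero_mul,
        coeff_zero_one] at h0
      exact zero_ne_one h0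
    have hg : growth 1000 1 η = 1000 := by simp [growth]
    rw [hg] at hG ⊢
    refine (ens_invNLFFT_one hu (by linarith) le_rfl ha).mono fun out H => ?_
    have hγ : stripSeq a b 0 = b 0 / a 0 := rfl
    have h0 := norm_le_norm2 (fun k : Fin 1 => stripSeq a b k) 0
    have h1 : norm2 (fun k : Fin 1 => out.γ k - stripSeq a b k) ≤
        (1 : ℕ) * (12 * u * ‖stripSeq a b 0‖) := norm2_le_of_le (fun k => by
      rw [Fin.val_eq_zero k, hγ]
      exact H.2) (by positivity)
    rw [Nat.cast_one, one_mul] at h1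
    refine h1.trans (mul_le_mul ?_ h0 (norm_nonneg _) (by positivity))
    linarith
  · have hp := pow_le_growth hn2 hη hη1
    have hp' := mul_le_mul_of_nonneg_right hp hu
    refine (ens_forward ((one_lt_inv₀ hη).2 hη1).le hn hx hxη hN hu rfl
      (hp'.trans hG)).mono fun out H => H.trans ?_
    exact mul_le_mul_of_nonneg_right hp' (norm2_nonneg _)

/-- Since `ε ≤ 1 / 2`, the term `log ε⁻¹ ≥ log 2` also absorbs the prefactor `1000 ≤ 2 ^ 10`. -/
theorem growth_mul_le {n : ℕ} {η ε : ℝ} {r : ℕ} (hε : 0 < ε) (hε1 : ε ≤ 1 / 2)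
    (hΛ : 0 ≤ Real.log n ^ 2 + Real.log n * Real.log η⁻¹)
    (hr : 100000 * (Real.log n ^ 2 + Real.log n * Real.log η⁻¹ + Real.log ε⁻¹) ≤ r) :
    growth 1000 n η * 2⁻¹ ^ r ≤ ε := by
  rw [growth]
  set Λ := Real.log n ^ 2 + Real.log n * Real.log η⁻¹
  have h2 := Real.log_two_gt_d9
  have hlε : Real.log 2 ≤ Real.log ε⁻¹ :=
    Real.log_le_log (by norm_num) (by rw [le_inv_comm₀ (by norm_num) hε]; linarith)
  have e1 : (2⁻¹ : ℝ) ^ r = Real.exp (-(r * Real.log 2)) := by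
    rw [Real.exp_neg, mul_comm, Real.exp_mul, Real.exp_log (by norm_num), Real.rpow_natCast, inv_pow]
  have e2 : ε = Real.exp (-Real.log ε⁻¹) := by
    rw [Real.log_inv, neg_neg, Real.exp_log hε]
  have e3 : (1000 : ℝ) ≤ Real.exp (10 * Real.log 2) := by
    rw [mul_comm, Real.exp_mul, Real.exp_log (by norm_num)]
    norm_num
  have hrl : 100000 * (Λ + Real.log ε⁻¹) * 0.69 ≤ r * Real.log 2 :=
    mul_le_mul hr (by linarith) (by norm_num) (by positivity)
  calc 1000 * Real.exp (1000 * Λ) * 2⁻¹ ^ r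
      ≤ Real.exp (10 * Real.log 2) * Real.exp (1000 * Λ) * Real.exp (-(r * Real.log 2)) := by
        rw [e1]
        gcongr
    _ = Real.exp (10 * Real.log 2 + 1000 * Λ + -(r * Real.log 2)) := by
        rw [Real.exp_add, Real.exp_add]
    _ ≤ Real.exp (-Real.log ε⁻¹) := Real.exp_le_exp.2 (by linarith)
    _ = ε := e2.symm

end total

end NLFT

end

/-! ### Assembly of the theorem. -/

theorem mainTheorem2 :
    ∃ C : ℝ, 0 < C ∧
      -- the number of floating-point operations, for arbitrary inputs
      (∀ (n : ℕ) (u : ℝ) (a b : ℕ → ℂ), 2 ≤ n → 0 ≤ u →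
        ∀ out ∈ NLFT.invNLFFT n a b u, (out.2 : ℝ) ≤ C * (n * Real.log n ^ 2)) ∧
      -- numerical stability
      (∀ (n : ℕ) (η : ℝ) (a b : ℂ[T;T⁻¹]), 0 < η → η < 1 →
        (a, b) ∈ NLFT.SEta η → NLFT.IsOuter (NLFT.conjL a) →
        (∀ k : ℤ, (n : ℤ) ≤ k → b.coeff k = 0) →
        ∃ γ : Fin n → ℂ,
          -- the exact inverse nonlinear Fourier transform
          (NLFT.nlft γ = NLFT.pairMatrix a b ∧
            ∀ γ' : Fin n → ℂ, NLFT.nlft γ' = NLFT.pairMatrix a b → γ' = γ) ∧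
          -- the bit requirement
          (∀ (ε : ℝ) (r : ℕ), 0 < ε → ε ≤ 1 / 2 →
            C * (Real.log n ^ 2 + Real.log n * Real.log η⁻¹ + Real.log ε⁻¹) ≤ r →
            ∀ out ∈ NLFT.invNLFFT n (NLFT.coeffs (NLFT.conjL a)) (NLFT.coeffs b) (2⁻¹ ^ r),
              NLFT.norm2 (fun k : Fin n => out.1.γ k - γ k) ≤ ε * NLFT.norm2 γ) ∧
          -- the backward error
          (∀ u : ℝ, 0 ≤ u → C * n ^ 3 * η⁻¹ ^ 3 * NLFT.growth C n η * u ≤ 1 →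
            ∀ out ∈ NLFT.invNLFFT n (NLFT.coeffs (NLFT.conjL a)) (NLFT.coeffs b) u,
              ∃ (E : Matrix (Fin n) (Fin n) ℂ) (q : Fin n → ℂ),
                (NLFT.matL n (NLFT.coeffs (NLFT.conjL a)) (NLFT.coeffs b) + E) *ᵥ
                    (fun k : Fin n => out.1.γ k) =
                  (NLFT.coeffs (NLFT.conjL a) 0)⁻¹ •
                    ((fun k : Fin n => NLFT.coeffs b k) + q) ∧
                ‖E‖ ≤ NLFT.growth C n η * u *
                  ‖NLFT.matL n (NLFT.coeffs (NLFT.conjL a)) (NLFT.coeffs b)‖ ∧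
                NLFT.norm2 q ≤ NLFT.growth C n η * u *
                  NLFT.norm2 (fun k : Fin n => NLFT.coeffs b k))) := by
  refine ⟨100000, by norm_num, fun n u a b hn _ out hout => ?_, ?_⟩
  · refine (NLFT.cost_invNLFFT_log hn a b out hout).trans ?_
    gcongr
    norm_num
  intro n η a b hη hη1 hab ho hdeg
  obtain ⟨⟨hS, hα, hre, him⟩, hb, hpos, hsup⟩ := hab
  set α := NLFT.conjL a with hαdef
  dsimp only at hS hα hre him hb hpos hsup
  have haα : a = NLFT.conjL α := (NLFT.conjL_conjL a).symm
  have hnorm : α * NLFT.conjL α + b * NLFT.conjL b = 1 := by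
    rw [← haα, mul_comm]
    exact hS
  -- For `n = 0` the degree condition forces `b = 0`, against the positive supremum.
  have hn : 1 ≤ n := by
    rw [Nat.one_le_iff_ne_zero]
    rintro rfl
    obtain rfl : b = 0 := by
      ext k
      rcases lt_or_ge k 0 with hk | hk
      · exact hb k hk
      · exact hdeg k (by simpa using hk)
    simp [NLFT.evalL_zero] at hpos
  have hΛ : 0 ≤ Real.log n ^ 2 + Real.log n * Real.log η⁻¹ := by
    have h1 : 0 ≤ Real.log n := Real.log_natCast_nonneg n
    have h2 : 0 ≤ Real.log η⁻¹ := Real.log_nonneg ((one_lt_inv₀ hη).2 hη1).le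
    positivity
  obtain ⟨x, hx, hxη⟩ := NLFT.exists_reciprocal hη hη1 ho hnorm hsup
  have hN := NLFT.normSq2_coeffs_le hα hb hnorm
  have hα0 : NLFT.coeffs α 0 ≠ 0 := fun h => by
    have : α.coeff 0 = 0 := h
    simp [this] at hre
  refine ⟨fun k => NLFT.stripSeq (NLFT.coeffs α) (NLFT.coeffs b) k, ⟨?_, fun γ' hγ' => ?_⟩,
    fun ε r hε hε1 hr out hout => ?_, fun u hu hCu out hout => ?_⟩
  · rw [NLFT.nlft_stripSeq n α b hα hb hnorm hre him hdeg, ← haα]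
  · obtain ⟨α', b', -, -, -, h, hs⟩ := NLFT.exists_of_nlft γ'
    obtain ⟨h1, rfl⟩ := NLFT.pairMatrix_injective (h.symm.trans hγ')
    have h2 : α' = α := by rw [hαdef, ← h1, NLFT.conjL_conjL]
    rw [h2] at hs
    exact funext fun k => (hs k).symm
  · have hG := NLFT.growth_mul_le hε hε1 hΛ hr
    exact (NLFT.ens_forward_growth hn hη hη1 hx hxη hN (by positivity) (by linarith) out hout).trans
      (mul_le_mul_of_nonneg_right hG (NLFT.norm2_nonneg _))
  · have hn' : (1 : ℝ) ≤ n := by exact_mod_cast hn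
    have hη' : 1 ≤ η⁻¹ := ((one_lt_inv₀ hη).2 hη1).le
    have hg0 : 0 ≤ NLFT.growth 100000 n η * u := by
      rw [NLFT.growth]
      positivity
    have h1 : 100000 * (NLFT.growth 100000 n η * u) ≤ 1 := by
      refine le_trans ?_ hCu
      have h3 : 1 ≤ (n : ℝ) ^ 3 * η⁻¹ ^ 3 :=
        one_le_mul_of_one_le_of_one_le (one_le_pow₀ hn') (one_le_pow₀ hη')
      calc 100000 * (NLFT.growth 100000 n η * u)
          ≤ (n : ℝ) ^ 3 * η⁻¹ ^ 3 * (100000 * (NLFT.growth 100000 n η * u)) :=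
            le_mul_of_one_le_left (by positivity) h3
        _ = _ := by ring
    -- Raising the constant from 1000 to 100000 gains a factor 100, which covers the factor 2 of
    -- `exists_backward_error` and its smallness condition.
    have h2 : NLFT.growth 1000 n η * u ≤ 1000 / 100000 * (NLFT.growth 100000 n η * u) := by
      rw [← mul_assoc]
      exact mul_le_mul_of_nonneg_right
        (NLFT.growth_le_growth (by norm_num) (by norm_num) hΛ) hu
    have hG0 : 0 ≤ NLFT.growth 1000 n η * u := by
      rw [NLFT.growth]
      positivity
    have hfw := NLFT.ens_forward_growth hn hη hη1 hx hxη hN hu (by linarith) out hout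
    obtain ⟨E, hE, hE'⟩ := NLFT.exists_backward_error
      (NLFT.matL n (NLFT.coeffs α) (NLFT.coeffs b)) hG0 (by linarith)
      (NLFT.matL_mulVec hα0 n) hfw
    -- The whole backward error is placed in the matrix; the right-hand side is not perturbed.
    refine ⟨E, 0, by rw [add_zero]; exact hE, hE'.trans ?_, ?_⟩
    · exact mul_le_mul_of_nonneg_right (by linarith) (norm_nonneg _)
    · rw [show NLFT.norm2 (0 : Fin n → ℂ) = 0 by simp [NLFT.norm2]]
      exact mul_nonneg hg0 (NLFT.norm2_nonneg _)
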